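/- Let $C$ be a smooth projective (irreducible) curve over $\mathbb{C}$, and let $G$ be an affine algebraic group over $\mathbb{C}$ whose Lie algebra $\mathfrak g$ is simple (for example a semisimple affine algebraic group with simple Lie algebra). Then: 1. There is a unique linear map $P\colon \mathfrak{gl}(\mathfrak g)\to\mathfrak g$ with $P(\mathrm{ad}\,X)=X$ for all $X\in\mathfrak g$ and $P(A)=0$ whenever $\mathrm{tr}(A\circ \mathrm{ad}\,X)=0$ for all $X\in\mathfrak g$, i.e. the orthogonal projection of $\mathfrak{gl}(\mathfrak g)$ onto $\mathfrak g$ (embedded by the adjoint representation) for the form $(A,B)\mapsto\mathrm{tr}(AB)$. 2. For an algebraic principal $G$-bundle $E_G\to C$ let $\mathcal C(E_G)$ be the set of algebraic connections on $E_G$ (equivariant $\mathfrak g$-valued algebraic one-forms on $E_G$ that take the value $X$ on the fundamental vector field of each $X\in\mathfrak g$) and $\mathcal C(\mathrm{ad}(E_G))$ the set of algebraic connections on the adjoint vector bundle $\mathrm{ad}(E_G)=E_G\times^G\mathfrak g$. Each $\omega\in\mathcal C(E_G)$ induces a unique connection $\Phi_0(\omega)\in\mathcal C(\mathrm{ad}(E_G))$,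 determined by the condition that, for local sections $s$ of $\mathrm{ad}(E_G)$, viewed as equivariant $\mathfrak g$-valued functions on $E_G$, the pullback of $\Phi_0(\omega)s$ to $E_G$ is $ds+[\omega,s]$. 3. For each $\nabla\in\mathcal C(\mathrm{ad}(E_G))$ there is a unique $\mathfrak{gl}(\mathfrak g)$-valued algebraic one-form $\theta_\nabla$ on $E_G$ such that the pullback of $\nabla s$ to $E_G$ is $ds+\theta_\nabla s$ for all local sections $s$ of $\mathrm{ad}(E_G)$ (the form $\theta_\nabla$ is the pullback of the connection form of $\nabla$ along the natural map from $E_G$ to the frame bundle of $\mathrm{ad}(E_G)$). The form $P\circ\theta_\nabla$ is an algebraic connection on $E_G$, so that there is a map $$\Phi\colon \mathcal C(\mathrm{ad}(E_G))\longrightarrow \mathcal C(E_G),\qquad \Phi(\nabla)=P\circ\theta_\nabla .$$ This map is natural: it is compatible with pullback of connections along every morphism of principal $G$-bundles over $C$. 4. $\Phi\circ\Phi_0=\mathrm{Id}_{\mathcal C(E_G)}$. -/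

import Mathlib

/-!
# Algebraic connections on a principal bundle and on its adjoint bundle

All schemes are over `Spec ℂ`.  An affine algebraic group `G` is given by its coordinate ring `H`,
a commutative Hopf algebra over `ℂ`, so that `G = Spec H`.
-/

namespace PrincipalConnections

open CategoryTheory AlgebraicGeometry MonoidalCategory CartesianMonoidalCategory
open scoped TensorProduct KaehlerDifferential MonObj

noncomputable section

/-! ### Schemes over the complex numbers and their functions -/

lemma lift_toUnit_comp {𝒞 : Type*} [Category 𝒞] [CartesianMonoidalCategory 𝒞] {X E G : 𝒞}
    (x : X ⟶ E) (e : 𝟙_ 𝒞 ⟶ G) :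
    lift x (toUnit X ≫ e) = x ≫ (ρ_ E).inv ≫ (E ◁ e) := by
  ext <;> simp

/-- Schemes over `ℂ`. -/
abbrev CScheme : Type 1 := Over (Spec (.of ℂ))

/-- The affine scheme `Spec R` of a `ℂ`-algebra `R`. -/
abbrev SpecC (R : Type) [CommRing R] [Algebra ℂ R] : CScheme :=
  (Spec (.of R)).asOver (Spec (.of ℂ))

lemma le_preimage_top {X Y : Scheme.{0}} (f : X ⟶ Y) (V : X.Opens) : V ≤ f ⁻¹ᵁ ⊤ := le_top

/-- The structure morphism to `Spec ℂ`. -/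
abbrev str (X : CScheme) : X.left ⟶ Spec (.of ℂ) := X.hom

lemma left_str {X Y : CScheme} (f : X ⟶ Y) : f.left ≫ str Y = str X := Over.w f

/-- The functions on an open subset of a scheme over `ℂ` form a `ℂ`-algebra. -/
instance sectionsAlgebra (X : CScheme) (U : X.left.Opens) : Algebra ℂ Γ(X.left, U) :=
  ((Scheme.ΓSpecIso (.of ℂ)).inv ≫ (str X).appLE ⊤ U (le_preimage_top _ _)).hom.toAlgebra

lemma appLE_congr_hom {X Y : Scheme.{0}} {f g : X ⟶ Y} (e : f = g) (U : Y.Opens) (V : X.Opens)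
    (h : V ≤ f ⁻¹ᵁ U) (h' : V ≤ g ⁻¹ᵁ U) : f.appLE U V h = g.appLE U V h' := by
  subst e; rfl

lemma appLE_specMap_top {R S : CommRingCat.{0}} (φ : R ⟶ S) {f : Spec S ⟶ Spec R}
    (e : f = Spec.map φ) (h : ⊤ ≤ f ⁻¹ᵁ ⊤) :
    f.appLE ⊤ ⊤ h ≫ (Scheme.ΓSpecIso S).hom = (Scheme.ΓSpecIso R).hom ≫ φ := by
  subst e
  rw [← Scheme.ΓSpecIso_naturality, Scheme.Hom.appLE]
  congr 1

/-- Pullback of functions along a morphism of schemes over `ℂ`; along the identity this is the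
restriction from `U` to `V`. -/
def pull {X Y : CScheme} (f : X ⟶ Y) (U : Y.left.Opens) (V : X.left.Opens)
    (h : V ≤ f.left ⁻¹ᵁ U) : Γ(Y.left, U) →ₐ[ℂ] Γ(X.left, V) where
  toRingHom := (f.left.appLE U V h).hom
  commutes' c := by
    have h1 : (str Y).appLE ⊤ U (le_preimage_top _ _) ≫ f.left.appLE U V h =
        (str X).appLE ⊤ V (le_preimage_top _ _) := by
      rw [Scheme.Hom.appLE_comp_appLE]
      exact appLE_congr_hom (left_str f) _ _ _ _
    exact congrArg (fun φ => φ.hom ((Scheme.ΓSpecIso (.of ℂ)).inv.hom c)) h1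

lemma pull_pull {X Y Z : CScheme} (f : X ⟶ Y) (g : Y ⟶ Z) (U : Z.left.Opens) (V : Y.left.Opens)
    (W : X.left.Opens) (h : V ≤ g.left ⁻¹ᵁ U) (h' : W ≤ f.left ⁻¹ᵁ V)
    (h'' : W ≤ (f ≫ g).left ⁻¹ᵁ U) (s : Γ(Z.left, U)) :
    pull f V W h' (pull g U V h s) = pull (f ≫ g) U W h'' s :=
  congrArg (fun φ => φ.hom s) (Scheme.Hom.appLE_comp_appLE f.left g.left U V W h h')

/-- Pullback of functions on `U` along a morphism `Spec R ⟶ Y` that lands in `U`. -/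
def pullSpec {Y : CScheme} {R : Type} [CommRing R] [Algebra ℂ R] (f : SpecC R ⟶ Y)
    (U : Y.left.Opens) (h : ⊤ ≤ f.left ⁻¹ᵁ U) : Γ(Y.left, U) →ₐ[ℂ] R where
  toRingHom := (f.left.appLE U ⊤ h ≫ (Scheme.ΓSpecIso (.of R)).hom).hom
  commutes' c := by
    have h1 : (str Y).appLE ⊤ U (le_preimage_top _ _) ≫ f.left.appLE U ⊤ h =
        (str (SpecC R)).appLE ⊤ ⊤ (le_preimage_top _ _) := by
      rw [Scheme.Hom.appLE_comp_appLE]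
      exact appLE_congr_hom (left_str f) _ _ _ _
    have h2 : (str (SpecC R)).appLE ⊤ ⊤ (le_preimage_top _ _) ≫ (Scheme.ΓSpecIso (.of R)).hom =
        (Scheme.ΓSpecIso (.of ℂ)).hom ≫ CommRingCat.ofHom (algebraMap ℂ R) :=
      appLE_specMap_top _ rfl _
    rw [← h1] at h2
    have h3 := congrArg (fun φ => φ.hom ((Scheme.ΓSpecIso (.of ℂ)).inv.hom c)) h2
    refine h3.trans ?_
    have h4 : (Scheme.ΓSpecIso (.of ℂ)).inv ≫ (Scheme.ΓSpecIso (.of ℂ)).hom = 𝟙 _ :=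
      Iso.inv_hom_id _
    exact congrArg (algebraMap ℂ R) (congrArg (fun φ => φ.hom c) h4)

lemma pullSpec_pull {X Y : CScheme} {R : Type} [CommRing R] [Algebra ℂ R] (f : SpecC R ⟶ X)
    (g : X ⟶ Y) (U : Y.left.Opens) (V : X.left.Opens) (h : ⊤ ≤ f.left ⁻¹ᵁ V)
    (h' : V ≤ g.left ⁻¹ᵁ U) (h'' : ⊤ ≤ (f ≫ g).left ⁻¹ᵁ U) (s : Γ(Y.left, U)) :
    pullSpec f V h (pull g U V h' s) = pullSpec (f ≫ g) U h'' s :=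
  congrArg (fun φ => (Scheme.ΓSpecIso (.of R)).hom.hom (φ.hom s))
    (Scheme.Hom.appLE_comp_appLE f.left g.left U V ⊤ h' h)

/-- The morphism of spectra of a homomorphism of `ℂ`-algebras. -/
def specMap {R R' : Type} [CommRing R] [Algebra ℂ R] [CommRing R'] [Algebra ℂ R']
    (φ : R →ₐ[ℂ] R') : SpecC R' ⟶ SpecC R :=
  Over.homMk (Spec.map (CommRingCat.ofHom φ.toRingHom)) (by
    change Spec.map _ ≫ Spec.map (CommRingCat.ofHom (algebraMap ℂ R)) =
      Spec.map (CommRingCat.ofHom (algebraMap ℂ R'))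
    rw [← Spec.map_comp, ← CommRingCat.ofHom_comp]
    congr 2
    exact φ.comp_algebraMap)

lemma specMap_id (R : Type) [CommRing R] [Algebra ℂ R] :
    specMap (AlgHom.id ℂ R) = 𝟙 (SpecC R) := by
  ext : 1
  exact Spec.map_id _

lemma specMap_comp {R R' R'' : Type} [CommRing R] [Algebra ℂ R] [CommRing R'] [Algebra ℂ R']
    [CommRing R''] [Algebra ℂ R''] (φ : R →ₐ[ℂ] R') (ψ : R' →ₐ[ℂ] R'') :
    specMap (ψ.comp φ) = specMap ψ ≫ specMap φ := by
  ext : 1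
  exact Spec.map_comp (CommRingCat.ofHom φ.toRingHom) (CommRingCat.ofHom ψ.toRingHom)

lemma specMap_ofId_comp_counit {R H : Type} [CommRing R] [Algebra ℂ R] [CommRing H]
    [HopfAlgebra ℂ H] : specMap ((Algebra.ofId ℂ R).comp (Bialgebra.counitAlgHom ℂ H)) =
      toUnit (SpecC R) ≫ η[SpecC H] := by
  have h1 : (toUnit (SpecC R)).left = Spec.map (CommRingCat.ofHom (algebraMap ℂ R)) :=
    Over.toUnit_left
  have h2 : (η[SpecC H]).left =
      Spec.map (CommRingCat.ofHom (Bialgebra.counitAlgHom ℂ H).toRingHom) :=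
    one_spec_asOver_spec_left
  have h3 : (toUnit (SpecC R) ≫ η[SpecC H]).left =
      Spec.map (CommRingCat.ofHom (algebraMap ℂ R)) ≫
        Spec.map (CommRingCat.ofHom (Bialgebra.counitAlgHom ℂ H).toRingHom) := by
    rw [← h1, ← h2]
    exact Over.comp_left _ _ _ _ _
  refine Over.OverMorphism.ext (Eq.trans ?_ h3.symm)
  rw [← Spec.map_comp, ← CommRingCat.ofHom_comp]
  rfl

lemma pull_congr {X Y : CScheme} {f g : X ⟶ Y} (e : f = g) (U : Y.left.Opens) (V : X.left.Opens)
    (h : V ≤ f.left ⁻¹ᵁ U) (h' : V ≤ g.left ⁻¹ᵁ U) (s : Γ(Y.left, U)) :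
    pull f U V h s = pull g U V h' s := by
  subst e; rfl

lemma pullSpec_congr {Y : CScheme} {R : Type} [CommRing R] [Algebra ℂ R] {f g : SpecC R ⟶ Y}
    (e : f = g) (U : Y.left.Opens) (h : ⊤ ≤ f.left ⁻¹ᵁ U) (h' : ⊤ ≤ g.left ⁻¹ᵁ U)
    (s : Γ(Y.left, U)) : pullSpec f U h s = pullSpec g U h' s := by
  subst e; rfl

lemma pullSpec_specMap {Y : CScheme} {R R' : Type} [CommRing R] [Algebra ℂ R] [CommRing R']
    [Algebra ℂ R'] (φ : R →ₐ[ℂ] R') (f : SpecC R ⟶ Y) (U : Y.left.Opens)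
    (h : ⊤ ≤ f.left ⁻¹ᵁ U) (h' : ⊤ ≤ (specMap φ ≫ f).left ⁻¹ᵁ U) (s : Γ(Y.left, U)) :
    pullSpec (specMap φ ≫ f) U h' s = φ (pullSpec f U h s) := by
  have h1 : f.left.appLE U ⊤ h ≫ (specMap φ).left.appLE ⊤ ⊤ (le_preimage_top _ _) =
      (specMap φ ≫ f).left.appLE U ⊤ h' := Scheme.Hom.appLE_comp_appLE _ _ _ _ _ _ _
  have h2 : (specMap φ).left.appLE ⊤ ⊤ (le_preimage_top _ _) ≫
      (Scheme.ΓSpecIso (.of R')).hom =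
      (Scheme.ΓSpecIso (.of R)).hom ≫ CommRingCat.ofHom φ.toRingHom :=
    appLE_specMap_top _ rfl _
  have h3 := congrArg (fun ψ => ψ.hom s) h1
  have h4 := congrArg (fun ψ => ψ.hom ((f.left.appLE U ⊤ h).hom s)) h2
  exact (congrArg (Scheme.ΓSpecIso (.of R')).hom.hom h3.symm).trans h4

/-- The inclusion of an affine open subset, as a morphism from the spectrum of its ring. -/
def fromSpecC {X : CScheme} {U : X.left.Opens} (hU : IsAffineOpen U) :
    SpecC Γ(X.left, U) ⟶ X :=
  Over.homMk hU.fromSpec (by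
    change hU.fromSpec ≫ str X = Spec.map (CommRingCat.ofHom (algebraMap ℂ Γ(X.left, U)))
    have h1 := (isAffineOpen_top (Spec (.of ℂ))).SpecMap_appLE_fromSpec (str X) hU
      (i := le_preimage_top _ _)
    rw [← h1, IsAffineOpen.fromSpec_top, Scheme.isoSpec_Spec_inv, ← Spec.map_comp]
    rfl)

lemma fromSpecC_le {X : CScheme} {U : X.left.Opens} (hU : IsAffineOpen U) :
    ⊤ ≤ (fromSpecC hU).left ⁻¹ᵁ U := hU.fromSpec_preimage_self.ge

lemma pullSpec_fromSpecC {X : CScheme} {U : X.left.Opens} (hU : IsAffineOpen U)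
    (s : Γ(X.left, U)) : pullSpec (fromSpecC hU) U (fromSpecC_le hU) s = s := by
  have h1 : hU.fromSpec.appLE U ⊤ hU.fromSpec_preimage_self.ge ≫
      (Scheme.ΓSpecIso Γ(X.left, U)).hom = 𝟙 _ := by
    rw [Scheme.Hom.appLE, hU.fromSpec_app_self, Category.assoc, Category.assoc, Iso.inv_comp_eq,
      ← Category.assoc, ← Functor.map_comp, ← op_comp, Category.comp_id]
    exact (congrArg (· ≫ _) ((Spec Γ(X.left, U)).presheaf.map_id _)).trans (Category.id_comp _)
  exact congrArg (fun φ => φ.hom s) h1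

lemma specMap_pull_fromSpecC {X Y : CScheme} (f : X ⟶ Y) {U : Y.left.Opens} {V : X.left.Opens}
    (hU : IsAffineOpen U) (hV : IsAffineOpen V) (h : V ≤ f.left ⁻¹ᵁ U) :
    specMap (pull f U V h) ≫ fromSpecC hU = fromSpecC hV ≫ f := by
  ext : 1
  exact hU.SpecMap_appLE_fromSpec f.left hV h

/-! ### The group -/

section Group

variable (H : Type) [CommRing H] [HopfAlgebra ℂ H]

/-- The Lie algebra of `G = Spec H`: the left-invariant derivations of `H` (those with
`Δ ∘ D = (id ⊗ D) ∘ Δ`), with the commutator bracket. -/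
def lieAlg : LieSubalgebra ℂ (Derivation ℂ H H) where
  carrier := {D | Coalgebra.comul (R := ℂ) ∘ₗ (D : H →ₗ[ℂ] H) =
    (D : H →ₗ[ℂ] H).lTensor H ∘ₗ Coalgebra.comul}
  add_mem' {D D'} h h' := by
    simp only [Set.mem_ofPred_eq, Derivation.coe_add_linearMap, LinearMap.comp_add,
      LinearMap.lTensor_add, LinearMap.add_comp] at *
    rw [h, h']
  zero_mem' := by simp
  smul_mem' c D h := by
    simp only [Set.mem_ofPred_eq, Derivation.coe_smul_linearMap, LinearMap.comp_smul,
      LinearMap.lTensor_smul, LinearMap.smul_comp] at *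
    rw [h]
  lie_mem' {D D'} h h' := by
    simp only [Set.mem_ofPred_eq] at *
    have e : ((⁅D, D'⁆ : Derivation ℂ H H) : H →ₗ[ℂ] H) =
        (D : H →ₗ[ℂ] H) ∘ₗ (D' : H →ₗ[ℂ] H) - (D' : H →ₗ[ℂ] H) ∘ₗ (D : H →ₗ[ℂ] H) := by
      ext x; change (⁅D, D'⁆ : Derivation ℂ H H) x = _; rw [Derivation.commutator_apply]; rfl
    rw [e, LinearMap.comp_sub, LinearMap.lTensor_sub, LinearMap.sub_comp, LinearMap.lTensor_comp,
      LinearMap.lTensor_comp, LinearMap.comp_assoc, LinearMap.comp_assoc, ← h, ← h',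
      ← LinearMap.comp_assoc, ← LinearMap.comp_assoc, ← LinearMap.comp_assoc,
      ← LinearMap.comp_assoc, h, h']

variable {H}

/-- For a point `g` of `G`, the map `b ⊗ h ↦ h(g) b`. -/
def evalRight (B : Type) [CommRing B] [Algebra ℂ B] (g : H →ₐ[ℂ] ℂ) : B ⊗[ℂ] H →ₐ[ℂ] B :=
  (Algebra.TensorProduct.rid ℂ ℂ B).toAlgHom.comp (Algebra.TensorProduct.map (AlgHom.id ℂ B) g)

@[simp] lemma evalRight_tmul (B : Type) [CommRing B] [Algebra ℂ B] (g : H →ₐ[ℂ] ℂ) (b : B)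
    (h : H) : evalRight B g (b ⊗ₜ h) = g h • b := by
  simp [evalRight]

lemma evalRight_natural {B B' : Type} [CommRing B] [Algebra ℂ B] [CommRing B'] [Algebra ℂ B']
    (φ : B →ₐ[ℂ] B') (g : H →ₐ[ℂ] ℂ) (x : B ⊗[ℂ] H) :
    evalRight B' g (Algebra.TensorProduct.map φ (AlgHom.id ℂ H) x) = φ (evalRight B g x) := by
  induction x with
  | zero => simp
  | add x y hx hy => simp only [map_add, hx, hy]
  | tmul b h => simp

/-- Right translation of functions on `G`: `f` goes to the function `x ↦ f (x g)`. -/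
def rightTranslate (g : H →ₐ[ℂ] ℂ) : H →ₐ[ℂ] H :=
  (evalRight H g).comp (Bialgebra.comulAlgHom ℂ H)

/-- The inverse of a point of `G`. -/
def pointInv (g : H →ₐ[ℂ] ℂ) : H →ₐ[ℂ] ℂ := g.comp (HopfAlgebra.antipodeAlgHom ℂ H)

lemma comul_rightTranslate (g : H →ₐ[ℂ] ℂ) (f : H) :
    Coalgebra.comul (R := ℂ) (rightTranslate g f) =
      (rightTranslate g).toLinearMap.lTensor H (Coalgebra.comul (R := ℂ) f) := by
  have key : ∀ x : H ⊗[ℂ] H, Coalgebra.comul (R := ℂ) (evalRight H g x) =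
      (evalRight H g).toLinearMap.lTensor H
        (TensorProduct.assoc ℂ H H H ((Coalgebra.comul (R := ℂ)).rTensor H x)) := by
    intro x
    induction x with
    | zero => simp
    | add x y hx hy => simp only [map_add, hx, hy]
    | tmul a b =>
      simp only [evalRight_tmul, map_smul, LinearMap.rTensor_tmul]
      generalize (Coalgebra.comul (R := ℂ) a) = y
      induction y with
      | zero => simp
      | add x y hx hy => simp only [map_add, hx, hy, smul_add, TensorProduct.add_tmul]
      | tmul c d => simp
  have := key (Coalgebra.comul (R := ℂ) f)
  rw [Coalgebra.coassoc_apply] at this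
  refine this.trans ?_
  rw [← LinearMap.lTensor_comp_apply]
  rfl

lemma rightTranslate_comp_inv (g : H →ₐ[ℂ] ℂ) (f : H) :
    rightTranslate g (rightTranslate (pointInv g) f) = f := by
  let T : H ⊗[ℂ] H →ₗ[ℂ] ℂ :=
    g.toLinearMap ∘ₗ LinearMap.mul' ℂ H ∘ₗ (HopfAlgebra.antipode ℂ).lTensor H
  have hT : T ∘ₗ Coalgebra.comul = Coalgebra.counit := by
    ext x
    simp only [T, LinearMap.comp_apply, HopfAlgebra.mul_antipode_lTensor_comul_apply]
    exact g.commutes _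
  have key : ∀ x : H ⊗[ℂ] H, rightTranslate g (evalRight H (pointInv g) x) =
      TensorProduct.rid ℂ H (T.lTensor H
        (TensorProduct.assoc ℂ H H H ((Coalgebra.comul (R := ℂ)).rTensor H x))) := by
    intro x
    induction x with
    | zero => simp
    | add x y hx hy => simp only [map_add, hx, hy]
    | tmul a b =>
      simp only [evalRight_tmul, map_smul, LinearMap.rTensor_tmul, rightTranslate,
        AlgHom.comp_apply, Bialgebra.comulAlgHom_apply]
      generalize (Coalgebra.comul (R := ℂ) a) = y
      induction y with
      | zero => simp
      | add x y hx hy => simp only [map_add, hx, hy, smul_add, TensorProduct.add_tmul]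
      | tmul c d => simp [T, pointInv, smul_smul, mul_comm]
  have := key (Coalgebra.comul (R := ℂ) f)
  rw [Coalgebra.coassoc_apply, ← LinearMap.lTensor_comp_apply, hT,
    Coalgebra.lTensor_counit_comul] at this
  refine this.trans ?_
  simp

variable (H) in
/-- The adjoint action of a point `g` of `G` on the Lie algebra: `D` goes to
`R_g ∘ D ∘ R_{g⁻¹}`, where `R_g` is right translation of functions by `g`. -/
def adjoint (g : H →ₐ[ℂ] ℂ) : lieAlg H →ₗ[ℂ] lieAlg H where
  toFun D := ⟨Derivation.mk' ((rightTranslate g).toLinearMap ∘ₗ (D.1 : H →ₗ[ℂ] H) ∘ₗ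
      (rightTranslate (pointInv g)).toLinearMap) (fun a b => by
        simp [rightTranslate_comp_inv]), by
    have hD : ∀ x, Coalgebra.comul (R := ℂ) (D.1 x) =
        (D.1 : H →ₗ[ℂ] H).lTensor H (Coalgebra.comul (R := ℂ) x) := LinearMap.congr_fun D.2
    refine LinearMap.ext fun x => ?_
    change Coalgebra.comul (R := ℂ) (rightTranslate g (D.1 (rightTranslate (pointInv g) x))) =
      ((rightTranslate g).toLinearMap ∘ₗ (D.1 : H →ₗ[ℂ] H) ∘ₗ
      (rightTranslate (pointInv g)).toLinearMap).lTensor H (Coalgebra.comul (R := ℂ) x)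
    rw [comul_rightTranslate, hD, comul_rightTranslate, LinearMap.lTensor_comp_apply,
      LinearMap.lTensor_comp_apply]⟩
  map_add' D D' := Subtype.ext (Derivation.ext fun _ => map_add (rightTranslate g) _ _)
  map_smul' c D := Subtype.ext (Derivation.ext fun _ => map_smul (rightTranslate g) c _)

section Coaction

variable {B B' : Type} [CommRing B] [Algebra ℂ B] [CommRing B'] [Algebra ℂ B']

/-- For a linear form `δ` on `H`, the map `b ⊗ h ↦ δ(h) b`. -/
def contractRight (B : Type) [CommRing B] [Algebra ℂ B] (δ : H →ₗ[ℂ] ℂ) : B ⊗[ℂ] H →ₗ[ℂ] B :=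
  (TensorProduct.rid ℂ B).toLinearMap ∘ₗ δ.lTensor B

lemma contractRight_mul (D : lieAlg H) (x y : B ⊗[ℂ] H) :
    contractRight B (Coalgebra.counit (R := ℂ) ∘ₗ (D.1 : H →ₗ[ℂ] H)) (x * y) =
      evalRight B (Bialgebra.counitAlgHom ℂ H) x *
        contractRight B (Coalgebra.counit (R := ℂ) ∘ₗ (D.1 : H →ₗ[ℂ] H)) y +
      evalRight B (Bialgebra.counitAlgHom ℂ H) y *
        contractRight B (Coalgebra.counit (R := ℂ) ∘ₗ (D.1 : H →ₗ[ℂ] H)) x := by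
  induction x with
  | zero => simp
  | add x x' hx hx' => simp only [add_mul, mul_add, map_add, hx, hx']; ring
  | tmul b h =>
    induction y with
    | zero => simp
    | add y y' hy hy' => simp only [add_mul, mul_add, map_add, hy, hy']; ring
    | tmul b' h' =>
      simp [contractRight, add_smul, smul_smul, mul_comm]

/-- The derivation of `B` given by a coaction `ρ : B → B ⊗ H` and an element `D` of the Lie algebra:
`b ↦ (id ⊗ D_e) (ρ b)`, with `D_e = ε ∘ D` the tangent vector of `D` at the identity. -/
def coactionField (ρ : B →ₐ[ℂ] B ⊗[ℂ] H)
    (hρ : ∀ b, evalRight B (Bialgebra.counitAlgHom ℂ H) (ρ b) = b) (D : lieAlg H) :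
    Derivation ℂ B B :=
  Derivation.mk' (contractRight B (Coalgebra.counit (R := ℂ) ∘ₗ (D.1 : H →ₗ[ℂ] H)) ∘ₗ
    ρ.toLinearMap) (fun b c => by
      have := contractRight_mul D (ρ b) (ρ c)
      rw [hρ, hρ, ← map_mul] at this
      exact this)

lemma map_smul_adjoint {A : Type} [CommRing A] [Algebra ℂ A] [Algebra A B] [IsScalarTower ℂ A B]
    (T : B →ₐ[ℂ] B) (hT : ∀ a : A, T (algebraMap A B a) = algebraMap A B a)
    (g : H →ₐ[ℂ] ℂ) (a : A) (s : B ⊗[ℂ] lieAlg H) :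
    TensorProduct.map T.toLinearMap (adjoint H g) (a • s) =
      a • TensorProduct.map T.toLinearMap (adjoint H g) s := by
  induction s with
  | zero => simp
  | add x y hx hy => simp only [smul_add, map_add, hx, hy]
  | tmul b X => simp [TensorProduct.smul_tmul', Algebra.smul_def, hT]

lemma map_adjoint_rTensor (T : B →ₐ[ℂ] B) (T' : B' →ₐ[ℂ] B') (φ : B →ₐ[ℂ] B')
    (h : ∀ b, φ (T b) = T' (φ b)) (g : H →ₐ[ℂ] ℂ) (s : B ⊗[ℂ] lieAlg H) :
    TensorProduct.map T'.toLinearMap (adjoint H g) (φ.toLinearMap.rTensor (lieAlg H) s) =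
      φ.toLinearMap.rTensor (lieAlg H) (TensorProduct.map T.toLinearMap (adjoint H g) s) := by
  induction s with
  | zero => simp
  | add x y hx hy => simp only [map_add, hx, hy]
  | tmul b X => simp [h]

lemma rTensor_smul {A A' : Type} [CommRing A] [Algebra ℂ A] [Algebra A B] [IsScalarTower ℂ A B]
    [CommRing A'] [Algebra ℂ A'] [Algebra A' B'] [IsScalarTower ℂ A' B']
    (φ : B →ₐ[ℂ] B') (ψ : A →ₐ[ℂ] A') (h : ∀ a, φ (algebraMap A B a) = algebraMap A' B' (ψ a))
    (V : Type) [AddCommGroup V] [Module ℂ V] (a : A) (s : B ⊗[ℂ] V) :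
    φ.toLinearMap.rTensor V (a • s) = ψ a • φ.toLinearMap.rTensor V s := by
  induction s with
  | zero => simp
  | add x y hx hy => simp only [smul_add, map_add, hx, hy]
  | tmul b X => simp [TensorProduct.smul_tmul', Algebra.smul_def, h]

/-- The map on Kähler differentials induced by a homomorphism of `ℂ`-algebras. -/
def kmap (φ : B →ₐ[ℂ] B') : Ω[B⁄ℂ] →ₗ[ℂ] Ω[B'⁄ℂ] :=
  letI := φ.toAlgebra
  haveI : IsScalarTower ℂ B B' := IsScalarTower.of_algebraMap_eq' φ.comp_algebraMap.symm
  (KaehlerDifferential.map ℂ ℂ B B').restrictScalars ℂ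

lemma kmap_D (φ : B →ₐ[ℂ] B') (b : B) :
    kmap φ (KaehlerDifferential.D ℂ B b) = KaehlerDifferential.D ℂ B' (φ b) := by
  let := φ.toAlgebra
  have : IsScalarTower ℂ B B' := IsScalarTower.of_algebraMap_eq' φ.comp_algebraMap.symm
  exact KaehlerDifferential.map_D ℂ ℂ B B' b

lemma kmap_smul (φ : B →ₐ[ℂ] B') (b : B) (τ : Ω[B⁄ℂ]) : kmap φ (b • τ) = φ b • kmap φ τ := by
  let := φ.toAlgebra
  have : IsScalarTower ℂ B B' := IsScalarTower.of_algebraMap_eq' φ.comp_algebraMap.symm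
  exact (map_smul (KaehlerDifferential.map ℂ ℂ B B') b τ).trans (algebraMap_smul B' b _).symm

/-- Multiplication of a one-form with a vector-valued function: `b ⊗ v ↦ b τ ⊗ v`. -/
def formMul (V : Type) [AddCommGroup V] [Module ℂ V] (τ : Ω[B⁄ℂ]) :
    B ⊗[ℂ] V →ₗ[ℂ] Ω[B⁄ℂ] ⊗[ℂ] V :=
  ((LinearMap.toSpanSingleton B Ω[B⁄ℂ] τ).restrictScalars ℂ).rTensor V

lemma formMul_smul (V : Type) [AddCommGroup V] [Module ℂ V] {A : Type} [CommRing A] [Algebra ℂ A]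
    [Algebra A B] [IsScalarTower ℂ A B] (a : A) (τ : Ω[B⁄ℂ]) (s : B ⊗[ℂ] V) :
    formMul V (algebraMap A B a • τ) s = formMul V τ (a • s) := by
  induction s with
  | zero => simp
  | add x y hx hy => simp only [smul_add, map_add, hx, hy]
  | tmul b X => 
    simp only [formMul, LinearMap.rTensor_tmul, LinearMap.coe_restrictScalars,
      LinearMap.toSpanSingleton_apply, TensorProduct.smul_tmul', algebraMap_smul, smul_comm b a,
      smul_assoc]

lemma formMul_add (V : Type) [AddCommGroup V] [Module ℂ V] (τ τ' : Ω[B⁄ℂ]) :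
    formMul V (τ + τ') = formMul V τ + formMul V τ' := by
  refine TensorProduct.ext' fun b v => ?_
  simp [formMul, TensorProduct.add_tmul]

/-- The exterior derivative of a vector-valued function: `b ⊗ v ↦ db ⊗ v`. -/
def dSection (V : Type) [AddCommGroup V] [Module ℂ V] : B ⊗[ℂ] V →ₗ[ℂ] Ω[B⁄ℂ] ⊗[ℂ] V :=
  (KaehlerDifferential.D ℂ B : B →ₗ[ℂ] Ω[B⁄ℂ]).rTensor V

/-- An endomorphism-valued one-form applied to a vector-valued function:
`(τ ⊗ T, b ⊗ v) ↦ b τ ⊗ T v`. -/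
def formApply (V : Type) [AddCommGroup V] [Module ℂ V] :
    Ω[B⁄ℂ] ⊗[ℂ] Module.End ℂ V →ₗ[ℂ] B ⊗[ℂ] V →ₗ[ℂ] Ω[B⁄ℂ] ⊗[ℂ] V :=
  TensorProduct.map₂ (Algebra.lsmul ℂ ℂ Ω[B⁄ℂ] : B →ₐ[ℂ] _).toLinearMap.flip LinearMap.id

lemma formApply_tmul (V : Type) [AddCommGroup V] [Module ℂ V] (τ : Ω[B⁄ℂ]) (T : Module.End ℂ V)
    (b : B) (v : V) : formApply V (τ ⊗ₜ T) (b ⊗ₜ v) = (b • τ) ⊗ₜ T v := rfl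

/-- The bracket of a Lie algebra valued one-form with a Lie algebra valued function:
`(τ ⊗ X, b ⊗ Y) ↦ b τ ⊗ ⁅X, Y⁆`. -/
def formBracket (𝔤 : Type) [LieRing 𝔤] [LieAlgebra ℂ 𝔤] :
    Ω[B⁄ℂ] ⊗[ℂ] 𝔤 →ₗ[ℂ] B ⊗[ℂ] 𝔤 →ₗ[ℂ] Ω[B⁄ℂ] ⊗[ℂ] 𝔤 :=
  formApply 𝔤 ∘ₗ (LieAlgebra.ad ℂ 𝔤 : 𝔤 →ₗ[ℂ] Module.End ℂ 𝔤).lTensor Ω[B⁄ℂ]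

lemma formBracket_tmul (𝔤 : Type) [LieRing 𝔤] [LieAlgebra ℂ 𝔤] (τ : Ω[B⁄ℂ]) (X : 𝔤) (b : B)
    (Y : 𝔤) : formBracket 𝔤 (τ ⊗ₜ X) (b ⊗ₜ Y) = (b • τ) ⊗ₜ ⁅X, Y⁆ := rfl

end Coaction

end Group

/-! ### Principal bundles -/

/-- A principal `G`-bundle over `C`, for `G = Spec H`: a flat surjective affine morphism
`proj : tot ⟶ C` with a right action of `G` on `tot` over `C` such that
`tot × G ⟶ tot ×_C tot`, `(x, g) ↦ (x, x g)`, is an isomorphism (which is what the cartesian square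
`isPullback` says).  When `G` is smooth, as every algebraic group over `ℂ` is, this is the same as
local triviality in the étale topology. -/
structure PrincipalBundle (H : Type) [CommRing H] [HopfAlgebra ℂ H] (C : CScheme) where
  tot : CScheme
  proj : tot ⟶ C
  affine : IsAffineHom proj.left
  flat : Flat proj.left
  surjective : Surjective proj.left
  act : tot ⊗ SpecC H ⟶ tot
  act_one : (ρ_ tot).inv ≫ (tot ◁ η[SpecC H]) ≫ act = 𝟙 tot
  act_mul : (α_ tot (SpecC H) (SpecC H)).hom ≫ (tot ◁ μ[SpecC H]) ≫ act = (act ▷ SpecC H) ≫ act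
  act_proj : act ≫ proj = fst tot (SpecC H) ≫ proj
  isPullback : IsPullback (fst tot (SpecC H)) act proj proj

namespace PrincipalBundle

section

variable {H : Type} [CommRing H] [HopfAlgebra ℂ H] {C : CScheme} (P : PrincipalBundle H C)

/-- The preimage of an affine open subset of `C` in the total space. -/
abbrev above (U : C.left.affineOpens) : P.tot.left.Opens := P.proj.left ⁻¹ᵁ U.1

lemma isAffineOpen_above (U : C.left.affineOpens) : IsAffineOpen (P.above U) :=
  haveI := P.affine
  U.2.preimage P.proj.left

/-- The ring of functions on the preimage of `U` in the total space. -/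
abbrev fn (U : C.left.affineOpens) : Type := Γ(P.tot.left, P.above U)

/-- Functions on the preimage of `U` form an algebra over the functions on `U`. -/
instance algebraFn (U : C.left.affineOpens) : Algebra Γ(C.left, U.1) (P.fn U) :=
  (pull P.proj U.1 (P.above U) le_rfl).toAlgebra

instance isScalarTowerFn (U : C.left.affineOpens) : IsScalarTower ℂ Γ(C.left, U.1) (P.fn U) :=
  IsScalarTower.of_algebraMap_eq' (pull P.proj U.1 (P.above U) le_rfl).comp_algebraMap.symm

lemma above_mono {U V : C.left.affineOpens} (h : V ≤ U) : P.above V ≤ P.above U :=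
  fun _ hx => h hx

/-- Restriction of functions on `C`. -/
def resBase {U V : C.left.affineOpens} (h : V ≤ U) : Γ(C.left, U.1) →ₐ[ℂ] Γ(C.left, V.1) :=
  pull (𝟙 C) U.1 V.1 h

/-- Functions on the first factor. -/
abbrev inl (U : C.left.affineOpens) : P.fn U →ₐ[ℂ] P.fn U ⊗[ℂ] H :=
  Algebra.TensorProduct.includeLeft

/-- Functions on the second factor. -/
abbrev inr (U : C.left.affineOpens) : H →ₐ[ℂ] P.fn U ⊗[ℂ] H :=
  Algebra.TensorProduct.includeRight

/-- The action morphism `(x, g) ↦ x g` on (preimage of `U`) `× G`. -/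
def univAct (U : C.left.affineOpens) : SpecC (P.fn U ⊗[ℂ] H) ⟶ P.tot :=
  lift (specMap (P.inl U) ≫ fromSpecC (P.isAffineOpen_above U))
    (specMap (P.inr U)) ≫ P.act

lemma univAct_proj (U : C.left.affineOpens) :
    P.univAct U ≫ P.proj = specMap (P.inl U) ≫
      fromSpecC (P.isAffineOpen_above U) ≫ P.proj := by
  rw [univAct, Category.assoc, P.act_proj, lift_fst_assoc, Category.assoc]

lemma le_of_comp_proj {X : CScheme} {f g : X ⟶ P.tot} (e : f ≫ P.proj = g ≫ P.proj)
    (U : C.left.affineOpens) (V : X.left.Opens) (h : V ≤ f.left ⁻¹ᵁ P.above U) :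
    V ≤ g.left ⁻¹ᵁ P.above U := by
  have : (f ≫ P.proj).left ⁻¹ᵁ U.1 = (g ≫ P.proj).left ⁻¹ᵁ U.1 := by rw [e]
  exact h.trans this.le

lemma univAct_le (U : C.left.affineOpens) : ⊤ ≤ (P.univAct U).left ⁻¹ᵁ P.above U := by
  refine P.le_of_comp_proj (f := specMap (P.inl U) ≫
    fromSpecC (P.isAffineOpen_above U)) ?_ U ⊤ ?_
  · rw [P.univAct_proj, Category.assoc]
  · intro x _
    exact fromSpecC_le (P.isAffineOpen_above U) trivial

/-- The coaction of `H` on the functions on the preimage of `U`: `f` goes to the function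
`(x, g) ↦ f (x g)`. -/
def coact (U : C.left.affineOpens) : P.fn U →ₐ[ℂ] P.fn U ⊗[ℂ] H :=
  pullSpec (P.univAct U) (P.above U) (P.univAct_le U)

lemma coact_counit (U : C.left.affineOpens) (b : P.fn U) :
    evalRight (P.fn U) (Bialgebra.counitAlgHom ℂ H) (P.coact U b) = b := by
  set e := evalRight (P.fn U) (Bialgebra.counitAlgHom ℂ H) with he
  have h1 : specMap e ≫ specMap (P.inl U) = 𝟙 _ := by
    rw [← specMap_comp]
    have : e.comp (P.inl U) = AlgHom.id ℂ _ := AlgHom.ext fun x => by simp [e]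
    rw [this, specMap_id]
  have h2 : specMap e ≫ specMap (P.inr U) = toUnit _ ≫ η[SpecC H] := by
    rw [← specMap_comp]
    have : e.comp (P.inr U) = (Algebra.ofId ℂ (P.fn U)).comp (Bialgebra.counitAlgHom ℂ H) := by
      refine AlgHom.ext fun x => ?_; simp [e, Algebra.ofId_apply, Algebra.algebraMap_eq_smul_one]
    rw [this]
    exact specMap_ofId_comp_counit
  have h3 : specMap e ≫ P.univAct U = fromSpecC (P.isAffineOpen_above U) := by
    rw [univAct, comp_lift_assoc, h2, ← Category.assoc, h1, Category.id_comp, lift_toUnit_comp,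
      Category.assoc, Category.assoc, P.act_one, Category.comp_id]
  have h5 : ⊤ ≤ (specMap e ≫ P.univAct U).left ⁻¹ᵁ P.above U := by
    rw [h3]; exact fromSpecC_le _
  have h6 := pullSpec_specMap e (P.univAct U) (P.above U) (P.univAct_le U) h5 b
  refine h6.symm.trans ?_
  rw [pullSpec_congr h3 _ h5 (fromSpecC_le _), pullSpec_fromSpecC]

lemma coact_algebraMap (U : C.left.affineOpens) (a : Γ(C.left, U.1)) :
    P.coact U (algebraMap _ (P.fn U) a) = algebraMap _ (P.fn U) a ⊗ₜ 1 := by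
  have h1 : ⊤ ≤ (P.univAct U ≫ P.proj).left ⁻¹ᵁ U.1 := P.univAct_le U
  have h2 : ⊤ ≤ (fromSpecC (P.isAffineOpen_above U) ≫ P.proj).left ⁻¹ᵁ U.1 :=
    fromSpecC_le (P.isAffineOpen_above U)
  have h3 : ⊤ ≤ (specMap (P.inl U) ≫ fromSpecC (P.isAffineOpen_above U) ≫ P.proj).left ⁻¹ᵁ U.1 := by
    rw [← P.univAct_proj]; exact h1
  refine (pullSpec_pull (P.univAct U) P.proj U.1 (P.above U) (P.univAct_le U) le_rfl h1 a).trans ?_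
  rw [pullSpec_congr (P.univAct_proj U) _ h1 h3, pullSpec_specMap _ _ _ h2,
    ← pullSpec_pull _ _ _ (P.above U) (fromSpecC_le _) le_rfl, pullSpec_fromSpecC]
  rfl

/-- Morphisms of principal bundles over `C`: equivariant morphisms over `C` (they are all
isomorphisms). -/
@[ext]
structure Hom (P Q : PrincipalBundle H C) where
  toHom : P.tot ⟶ Q.tot
  comp_proj : toHom ≫ Q.proj = P.proj
  act_comp : P.act ≫ toHom = (toHom ▷ SpecC H) ≫ Q.act

/-- The identity morphism. -/
def Hom.id : Hom P P where
  toHom := 𝟙 P.tot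
  comp_proj := Category.id_comp _
  act_comp := by simp

variable {P} {Q : PrincipalBundle H C}

lemma Hom.above_le (f : Hom P Q) {U V : C.left.affineOpens} (h : V ≤ U) :
    P.above V ≤ f.toHom.left ⁻¹ᵁ Q.above U := by
  refine (P.above_mono h).trans ?_
  have : P.proj.left ⁻¹ᵁ U.1 = (f.toHom ≫ Q.proj).left ⁻¹ᵁ U.1 := by rw [f.comp_proj]
  exact this.le

/-- Pullback of functions along a morphism of principal bundles, followed by restriction. -/
def Hom.comap (f : Hom P Q) {U V : C.left.affineOpens} (h : V ≤ U) : Q.fn U →ₐ[ℂ] P.fn V :=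
  pull f.toHom (Q.above U) (P.above V) (f.above_le h)

lemma Hom.comap_algebraMap (f : Hom P Q) {U V : C.left.affineOpens} (h : V ≤ U)
    (a : Γ(C.left, U.1)) :
    f.comap h (algebraMap _ (Q.fn U) a) = algebraMap _ (P.fn V) (resBase h a) := by
  have e : f.toHom ≫ Q.proj = P.proj ≫ 𝟙 C := by simp [f.comp_proj]
  have h1 : P.above V ≤ (f.toHom ≫ Q.proj).left ⁻¹ᵁ U.1 := f.above_le h
  have h2 : P.above V ≤ (P.proj ≫ 𝟙 C).left ⁻¹ᵁ U.1 := by rw [← e]; exact h1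
  refine (pull_pull f.toHom Q.proj _ _ _ le_rfl (f.above_le h) h1 a).trans ?_
  refine Eq.trans ?_ (pull_pull P.proj (𝟙 C) _ _ _ h le_rfl h2 a).symm
  exact pull_congr e _ _ _ _ _

lemma Hom.coact_comap (f : Hom P Q) {U V : C.left.affineOpens} (h : V ≤ U) (b : Q.fn U) :
    P.coact V (f.comap h b) =
      Algebra.TensorProduct.map (f.comap h) (AlgHom.id ℂ H) (Q.coact U b) := by
  set φ := Algebra.TensorProduct.map (f.comap h) (AlgHom.id ℂ H) with hφ
  have e : P.univAct V ≫ f.toHom = specMap φ ≫ Q.univAct U := by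
    have e1 : φ.comp (Q.inl U) = (P.inl V).comp (f.comap h) := AlgHom.ext fun x => by simp [φ]
    have e2 : φ.comp (Q.inr U) = P.inr V := AlgHom.ext fun x => by simp [φ]
    have e3 : specMap (f.comap h) ≫ fromSpecC (Q.isAffineOpen_above U) =
        fromSpecC (P.isAffineOpen_above V) ≫ f.toHom :=
      specMap_pull_fromSpecC _ _ _ _
    have e4 : specMap φ ≫ specMap (Q.inl U) ≫ fromSpecC (Q.isAffineOpen_above U) =
        (specMap (P.inl V) ≫ fromSpecC (P.isAffineOpen_above V)) ≫ f.toHom := by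
      rw [← Category.assoc, ← specMap_comp, e1, specMap_comp, Category.assoc, e3, Category.assoc]
    rw [univAct, univAct, Category.assoc, f.act_comp, comp_lift_assoc, e4, ← specMap_comp, e2,
      lift_whiskerRight_assoc]
  have h1 : ⊤ ≤ (P.univAct V ≫ f.toHom).left ⁻¹ᵁ Q.above U :=
    fun x hx => f.above_le h (P.univAct_le V hx)
  have h2 : ⊤ ≤ (specMap φ ≫ Q.univAct U).left ⁻¹ᵁ Q.above U := by rw [← e]; exact h1
  refine (pullSpec_pull _ _ _ _ (P.univAct_le V) (f.above_le h) h1 b).trans ?_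
  rw [pullSpec_congr e _ h1 h2, pullSpec_specMap]
  rfl

variable (P)

/-- The action of a point `g` of `G` on functions: `f` goes to the function `x ↦ f (x g)`. -/
def translate (U : C.left.affineOpens) (g : H →ₐ[ℂ] ℂ) : P.fn U →ₐ[ℂ] P.fn U :=
  (evalRight (P.fn U) g).comp (P.coact U)

lemma translate_algebraMap (U : C.left.affineOpens) (g : H →ₐ[ℂ] ℂ) (a : Γ(C.left, U.1)) :
    P.translate U g (algebraMap _ (P.fn U) a) = algebraMap _ (P.fn U) a := by
  simp [translate, coact_algebraMap]

variable {P} in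
lemma Hom.comap_translate (f : Hom P Q) {U V : C.left.affineOpens} (h : V ≤ U) (g : H →ₐ[ℂ] ℂ)
    (b : Q.fn U) : f.comap h (Q.translate U g b) = P.translate V g (f.comap h b) := by
  simp [translate, f.coact_comap, evalRight_natural]

/-- The fundamental vector field on the total space given by an element of the Lie algebra: the
derivative at the identity of the action. -/
def fundamentalField (U : C.left.affineOpens) (D : lieAlg H) :
    Derivation ℂ (P.fn U) (P.fn U) :=
  coactionField (P.coact U) (P.coact_counit U) D

/-! ### The adjoint bundle -/

/-- Sections over `U` of the adjoint bundle, the vector bundle associated to the adjoint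
representation of `G`: functions `s` on the preimage of `U` with values in the Lie algebra such
that `s (x g) = Ad(g⁻¹) (s x)`, that is `Ad(g) (s (x g)) = s x`, for all `g`. -/
def adSections (U : C.left.affineOpens) : Submodule Γ(C.left, U.1) (P.fn U ⊗[ℂ] lieAlg H) where
  carrier := {s | ∀ g : H →ₐ[ℂ] ℂ,
    TensorProduct.map (P.translate U g).toLinearMap (adjoint H g) s = s}
  add_mem' {s t} hs ht g := by rw [map_add, hs g, ht g]
  zero_mem' g := map_zero _
  smul_mem' a s hs g := by
    rw [map_smul_adjoint (P.translate U g) (P.translate_algebraMap U g), hs g]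

variable {P} in
/-- Pullback of sections of the adjoint bundles along a morphism of principal bundles, followed
by restriction; for the identity morphism this is restriction of sections. -/
def Hom.adComap (f : Hom P Q) {U V : C.left.affineOpens} (h : V ≤ U) :
    Q.adSections U →+ P.adSections V where
  toFun s := ⟨(f.comap h).toLinearMap.rTensor (lieAlg H) s.1, fun g => by
    rw [map_adjoint_rTensor _ _ _ (fun b => f.comap_translate h g b), s.2 g]⟩
  map_zero' := Subtype.ext (map_zero _)
  map_add' s t := Subtype.ext (map_add _ _ _)

variable {P} in
lemma Hom.adComap_smul (f : Hom P Q) {U V : C.left.affineOpens} (h : V ≤ U)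
    (a : Γ(C.left, U.1)) (s : Q.adSections U) :
    f.adComap h (a • s) = resBase h a • f.adComap h s :=
  Subtype.ext (rTensor_smul (f.comap h) (resBase h) (f.comap_algebraMap h) (lieAlg H) a s.1)

/-- One-forms on `U` with values in the adjoint bundle. -/
abbrev AdForms (U : C.left.affineOpens) : Type :=
  Ω[Γ(C.left, U.1)⁄ℂ] ⊗[Γ(C.left, U.1)] P.adSections U

variable {P} in
/-- Pullback of one-forms on `C` with values in the adjoint bundles along a morphism of principal
bundles, followed by restriction; for the identity morphism this is restriction. -/
def Hom.adFormsComap (f : Hom P Q) {U V : C.left.affineOpens} (h : V ≤ U) :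
    Q.AdForms U →+ P.AdForms V :=
  TensorProduct.liftAddHom
    (AddMonoidHom.mk' (fun τ => AddMonoidHom.mk'
        (fun s => kmap (resBase h) τ ⊗ₜ[Γ(C.left, V.1)] f.adComap h s)
        (fun s t => by rw [map_add, TensorProduct.tmul_add]))
      (fun τ τ' => by
        refine AddMonoidHom.ext fun s => ?_
        simp [TensorProduct.add_tmul]))
    (fun a τ s => by
      simp only [AddMonoidHom.mk'_apply]
      rw [kmap_smul, f.adComap_smul, TensorProduct.smul_tmul])

/-- Algebraic connections on the adjoint vector bundle: `ℂ`-linear sheaf maps to the one-forms on `C`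
with values in the adjoint bundle that satisfy the Leibniz rule (given on the affine open subsets
of `C`, compatibly with restriction). -/
@[ext]
structure AdConnection where
  nabla : ∀ U : C.left.affineOpens, P.adSections U →ₗ[ℂ] P.AdForms U
  leibniz : ∀ (U : C.left.affineOpens) (a : Γ(C.left, U.1)) (s : P.adSections U),
    nabla U (a • s) = a • nabla U s + KaehlerDifferential.D ℂ Γ(C.left, U.1) a ⊗ₜ s
  compat : ∀ (U V : C.left.affineOpens) (h : V ≤ U) (s : P.adSections U),
    (Hom.id P).adFormsComap h (nabla U s) = nabla V ((Hom.id P).adComap h s)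

/-! ### Forms on the total space -/

/-- Algebraic one-forms on the total space with values in the vector space `V`.  The preimages of the
affine open subsets of `C` are affine and cover the total space, so a form is a compatible family of
elements of `Ω ⊗ V` on them. -/
@[ext]
structure Form (V : Type) [AddCommGroup V] [Module ℂ V] where
  val : ∀ U : C.left.affineOpens, Ω[P.fn U⁄ℂ] ⊗[ℂ] V
  compat : ∀ (U U' : C.left.affineOpens) (h : U' ≤ U),
    (kmap ((Hom.id P).comap h)).rTensor V (val U) = val U'

variable {P} in
/-- A linear map applied to the values of a form. -/
def Form.map {V W : Type} [AddCommGroup V] [Module ℂ V] [AddCommGroup W] [Module ℂ W]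
    (T : V →ₗ[ℂ] W) (ω : P.Form V) : P.Form W where
  val U := T.lTensor _ (ω.val U)
  compat U U' h := by
    rw [← LinearMap.comp_apply, LinearMap.rTensor_comp_lTensor, ← LinearMap.lTensor_comp_rTensor,
      LinearMap.comp_apply, ω.compat]

/-- Algebraic connections on a principal bundle: one-forms `ω` on the total space with values in the
Lie algebra that are equivariant, `R_g^* ω = Ad(g⁻¹) ω` for every point `g` of `G`, and take the
value `D` on the fundamental vector field of every element `D` of the Lie algebra. -/
@[ext]
structure Connection extends P.Form (lieAlg H) where
  equivariant : ∀ (U : C.left.affineOpens) (g : H →ₐ[ℂ] ℂ),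
    TensorProduct.map (kmap (P.translate U g)) (adjoint H g) (val U) = val U
  vertical : ∀ (U : C.left.affineOpens) (D : lieAlg H),
    ((P.fundamentalField U D).liftKaehlerDifferential.restrictScalars ℂ).rTensor (lieAlg H)
      (val U) = 1 ⊗ₜ D

/-- Pullback to the total space of one-forms on `C` with values in the adjoint bundle.  The pullback
of the adjoint bundle to the total space is canonically trivial with fibre the Lie algebra, so the
result is a one-form with values in the Lie algebra. -/
def pullAdForms (U : C.left.affineOpens) : P.AdForms U →+ Ω[P.fn U⁄ℂ] ⊗[ℂ] lieAlg H :=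
  TensorProduct.liftAddHom
    (AddMonoidHom.mk' (fun τ => AddMonoidHom.mk'
        (fun s => formMul (lieAlg H) (kmap (pull P.proj U.1 (P.above U) le_rfl) τ) s.1)
        (fun s t => map_add _ _ _))
      (fun τ τ' => by
        refine AddMonoidHom.ext fun s => ?_
        simp [formMul_add]))
    (fun a τ s => by
      simp only [AddMonoidHom.mk'_apply]
      rw [kmap_smul]
      exact formMul_smul (lieAlg H) a _ s.1)

variable {P}

/-- The connection `D` on the adjoint bundle of `P` is the pullback along `f : P ⟶ Q` of the
connection `D'` on the adjoint bundle of `Q`. -/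
def Hom.IsAdPullback (f : Hom P Q) (D : P.AdConnection) (D' : Q.AdConnection) : Prop :=
  ∀ (U : C.left.affineOpens) (s : Q.adSections U),
    D.nabla U (f.adComap le_rfl s) = f.adFormsComap le_rfl (D'.nabla U s)

/-- The form `ω` on the total space of `P` is the pullback along `f : P ⟶ Q` of the form `ω'` on the
total space of `Q`. -/
def Hom.IsFormPullback {V : Type} [AddCommGroup V] [Module ℂ V] (f : Hom P Q) (ω : P.Form V)
    (ω' : Q.Form V) : Prop :=
  ∀ U : C.left.affineOpens, ω.val U = (kmap (f.comap (le_refl U))).rTensor V (ω'.val U)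

/-- `θ` is the connection form of the connection `D` on the adjoint bundle along the canonical map
from the total space to the bundle of frames of the adjoint bundle.  In other words the pullback
of `D` to the total space, where the adjoint bundle is canonically trivial, is `d + θ`. -/
def IsConnectionForm (D : P.AdConnection) (θ : P.Form (Module.End ℂ (lieAlg H))) : Prop :=
  ∀ (U : C.left.affineOpens) (s : P.adSections U),
    P.pullAdForms U (D.nabla U s) =
      dSection (lieAlg H) s.1 + formApply (lieAlg H) (θ.val U) s.1

/-- The connection `D` on the adjoint bundle is induced by the connection `ω` on the principal
bundle: as forms on the total space, `D s = ds + [ω, s]` for all sections `s`. -/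
def IsInduced (ω : P.Connection) (D : P.AdConnection) : Prop :=
  ∀ (U : C.left.affineOpens) (s : P.adSections U),
    P.pullAdForms U (D.nabla U s) =
      dSection (lieAlg H) s.1 + formBracket (lieAlg H) (ω.val U) s.1

end
end PrincipalBundle

/-- `p` is the projection of `gl(𝔤)` to `𝔤`, embedded by the adjoint representation, along the
orthogonal complement of `𝔤` for the bilinear form `trace (A B)`. -/
def IsTraceOrthogonalProjection (𝔤 : Type) [LieRing 𝔤] [LieAlgebra ℂ 𝔤]
    (p : Module.End ℂ 𝔤 →ₗ[ℂ] 𝔤) : Prop :=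
  (∀ X : 𝔤, p (LieAlgebra.ad ℂ 𝔤 X) = X) ∧
  ∀ A : Module.End ℂ 𝔤, (∀ X : 𝔤, LinearMap.trace ℂ 𝔤 (A * LieAlgebra.ad ℂ 𝔤 X) = 0) → p A = 0

end

end PrincipalConnections

namespace PrincipalConnections

open CategoryTheory AlgebraicGeometry MonoidalCategory CartesianMonoidalCategory
open scoped TensorProduct KaehlerDifferential MonObj

noncomputable section

/-! ### Points of the group -/

section Contract

variable {H : Type} [AddCommGroup H] [Module ℂ H] {V V' : Type} [AddCommGroup V] [Module ℂ V]
  [AddCommGroup V'] [Module ℂ V']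

/-! Write `𝔤` for the Lie algebra. Its Killing form is nondegenerate, so the projection `p` is the
map `A ↦ tr(A ∘ ad ·)` into the dual of `𝔤`, followed by the inverse of the Killing form. Being
characterised uniquely, `p` commutes with all automorphisms of `𝔤`
(`IsTraceOrthogonalProjection.conj`), in particular with every `Ad(g)`.

Everything else is descent along the bundle. Over an affine open `Spec A` of `C` the total space is
`Spec B`, with a coaction `B → B ⊗ H` such that `B` is faithfully flat over `A` and `B ⊗_A B ≅ B ⊗
H` (`isTorsor_coact`). Sections of the adjoint bundle form the submodule `M` of invariants in `B ⊗
𝔤`. Two facts carry the proof. First, `B ⊗_A M ≅ B ⊗ 𝔤`: the adjoint bundle becomes trivial on the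
total space (`liftBaseChange_bijective`). Second, pullback identifies the `M`-valued one-forms on
the base with the invariant `𝔤`-valued forms on the total space that vanish on the fundamental
fields (`exists_form_of_horizontal`, `pullTensor_subtype_injective`). The second fact uses
smoothness of `G`, which makes the pullback of one-forms injective, and smoothness of `C`, which
makes `Ω[A⁄ℂ]` flat.

For a connection `∇` on the adjoint bundle, `∇ - d` is `A`-linear on `M`, so it extends `B`-linearly
and is given by exactly one form `θ` with values in `gl(𝔤)`. Uniqueness makes `θ` natural and
equivariant. A pulled-back form is horizontal and an invariant section satisfies `X s + [X, s] = 0`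
for the fundamental field of `X`, so `θ` takes the value `ad X` on that field. Hence `p ∘ θ` is a
connection on the bundle.

Conversely, for a connection `ω` on the bundle, `ds + [ω, s]` is horizontal and invariant, so it
descends to the base and defines the induced connection. Its connection form is `ad ∘ ω` by
uniqueness, and `p ∘ ad = id` gives back `ω`. -/

variable (V) in
/-- For a linear form `δ` on `H`, the map `v ⊗ h ↦ δ(h) v`. -/
def contract (δ : H →ₗ[ℂ] ℂ) : V ⊗[ℂ] H →ₗ[ℂ] V :=
  (TensorProduct.rid ℂ V).toLinearMap ∘ₗ δ.lTensor V

@[simp] lemma contract_tmul (δ : H →ₗ[ℂ] ℂ) (v : V) (h : H) :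
    contract V δ (v ⊗ₜ h) = δ h • v := by
  simp [contract]

lemma contract_rTensor (δ : H →ₗ[ℂ] ℂ) (φ : V →ₗ[ℂ] V') (x : V ⊗[ℂ] H) :
    contract V' δ (φ.rTensor H x) = φ (contract V δ x) := by
  induction x with
  | zero => simp
  | add x y hx hy => simp only [map_add, hx, hy]
  | tmul v h => simp

end Contract

section Group

variable {H : Type} [CommRing H] [HopfAlgebra ℂ H]

lemma evalRight_eq_contract (B : Type) [CommRing B] [Algebra ℂ B] (g : H →ₐ[ℂ] ℂ)
    (x : B ⊗[ℂ] H) : evalRight B g x = contract B g.toLinearMap x := by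
  induction x with
  | zero => simp
  | add x y hx hy => simp only [map_add, hx, hy]
  | tmul v h => simp

section Points

variable [Algebra.FiniteType ℂ H] [IsReduced H]

/-- A function that vanishes at all points is zero. -/
lemma eq_zero_of_forall_point (h : H) (hh : ∀ g : H →ₐ[ℂ] ℂ, g h = 0) : h = 0 := by
  -- Nullstellensatz: each residue field at a maximal ideal is finite over `ℂ` and so embeds in `ℂ`,
  -- which makes the maximal ideal the kernel of a point. In a reduced Jacobson ring these ideals
  -- intersect in zero.
  have : IsJacobsonRing H := isJacobsonRing_of_finiteType (A := ℂ) (B := H)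
  have key : h ∈ (⊥ : Ideal H).jacobson := by
    refine Ideal.mem_sInf.2 fun {J} hJ => ?_
    have := hJ.2
    let := Ideal.Quotient.field J
    have : Module.Finite ℂ (H ⧸ J) := finite_of_finite_type_of_isJacobsonRing ℂ (H ⧸ J)
    let l : (H ⧸ J) →ₐ[ℂ] ℂ := IsAlgClosed.lift
    have h1 := hh (l.comp (Ideal.Quotient.mkₐ ℂ J))
    exact Ideal.Quotient.eq_zero_iff_mem.1 (l.toRingHom.injective (h1.trans (map_zero l).symm))
  rwa [this.out Ideal.isRadical_bot] at key

/-- An element of `V ⊗ H` that vanishes at all points is zero. -/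
lemma eq_zero_of_forall_contract {V : Type} [AddCommGroup V] [Module ℂ V] (x : V ⊗[ℂ] H)
    (hx : ∀ g : H →ₐ[ℂ] ℂ, contract V g.toLinearMap x = 0) : x = 0 := by
  -- The coordinates of `x` in a basis of `V` are functions on the group that vanish at all points.
  let b := Module.Free.chooseBasis ℂ V
  let e := TensorProduct.equivFinsuppOfBasisLeft (M := V) (N := H) b
  rw [← e.map_eq_zero_iff]
  ext i
  refine eq_zero_of_forall_point _ fun g => ?_
  have h1 : ∀ y : V ⊗[ℂ] H, g (e y i) = b.repr (contract V g.toLinearMap y) i := by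
    intro y
    induction y with
    | zero => simp
    | add x y hx hy => simp only [map_add, Finsupp.add_apply, hx, hy]
    | tmul v h =>
      simp [e, mul_comm]
  rw [h1, hx, map_zero, Finsupp.zero_apply]

lemma eq_of_forall_contract {V : Type} [AddCommGroup V] [Module ℂ V] {x y : V ⊗[ℂ] H}
    (hx : ∀ g : H →ₐ[ℂ] ℂ, contract V g.toLinearMap x = contract V g.toLinearMap y) : x = y :=
  sub_eq_zero.1 (eq_zero_of_forall_contract _ fun g => by rw [map_sub, hx, sub_self])

/-- Evaluation at a `ℂ`-point is a ring homomorphism to the field `K`, so it kills nilpotents, and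
such evaluations detect zero. This supplies the geometric reducedness behind smoothness of the
group. -/
lemma isReduced_tensor (K : Type) [Field K] [Algebra ℂ K] : IsReduced (K ⊗[ℂ] H) where
  eq_zero x hx := by
    refine eq_zero_of_forall_contract x fun g => ?_
    rw [← evalRight_eq_contract]
    exact (hx.map (evalRight K g)).eq_zero

end Points

/-! ### Tangent vectors at the identity -/

/-- The tangent vector at the identity of an element of the Lie algebra. -/
def tangent (D : lieAlg H) : H →ₗ[ℂ] ℂ := Coalgebra.counit ∘ₗ (D.1 : H →ₗ[ℂ] H)

lemma tangent_apply (D : lieAlg H) (h : H) : tangent D h = Coalgebra.counit (R := ℂ) (D.1 h) := rfl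

@[simp] lemma tangent_one (D : lieAlg H) : tangent D 1 = 0 := by simp [tangent_apply]

lemma tangent_mul (D : lieAlg H) (a b : H) : tangent D (a * b) =
    Coalgebra.counit (R := ℂ) a * tangent D b + Coalgebra.counit (R := ℂ) b * tangent D a := by
  simp [tangent_apply]

/-- Apply `id ⊗ ε` to the left-invariance `Δ D = (id ⊗ D) Δ`. So a left-invariant derivation is
recovered from its value at the identity. -/
lemma contract_tangent_comul (D : lieAlg H) (h : H) :
    contract H (tangent D) (Coalgebra.comul (R := ℂ) h) = D.1 h := by
  have h1 : Coalgebra.comul (R := ℂ) (D.1 h) =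
      (D.1 : H →ₗ[ℂ] H).lTensor H (Coalgebra.comul (R := ℂ) h) := LinearMap.congr_fun D.2 h
  have h2 := Coalgebra.lTensor_counit_comul (R := ℂ) (D.1 h)
  rw [h1, ← LinearMap.lTensor_comp_apply] at h2
  have h3 := congrArg (TensorProduct.rid ℂ H) h2
  rw [TensorProduct.rid_tmul, one_smul] at h3
  exact h3

/-- A linear form that is a derivation at the identity is the tangent vector of a left-invariant
derivation. -/
lemma exists_tangent_eq (δ : H →ₗ[ℂ] ℂ) (hδ : ∀ a b, δ (a * b) =
    Coalgebra.counit (R := ℂ) a * δ b + Coalgebra.counit (R := ℂ) b * δ a) :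
    ∃ D : lieAlg H, tangent D = δ := by
  have hmul : ∀ x y : H ⊗[ℂ] H, contract H δ (x * y) =
      evalRight H (Bialgebra.counitAlgHom ℂ H) x * contract H δ y +
        evalRight H (Bialgebra.counitAlgHom ℂ H) y * contract H δ x := by
    intro x y
    induction x with
    | zero => simp
    | add x x' hx hx' => simp only [add_mul, mul_add, map_add, hx, hx']; ring
    | tmul b h =>
      induction y with
      | zero => simp
      | add y y' hy hy' => simp only [add_mul, mul_add, map_add, hy, hy']; ring
      | tmul b' h' => simp [hδ, add_smul, smul_smul, mul_comm]
  have hε : ∀ x : H, evalRight H (Bialgebra.counitAlgHom ℂ H) (Coalgebra.comul (R := ℂ) x) = x := by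
    intro x
    rw [evalRight_eq_contract]
    change TensorProduct.rid ℂ H ((Coalgebra.counit (R := ℂ)).lTensor H _) = x
    rw [Coalgebra.lTensor_counit_comul, TensorProduct.rid_tmul, one_smul]
  -- The derivation is `(id ⊗ δ) Δ`; its left-invariance is coassociativity, and its value at the
  -- identity is `δ` by the counit axiom.
  refine ⟨⟨Derivation.mk' (contract H δ ∘ₗ Coalgebra.comul) fun a b => ?_, ?_⟩, ?_⟩
  · change contract H δ (Coalgebra.comul (R := ℂ) (a * b)) = _
    rw [Bialgebra.comul_mul, hmul, hε, hε]
    rfl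
  · refine LinearMap.ext fun f => ?_
    have key : ∀ x : H ⊗[ℂ] H, Coalgebra.comul (R := ℂ) (contract H δ x) =
        (contract H δ).lTensor H
          (TensorProduct.assoc ℂ H H H ((Coalgebra.comul (R := ℂ)).rTensor H x)) := by
      intro x
      induction x with
      | zero => simp
      | add x y hx hy => simp only [map_add, hx, hy]
      | tmul a b =>
        simp only [contract_tmul, map_smul, LinearMap.rTensor_tmul]
        generalize (Coalgebra.comul (R := ℂ) a) = y
        induction y with
        | zero => simp
        | add x y hx hy => simp only [map_add, hx, hy, smul_add, TensorProduct.add_tmul]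
        | tmul c d => simp
    have := key (Coalgebra.comul (R := ℂ) f)
    rw [Coalgebra.coassoc_apply] at this
    refine this.trans ?_
    rw [← LinearMap.lTensor_comp_apply]
    rfl
  · refine LinearMap.ext fun f => ?_
    change Coalgebra.counit (R := ℂ) (contract H δ (Coalgebra.comul (R := ℂ) f)) = δ f
    have key : ∀ x : H ⊗[ℂ] H, Coalgebra.counit (R := ℂ) (contract H δ x) =
        δ (TensorProduct.lid ℂ H ((Coalgebra.counit (R := ℂ)).rTensor H x)) := by
      intro x
      induction x with
      | zero => simp
      | add x y hx hy => simp only [map_add, hx, hy]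
      | tmul a b => simp [mul_comm]
    rw [key, Coalgebra.rTensor_counit_comul, TensorProduct.lid_tmul, one_smul]

variable (H) in
/-- The pairing of functions with the Lie algebra by tangent vectors at the identity. -/
def tangentPairing : lieAlg H →ₗ[ℂ] H →ₗ[ℂ] ℂ where
  toFun := tangent
  map_add' D D' := by ext h; simp [tangent_apply]
  map_smul' c D := by ext h; simp [tangent_apply]

@[simp] lemma tangentPairing_apply (D : lieAlg H) : tangentPairing H D = tangent D := rfl

lemma tangentPairing_injective : Function.Injective (tangentPairing H) := by
  refine (injective_iff_map_eq_zero _).2 fun D hD => Subtype.ext (Derivation.ext fun h => ?_)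
  rw [tangentPairing_apply] at hD
  rw [← contract_tangent_comul, hD]
  simp [contract]

/-- By the product rule a tangent vector is determined by its values on a finite set of generators
of `H`. -/
instance finiteDimensional_lieAlg [Algebra.FiniteType ℂ H] : FiniteDimensional ℂ (lieAlg H) := by
  obtain ⟨s, hs⟩ := Algebra.FiniteType.out (R := ℂ) (A := H)
  let r : lieAlg H →ₗ[ℂ] s → ℂ := LinearMap.pi fun x => (tangentPairing H).flip x.1
  refine Module.Finite.of_injective r ((injective_iff_map_eq_zero _).2 fun D hD => ?_)
  refine tangentPairing_injective (LinearMap.ext fun h => ?_)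
  have hh : h ∈ Algebra.adjoin ℂ (s : Set H) := by rw [hs]; trivial
  rw [map_zero, LinearMap.zero_apply, tangentPairing_apply]
  induction hh using Algebra.adjoin_induction with
  | mem x hx => exact congrFun hD ⟨x, hx⟩
  | algebraMap c => simp [Algebra.algebraMap_eq_smul_one]
  | add x y _ _ hx hy => rw [map_add, hx, hy, add_zero]
  | mul x y _ _ hx hy => rw [tangent_mul, hx, hy, mul_zero, mul_zero, add_zero]

/-- Every linear form on the Lie algebra is given by a function that vanishes at the identity. -/
lemma exists_function_of_dual [Algebra.FiniteType ℂ H] (lam : Module.Dual ℂ (lieAlg H)) :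
    ∃ f : H, Coalgebra.counit (R := ℂ) f = 0 ∧ ∀ D, tangent D f = lam D := by
  -- Since `𝔤` is finite-dimensional, injectivity of `𝔤 → H*` is the same as surjectivity of `H →
  -- 𝔤*`. Subtracting the constant `f(e)` does not change the derivatives.
  obtain ⟨f, hf⟩ := LinearMap.flip_surjective_iff₁.2 (tangentPairing_injective (H := H)) lam
  refine ⟨f - algebraMap ℂ H (Coalgebra.counit (R := ℂ) f), by simp, fun D => ?_⟩
  rw [← hf]
  simp [Algebra.algebraMap_eq_smul_one]

variable (H) in
/-- A basis of the Lie algebra. -/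
def lieBasis [Algebra.FiniteType ℂ H] :
    Module.Basis (Fin (Module.finrank ℂ (lieAlg H))) ℂ (lieAlg H) :=
  Module.finBasis ℂ (lieAlg H)

/-- Functions that vanish at the identity with differentials there dual to the basis of the
Lie algebra. -/
def dualFunction [Algebra.FiniteType ℂ H] (j : Fin (Module.finrank ℂ (lieAlg H))) : H :=
  (exists_function_of_dual ((lieBasis H).coord j)).choose

lemma counit_dualFunction [Algebra.FiniteType ℂ H] (j : Fin (Module.finrank ℂ (lieAlg H))) :
    Coalgebra.counit (R := ℂ) (dualFunction (H := H) j) = 0 :=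
  (exists_function_of_dual ((lieBasis H).coord j)).choose_spec.1

lemma tangent_dualFunction [Algebra.FiniteType ℂ H] (j : Fin (Module.finrank ℂ (lieAlg H)))
    (D : lieAlg H) : tangent D (dualFunction j) = (lieBasis H).repr D j :=
  (exists_function_of_dual ((lieBasis H).coord j)).choose_spec.2 D

variable (H) in
/-- The ideal of functions that vanish at the identity. -/
def augIdeal : Ideal H := RingHom.ker (Bialgebra.counitAlgHom ℂ H)

/-- First order Taylor expansion at the identity. -/
lemma taylor_mem [Algebra.FiniteType ℂ H] (h : H) :
    h - algebraMap ℂ H (Coalgebra.counit (R := ℂ) h) -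
      ∑ j, tangent (lieBasis H j) h • dualFunction j ∈ augIdeal H ^ 2 := by
  set v := h - algebraMap ℂ H (Coalgebra.counit (R := ℂ) h) -
      ∑ j, tangent (lieBasis H j) h • dualFunction j with hv
  -- A linear form that kills the square of the augmentation ideal but not `v` would, once corrected
  -- on constants, be a derivation at the identity, hence the tangent vector of some `D`. By
  -- construction of `v` every tangent vector kills it.
  by_contra hmem
  obtain ⟨lam, hlam, hker⟩ := Submodule.exists_le_ker_of_notMem
    (p := (augIdeal H ^ 2).restrictScalars ℂ) (v := v) (by simpa using hmem)
  have hvε : Coalgebra.counit (R := ℂ) v = 0 := by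
    simp [hv, counit_dualFunction]
  -- The correction makes the form vanish on constants without changing it on the augmentation
  -- ideal.
  let lam' : H →ₗ[ℂ] ℂ := lam - lam 1 • Coalgebra.counit
  have hsq : ∀ a b : H, Coalgebra.counit (R := ℂ) a = 0 → Coalgebra.counit (R := ℂ) b = 0 →
      lam' (a * b) = 0 := by
    intro a b ha hb
    have h1 : a * b ∈ augIdeal H ^ 2 := by
      rw [pow_two]
      exact Ideal.mul_mem_mul ha hb
    have h2 : lam (a * b) = 0 := hker h1
    simp [lam', h2, ha]
  have h1 : lam' 1 = 0 := by simp [lam']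
  obtain ⟨D, hD⟩ := exists_tangent_eq lam' (fun a b => by
    have := hsq (a - algebraMap ℂ H (Coalgebra.counit (R := ℂ) a))
      (b - algebraMap ℂ H (Coalgebra.counit (R := ℂ) b)) (by simp) (by simp)
    rw [sub_mul, mul_sub, mul_sub, ← Algebra.commutes (Coalgebra.counit (R := ℂ) b) a,
      Algebra.algebraMap_eq_smul_one, Algebra.algebraMap_eq_smul_one] at this
    simp only [smul_mul_assoc, one_mul, map_sub, map_smul, h1,
      smul_eq_mul, mul_zero, sub_zero] at this
    linear_combination this)
  apply hlam
  have h2 : lam v = lam' v := by simp [lam', hvε]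
  rw [h2, ← hD, hv, map_sub, map_sub, map_sum]
  simp only [map_smul, tangent_dualFunction, Algebra.algebraMap_eq_smul_one, tangent_one,
    smul_eq_mul, mul_zero, sub_zero]
  have h3 : tangent D = ∑ j, (lieBasis H).repr D j • tangent (lieBasis H j) := by
    conv_lhs => rw [← tangentPairing_apply, ← (lieBasis H).sum_repr D, map_sum]
    simp
  rw [sub_eq_zero]
  conv_lhs => rw [h3]
  simp [LinearMap.sum_apply, mul_comm]

/-! ### The adjoint representation -/

/-- The one-sided identity `rightTranslate_comp_inv`, applied both to `g` and to `pointInv g`, is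
enough; the antipode need not be known to be an involution. -/
lemma rightTranslate_bijective (g : H →ₐ[ℂ] ℂ) : Function.Bijective (rightTranslate g) := by
  have hinj : Function.Injective (rightTranslate (pointInv g)) :=
    Function.LeftInverse.injective (rightTranslate_comp_inv g)
  have hl : ∀ f, rightTranslate (pointInv g) (rightTranslate g f) = f := by
    intro f
    obtain ⟨f', rfl⟩ : ∃ f', rightTranslate (pointInv g) f' = f :=
      ⟨_, rightTranslate_comp_inv (pointInv g) f⟩
    rw [rightTranslate_comp_inv]
  exact ⟨Function.LeftInverse.injective hl, fun f => ⟨_, rightTranslate_comp_inv g f⟩⟩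

lemma rightTranslate_inv_comp (g : H →ₐ[ℂ] ℂ) (f : H) :
    rightTranslate (pointInv g) (rightTranslate g f) = f :=
  (rightTranslate_bijective g).1 (by rw [rightTranslate_comp_inv])

lemma adjoint_apply (g : H →ₐ[ℂ] ℂ) (D : lieAlg H) (f : H) :
    (adjoint H g D).1 f = rightTranslate g (D.1 (rightTranslate (pointInv g) f)) := rfl

lemma adjoint_apply_rightTranslate (g : H →ₐ[ℂ] ℂ) (D : lieAlg H) (f : H) :
    (adjoint H g D).1 (rightTranslate g f) = rightTranslate g (D.1 f) := by
  rw [adjoint_apply, rightTranslate_inv_comp]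

/-- As `R_g` is onto, `Ad(g) D` is the only element that `R_g` intertwines with `D`. This criterion
keeps inverses out of the computations with `Ad`. -/
lemma adjoint_eq_of_forall {g : H →ₐ[ℂ] ℂ} {D D' : lieAlg H}
    (h : ∀ f, rightTranslate g (D.1 f) = D'.1 (rightTranslate g f)) : adjoint H g D = D' := by
  refine Subtype.ext (Derivation.ext fun f => ?_)
  obtain ⟨f, rfl⟩ := (rightTranslate_bijective g).2 f
  rw [adjoint_apply_rightTranslate, h]

lemma adjoint_lie (g : H →ₐ[ℂ] ℂ) (D D' : lieAlg H) :
    adjoint H g ⁅D, D'⁆ = ⁅adjoint H g D, adjoint H g D'⁆ := by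
  refine adjoint_eq_of_forall fun f => ?_
  simp only [LieSubalgebra.coe_bracket, Derivation.commutator_apply, map_sub,
    adjoint_apply_rightTranslate]

lemma adjoint_adjoint_inv (g : H →ₐ[ℂ] ℂ) (D : lieAlg H) :
    adjoint H g (adjoint H (pointInv g) D) = D := by
  refine adjoint_eq_of_forall fun f => ?_
  obtain ⟨f, rfl⟩ := (rightTranslate_bijective (pointInv g)).2 f
  rw [adjoint_apply_rightTranslate, rightTranslate_comp_inv, rightTranslate_comp_inv]

lemma adjoint_injective (g : H →ₐ[ℂ] ℂ) : Function.Injective (adjoint H g) := by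
  refine (injective_iff_map_eq_zero _).2 fun D hD => Subtype.ext (Derivation.ext fun f => ?_)
  apply (rightTranslate_bijective g).1
  rw [← adjoint_apply_rightTranslate, hD]
  simp

/-- The product of two points of the group. -/
def pointMul (g h : H →ₐ[ℂ] ℂ) : H →ₐ[ℂ] ℂ :=
  (Algebra.TensorProduct.lift g h fun _ _ => Commute.all _ _).comp (Bialgebra.comulAlgHom ℂ H)

lemma contract_contract_assoc {V : Type} [AddCommGroup V] [Module ℂ V] (g h : H →ₐ[ℂ] ℂ)
    (x : V ⊗[ℂ] (H ⊗[ℂ] H)) :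
    contract V h.toLinearMap (contract (V ⊗[ℂ] H) g.toLinearMap
      ((TensorProduct.assoc ℂ V H H).symm x)) =
    contract V (Algebra.TensorProduct.lift h g fun _ _ => Commute.all _ _).toLinearMap x := by
  induction x with
  | zero => simp
  | add x y hx hy => simp only [map_add, hx, hy]
  | tmul v y =>
    induction y with
    | zero => simp
    | add x y hx hy => simp only [map_add, hx, hy, TensorProduct.tmul_add]
    | tmul a b => simp [smul_smul, mul_comm]

/-- For a coaction of `H`, translation by a product of points is the composition of the
translations. -/
lemma contract_coaction_mul {V : Type} [AddCommGroup V] [Module ℂ V] (ρ : V →ₗ[ℂ] V ⊗[ℂ] H)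
    (hρ : ∀ v, TensorProduct.assoc ℂ V H H (ρ.rTensor H (ρ v)) =
      (Coalgebra.comul (R := ℂ)).lTensor V (ρ v)) (g h : H →ₐ[ℂ] ℂ) (v : V) :
    contract V (pointMul g h).toLinearMap (ρ v) =
      contract V g.toLinearMap (ρ (contract V h.toLinearMap (ρ v))) := by
  have h1 := contract_contract_assoc h g (TensorProduct.assoc ℂ V H H (ρ.rTensor H (ρ v)))
  rw [LinearEquiv.symm_apply_apply, contract_rTensor, hρ] at h1
  rw [h1]
  generalize ρ v = x
  induction x with
  | zero => simp
  | add x y hx hy => simp only [map_add, hx, hy]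
  | tmul v a => simp [pointMul]

lemma rightTranslate_apply (g : H →ₐ[ℂ] ℂ) (f : H) :
    rightTranslate g f = contract H g.toLinearMap (Coalgebra.comul (R := ℂ) f) :=
  evalRight_eq_contract H g _

lemma rightTranslate_mul (g h : H →ₐ[ℂ] ℂ) (f : H) :
    rightTranslate (pointMul g h) f = rightTranslate g (rightTranslate h f) := by
  simp only [rightTranslate_apply]
  exact contract_coaction_mul (Coalgebra.comul (R := ℂ) (A := H)) Coalgebra.coassoc_apply g h f

lemma adjoint_mul (g h : H →ₐ[ℂ] ℂ) (D : lieAlg H) :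
    adjoint H (pointMul g h) D = adjoint H g (adjoint H h D) := by
  refine adjoint_eq_of_forall fun f => ?_
  simp only [rightTranslate_mul, adjoint_apply_rightTranslate]

lemma adjoint_inv_mul (g h : H →ₐ[ℂ] ℂ) (D : lieAlg H) :
    adjoint H h (adjoint H (pointInv (pointMul g h)) D) = adjoint H (pointInv g) D := by
  apply adjoint_injective g
  rw [← adjoint_mul, adjoint_adjoint_inv, adjoint_adjoint_inv]

lemma counit_rightTranslate (g : H →ₐ[ℂ] ℂ) (f : H) :
    Coalgebra.counit (R := ℂ) (rightTranslate g f) = g f := by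
  have key : ∀ x : H ⊗[ℂ] H, Coalgebra.counit (R := ℂ) (contract H g.toLinearMap x) =
      g (TensorProduct.lid ℂ H ((Coalgebra.counit (R := ℂ)).rTensor H x)) := by
    intro x
    induction x with
    | zero => simp
    | add x y hx hy => simp only [map_add, hx, hy]
    | tmul a b => simp [mul_comm]
  rw [rightTranslate_apply, key, Coalgebra.rTensor_counit_comul, TensorProduct.lid_tmul, one_smul]

/-- Differentiate the antipode identity `S(f₁) f₂ = ε(f)` at the identity element. -/
lemma tangent_antipode (D : lieAlg H) (f : H) :
    tangent D (HopfAlgebra.antipode ℂ f) = - tangent D f := by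
  have h1 := HopfAlgebra.mul_antipode_rTensor_comul_apply (R := ℂ) f
  have key : ∀ x : H ⊗[ℂ] H, tangent D (LinearMap.mul' ℂ H
      ((HopfAlgebra.antipode ℂ).rTensor H x)) =
      tangent D (TensorProduct.lid ℂ H ((Coalgebra.counit (R := ℂ)).rTensor H x)) +
      tangent D (HopfAlgebra.antipode ℂ
        (TensorProduct.rid ℂ H ((Coalgebra.counit (R := ℂ)).lTensor H x))) := by
    intro x
    induction x with
    | zero => simp
    | add x y hx hy => simp only [map_add, hx, hy]; ring
    | tmul a b => simp [tangent_mul]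
  have h2 := key (Coalgebra.comul (R := ℂ) f)
  rw [h1, Coalgebra.rTensor_counit_comul, Coalgebra.lTensor_counit_comul, TensorProduct.lid_tmul,
    TensorProduct.rid_tmul, one_smul, Algebra.algebraMap_eq_smul_one, map_smul,
    tangent_one, smul_zero] at h2
  linear_combination -h2

/-- The matrix coefficient `g ↦ (Ad(g) D) f` at the identity of the adjoint representation. -/
def adjointCoeff (f : H) : lieAlg H →ₗ[ℂ] H where
  toFun D := LinearMap.mul' ℂ H (TensorProduct.map (D.1 : H →ₗ[ℂ] H) (HopfAlgebra.antipode ℂ)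
    (Coalgebra.comul (R := ℂ) f))
  map_add' D D' := by
    simp [TensorProduct.map_add_left]
  map_smul' c D := by
    simp [TensorProduct.map_smul_left]

lemma point_adjointCoeff (f : H) (D : lieAlg H) (g : H →ₐ[ℂ] ℂ) :
    g (adjointCoeff f D) = tangent (adjoint H g D) f := by
  rw [tangent_apply, adjoint_apply, counit_rightTranslate, rightTranslate_apply]
  change g (LinearMap.mul' ℂ H (TensorProduct.map _ _ _)) = _
  generalize Coalgebra.comul (R := ℂ) f = x
  induction x with
  | zero => simp
  | add x y hx hy => simp only [map_add, hx, hy]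
  | tmul a b => simp [pointInv, mul_comm]

/-- The derivative of `Ad` is `ad`: the product rule for `D(f₁) S(f₂)`, with `tangent_antipode` for
the second factor, gives the value of `Y D f - D Y f` at the identity. -/
lemma tangent_adjointCoeff (f : H) (D Y : lieAlg H) :
    tangent Y (adjointCoeff f D) = tangent ⁅Y, D⁆ f := by
  have key : ∀ x : H ⊗[ℂ] H, tangent Y (LinearMap.mul' ℂ H
      (TensorProduct.map (D.1 : H →ₗ[ℂ] H) (HopfAlgebra.antipode ℂ) x)) =
      tangent Y (D.1 (TensorProduct.rid ℂ H ((Coalgebra.counit (R := ℂ)).lTensor H x))) -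
      tangent D (contract H (tangent Y) x) := by
    intro x
    induction x with
    | zero => simp
    | add x y hx hy => simp only [map_add, hx, hy]; ring
    | tmul a b =>
      simp [tangent_mul, tangent_antipode, tangent_apply D a]
      ring
  refine (key _).trans ?_
  rw [Coalgebra.lTensor_counit_comul, TensorProduct.rid_tmul, one_smul, contract_tangent_comul]
  simp only [tangent_apply, LieSubalgebra.coe_bracket, Derivation.commutator_apply, map_sub]

variable (H) in
/-- The coaction of `H` on the Lie algebra that corresponds to the adjoint representation. -/
def adjointCoaction [Algebra.FiniteType ℂ H] : lieAlg H →ₗ[ℂ] lieAlg H ⊗[ℂ] H :=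
  ∑ j, (TensorProduct.mk ℂ (lieAlg H) H (lieBasis H j)) ∘ₗ adjointCoeff (dualFunction j)

lemma contract_adjointCoaction [Algebra.FiniteType ℂ H] (g : H →ₐ[ℂ] ℂ) (D : lieAlg H) :
    contract _ g.toLinearMap (adjointCoaction H D) = adjoint H g D := by
  conv_rhs => rw [← (lieBasis H).sum_repr (adjoint H g D)]
  simp [adjointCoaction, point_adjointCoeff, tangent_dualFunction]

lemma contract_tangent_adjointCoaction [Algebra.FiniteType ℂ H] (Y D : lieAlg H) :
    contract _ (tangent Y) (adjointCoaction H D) = ⁅Y, D⁆ := by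
  conv_rhs => rw [← (lieBasis H).sum_repr ⁅Y, D⁆]
  simp [adjointCoaction, tangent_adjointCoeff, tangent_dualFunction]

/-- The adjoint action of a point as an automorphism of the Lie algebra. -/
def adjointEquiv [Algebra.FiniteType ℂ H] (g : H →ₐ[ℂ] ℂ) : lieAlg H ≃ₗ[ℂ] lieAlg H :=
  LinearEquiv.ofInjectiveEndo (adjoint H g) (adjoint_injective g)

lemma adjointEquiv_coe [Algebra.FiniteType ℂ H] (g : H →ₐ[ℂ] ℂ) :
    (adjointEquiv g : lieAlg H →ₗ[ℂ] lieAlg H) = adjoint H g := rfl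

/-! ### Smoothness of the group -/

-- A reduced group scheme of finite type over `ℂ` is geometrically reduced by `isReduced_tensor`,
-- and a geometrically reduced group scheme locally of finite type over a field is smooth.
variable (H) in
lemma formallySmooth_hopf [Algebra.FiniteType ℂ H] [IsReduced H] : Algebra.FormallySmooth ℂ H := by
  let f : Spec (.of H) ⟶ Spec (.of ℂ) := Spec.map (CommRingCat.ofHom (algebraMap ℂ H))
  have : LocallyOfFiniteType f := locallyOfFiniteType_specOverSpec (R := .of ℂ) (A := .of H)
  let : GrpObj (Over.mk f) := instGrpObjSpecAsOverSpec (R := .of ℂ) (A := .of H)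
  have : GeometricallyReduced f := by
    refine (geometricallyReduced_iff _).2
      (geometrically_iff_of_commRing_of_isClosedUnderIsomorphisms.2 fun K _ _ => ?_)
    have : _root_.IsReduced (H ⊗[ℂ] K) := by
      have := isReduced_tensor (H := H) K
      exact isReduced_of_injective (Algebra.TensorProduct.comm ℂ H K)
        (Algebra.TensorProduct.comm ℂ H K).injective
    exact isReduced_of_isOpenImmersion (pullbackSpecIso ℂ H K).hom
  have h1 : Smooth f := smooth_of_grpObj f
  rw [HasRingHomProperty.Spec_iff (P := @Smooth)] at h1
  exact RingHom.formallySmooth_algebraMap.1 (RingHom.Smooth.formallySmooth h1)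

end Group

/-! ### The trace form -/

section Projection

variable {𝔤 : Type} [LieRing 𝔤] [LieAlgebra ℂ 𝔤] [FiniteDimensional ℂ 𝔤]

/-- With `T A = tr(A ∘ ad ·)`, the composite `T ∘ ad` is the Killing form, so the inverse of the
Killing form composed with `T` is a projection. It is the only one because `A` minus `ad` of its
projection is trace-orthogonal to `ad 𝔤`. -/
lemma existsUnique_projection [LieAlgebra.IsKilling ℂ 𝔤] :
    ∃! p : Module.End ℂ 𝔤 →ₗ[ℂ] 𝔤, IsTraceOrthogonalProjection 𝔤 p := by
  have hnd := LieAlgebra.IsKilling.killingForm_nondegenerate ℂ 𝔤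
  let e := (killingForm ℂ 𝔤).toDual hnd
  let T : Module.End ℂ 𝔤 →ₗ[ℂ] Module.Dual ℂ 𝔤 :=
    ((LinearMap.mul ℂ (Module.End ℂ 𝔤)).compr₂ (LinearMap.trace ℂ 𝔤)).compl₂
      (LieAlgebra.ad ℂ 𝔤 : 𝔤 →ₗ[ℂ] Module.End ℂ 𝔤)
  have hT : ∀ A X, T A X = LinearMap.trace ℂ 𝔤 (A * LieAlgebra.ad ℂ 𝔤 X) := fun _ _ => rfl
  have had : ∀ X, e.symm (T (LieAlgebra.ad ℂ 𝔤 X)) = X := fun X => by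
    rw [LinearEquiv.symm_apply_eq]
    rfl
  refine ⟨e.symm.toLinearMap ∘ₗ T, ⟨had, fun A hA => ?_⟩, fun q hq => LinearMap.ext fun A => ?_⟩
  · have : T A = 0 := LinearMap.ext hA
    simp [this]
  · have h1 : q (A - LieAlgebra.ad ℂ 𝔤 (e.symm (T A))) = 0 := by
      refine hq.2 _ fun X => ?_
      rw [← hT, map_sub, LinearMap.sub_apply, sub_eq_zero]
      conv_lhs => rw [← e.apply_symm_apply (T A)]
      rfl
    rw [map_sub, hq.1, sub_eq_zero] at h1
    exact h1

/-- The projection commutes with automorphisms. -/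
lemma IsTraceOrthogonalProjection.conj {p : Module.End ℂ 𝔤 →ₗ[ℂ] 𝔤}
    (hp : IsTraceOrthogonalProjection 𝔤 p) [LieAlgebra.IsKilling ℂ 𝔤] (e : 𝔤 ≃ₗ[ℂ] 𝔤)
    (he : ∀ X Y, e ⁅X, Y⁆ = ⁅e X, e Y⁆) (A : Module.End ℂ 𝔤) : p (e.conj A) = e (p A) := by
  have had : ∀ X, e.conj (LieAlgebra.ad ℂ 𝔤 X) = LieAlgebra.ad ℂ 𝔤 (e X) := fun X => by
    ext Y
    simp [LinearEquiv.conj_apply, he]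
  -- The conjugate of `p` by `e` has the same characterisation, since conjugation preserves traces
  -- and carries `ad X` to `ad (e X)`; uniqueness then identifies it with `p`.
  have hq : IsTraceOrthogonalProjection 𝔤
      (e.symm.toLinearMap ∘ₗ p ∘ₗ (e.conj : Module.End ℂ 𝔤 →ₗ[ℂ] Module.End ℂ 𝔤)) := by
    refine ⟨fun X => ?_, fun A hA => ?_⟩
    · change e.symm (p (e.conj (LieAlgebra.ad ℂ 𝔤 X))) = X
      rw [had, hp.1, e.symm_apply_apply]
    · change e.symm (p (e.conj A)) = 0
      rw [hp.2, map_zero]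
      intro X
      rw [← e.apply_symm_apply X, ← had, Module.End.mul_eq_comp, ← LinearEquiv.conj_comp,
        LinearMap.trace_conj']
      exact hA _
  have := (existsUnique_projection (𝔤 := 𝔤)).unique hp hq
  conv_rhs => rw [this]
  simp

end Projection

/-! ### Torsors in terms of rings -/

section Torsor

variable {H : Type} [CommRing H] [HopfAlgebra ℂ H] {A B : Type} [CommRing A] [Algebra ℂ A]
  [CommRing B] [Algebra ℂ B] [Algebra A B] [IsScalarTower ℂ A B]

/-- The map `b ⊗ b' ↦ b ρ(b')`. -/
def canMap (ρ : B →ₐ[ℂ] B ⊗[ℂ] H) (hρ : ∀ a : A, ρ (algebraMap A B a) = algebraMap A B a ⊗ₜ 1) :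
    B ⊗[A] B →ₐ[B] B ⊗[ℂ] H :=
  Algebra.TensorProduct.lift (Algebra.ofId B (B ⊗[ℂ] H))
    { ρ.toRingHom with commutes' := hρ } fun _ _ => Commute.all _ _

lemma canMap_tmul (ρ : B →ₐ[ℂ] B ⊗[ℂ] H)
    (hρ : ∀ a : A, ρ (algebraMap A B a) = algebraMap A B a ⊗ₜ 1) (b b' : B) :
    canMap ρ hρ (b ⊗ₜ b') = (b ⊗ₜ 1) * ρ b' := by
  rw [canMap, Algebra.TensorProduct.lift_tmul]
  rfl

variable (A) in
/-- The coaction `ρ` makes `Spec B` a principal bundle over `Spec A`. -/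
structure IsTorsor (ρ : B →ₐ[ℂ] B ⊗[ℂ] H) : Prop where
  map_base : ∀ a : A, ρ (algebraMap A B a) = algebraMap A B a ⊗ₜ 1
  counit : ∀ b, evalRight B (Bialgebra.counitAlgHom ℂ H) (ρ b) = b
  coassoc : ∀ b, TensorProduct.assoc ℂ B H H (ρ.toLinearMap.rTensor H (ρ b)) =
    (Coalgebra.comul (R := ℂ)).lTensor B (ρ b)
  bijective : Function.Bijective (canMap ρ map_base)
  faithfullyFlat : Module.FaithfullyFlat A B

namespace IsTorsor

variable {ρ : B →ₐ[ℂ] B ⊗[ℂ] H}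

/-- The isomorphism `b ⊗ b' ↦ b ρ(b')`. -/
def canEquiv (hρ : IsTorsor A ρ) : B ⊗[A] B ≃ₐ[B] B ⊗[ℂ] H :=
  AlgEquiv.ofBijective (canMap ρ hρ.map_base) hρ.bijective

lemma canEquiv_tmul (hρ : IsTorsor A ρ) (b b' : B) : hρ.canEquiv (b ⊗ₜ b') = (b ⊗ₜ 1) * ρ b' :=
  canMap_tmul ρ hρ.map_base b b'

/-- The pullback of one-forms along a principal bundle is injective. -/
lemma mapBaseChange_injective (hρ : IsTorsor A ρ) [Algebra.FiniteType ℂ H] [IsReduced H] :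
    Function.Injective (KaehlerDifferential.mapBaseChange ℂ A B) := by
  -- The kernel is the image of `H1Cotangent A B` in the Jacobi-Zariski sequence. After the
  -- faithfully flat base change to `B` the torsor becomes `B ⊗ H`, formally smooth over `B`, so
  -- this module vanishes.
  have := hρ.faithfullyFlat
  have := formallySmooth_hopf H
  have : Algebra.FormallySmooth B (B ⊗[A] B) := .of_equiv hρ.canEquiv.symm
  have h1 : Subsingleton (Algebra.H1Cotangent B (B ⊗[A] B)) := inferInstance
  have h2 : Subsingleton (B ⊗[A] Algebra.H1Cotangent A B) :=
    (Algebra.tensorH1CotangentOfFlat A B B).subsingleton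
  have h3 : Subsingleton (Algebra.H1Cotangent A B) :=
    Module.FaithfullyFlat.lTensor_reflects_triviality A B _
  rw [injective_iff_map_eq_zero]
  intro x hx
  obtain ⟨y, rfl⟩ := (Algebra.H1Cotangent.exact_δ_mapBaseChange ℂ A B x).1 hx
  rw [Subsingleton.elim y 0, map_zero]

/-- Taylor expansion along the unit section of `Spec B × G`, obtained from `taylor_mem` by
multiplying with coefficients in `B`. -/
lemma expansion_mem [Algebra.FiniteType ℂ H] (u : B ⊗[ℂ] H) :
    u - evalRight B (Bialgebra.counitAlgHom ℂ H) u ⊗ₜ 1 -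
      ∑ j, contract B (tangent (lieBasis H j)) u ⊗ₜ dualFunction j ∈
    RingHom.ker (evalRight B (Bialgebra.counitAlgHom ℂ H)) ^ 2 := by
  set J := RingHom.ker (evalRight B (Bialgebra.counitAlgHom ℂ H)) with hJ
  induction u with
  | zero => simp
  | add u v hu hv =>
    convert add_mem hu hv using 1
    simp only [map_add, TensorProduct.add_tmul, Finset.sum_add_distrib]
    abel
  | tmul b h =>
    let incl : H →ₐ[ℂ] B ⊗[ℂ] H := Algebra.TensorProduct.includeRight
    have h1 : (augIdeal H ^ 2).map incl ≤ J ^ 2 := by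
      rw [Ideal.map_pow]
      refine Ideal.pow_right_mono (Ideal.map_le_iff_le_comap.2 fun x hx => ?_) 2
      have hx' : Bialgebra.counitAlgHom ℂ H x = 0 := hx
      change evalRight B (Bialgebra.counitAlgHom ℂ H) (1 ⊗ₜ x) = 0
      rw [evalRight_tmul, hx', zero_smul]
    have h2 := Ideal.mul_mem_left (J ^ 2) (b ⊗ₜ 1) (h1 (Ideal.mem_map_of_mem incl (taylor_mem h)))
    convert h2 using 1
    simp only [map_sub, map_sum, mul_sub, Finset.mul_sum, incl,
      Algebra.TensorProduct.includeRight_apply, Algebra.TensorProduct.tmul_mul_tmul, mul_one,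
      one_mul, evalRight_tmul, contract_tmul, TensorProduct.smul_tmul,
      Algebra.algebraMap_eq_smul_one]
    rfl

/-- The fundamental vector field of `D`, as a derivation over the base. -/
def field (hρ : IsTorsor A ρ) (D : lieAlg H) : Derivation A B B :=
  { coactionField ρ hρ.counit D with
    map_smul' := fun a b => by
      change contract B (tangent D) (ρ (a • b)) = a • contract B (tangent D) (ρ b)
      rw [Algebra.smul_def, map_mul, hρ.map_base]
      generalize ρ b = x
      induction x with
      | zero => simp
      | add x y hx hy => simp only [map_add, hx, hy, mul_add, smul_add]
      | tmul b h => simp [Algebra.smul_def]; ring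
    map_one_eq_zero' := (coactionField ρ hρ.counit D).map_one_eq_zero
    leibniz' := (coactionField ρ hρ.counit D).leibniz }

lemma field_apply (hρ : IsTorsor A ρ) (D : lieAlg H) (b : B) :
    hρ.field D b = contract B (tangent D) (ρ b) := rfl

/-- A relative one-form that vanishes on all fundamental vector fields is zero. -/
lemma eq_zero_of_field (hρ : IsTorsor A ρ) [Algebra.FiniteType ℂ H] (y : Ω[B⁄A])
    (hy : ∀ D, (hρ.field D).liftKaehlerDifferential y = 0) : y = 0 := by
  -- Relative one-forms are `I / I²` for the ideal `I` of the diagonal. The isomorphism `B ⊗_A B ≅ B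
  -- ⊗ H` carries the diagonal to the unit section and the fundamental fields to contractions with
  -- tangent vectors. So `i` has no constant and no linear Taylor term, and lies in `I²`.
  obtain ⟨⟨i, hi⟩, rfl⟩ := Ideal.toCotangent_surjective _ y
  have h0 : ∀ i, evalRight B (Bialgebra.counitAlgHom ℂ H) (hρ.canEquiv i) =
      Algebra.TensorProduct.lmul' A i := by
    intro i
    induction i with
    | zero => simp
    | add x y hx hy => simp only [map_add, hx, hy]
    | tmul b b' =>
      rw [canEquiv_tmul, map_mul, hρ.counit]
      simp
  have h1 : ∀ D i, contract B (tangent D) (hρ.canEquiv i) = (hρ.field D).tensorProductTo i := by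
    intro D i
    induction i with
    | zero => simp
    | add x y hx hy => simp only [map_add, hx, hy]
    | tmul b b' =>
      rw [canEquiv_tmul, Derivation.tensorProductTo_tmul, field_apply]
      generalize ρ b' = x
      induction x with
      | zero => simp
      | add x y hx hy => simp only [map_add, hx, hy, mul_add, smul_add]
      | tmul b h => simp
  have h2 : ∀ D, contract B (tangent D) (hρ.canEquiv i) = 0 := fun D => (h1 D i).trans (hy D)
  have h3 := expansion_mem (hρ.canEquiv i)
  have hi' : Algebra.TensorProduct.lmul' A i = 0 := hi
  simp only [h0, hi', h2, TensorProduct.zero_tmul, Finset.sum_const_zero, sub_zero] at h3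
  refine (Ideal.toCotangent_eq_zero _ _).2 ?_
  have h4 : (RingHom.ker (evalRight B (Bialgebra.counitAlgHom ℂ H))).map hρ.canEquiv.symm ≤
      KaehlerDifferential.ideal A B := by
    refine Ideal.map_le_iff_le_comap.2 fun x hx => ?_
    obtain ⟨x, rfl⟩ := hρ.canEquiv.surjective x
    change Algebra.TensorProduct.lmul' A (hρ.canEquiv.symm (hρ.canEquiv x)) = 0
    rw [AlgEquiv.symm_apply_apply, ← h0]
    exact hx
  have h5 := Ideal.mem_map_of_mem hρ.canEquiv.symm h3
  rw [AlgEquiv.symm_apply_apply, Ideal.map_pow] at h5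
  exact Ideal.pow_right_mono h4 2 h5

/-- A one-form that vanishes on all fundamental vector fields comes from the base. -/
lemma mem_range_mapBaseChange (hρ : IsTorsor A ρ) [Algebra.FiniteType ℂ H] (z : Ω[B⁄ℂ])
    (hz : ∀ D, (coactionField ρ hρ.counit D).liftKaehlerDifferential z = 0) :
    z ∈ LinearMap.range (KaehlerDifferential.mapBaseChange ℂ A B) := by
  -- By exactness of `B ⊗ Ω_A → Ω_B → Ω_{B/A}` it suffices that the relative form vanishes.
  refine (KaehlerDifferential.exact_mapBaseChange_map ℂ A B z).1
    (hρ.eq_zero_of_field _ fun D => ?_)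
  rw [← hz D]
  have h1 : ((hρ.field D).liftKaehlerDifferential.restrictScalars B) ∘ₗ
      KaehlerDifferential.map ℂ A B B =
      (coactionField ρ hρ.counit D).liftKaehlerDifferential := by
    apply Derivation.liftKaehlerDifferential_unique
    ext b
    simp [KaehlerDifferential.map_D]
    rfl
  exact LinearMap.congr_fun h1 z

end IsTorsor

end Torsor

/-! ### Evaluation at points, linearly over a base algebra -/

section ContractBase

variable {H : Type} [AddCommGroup H] [Module ℂ H]

/-- The contraction with a linear form on `H`, linear over a base algebra. -/
def contractBase (A V : Type) [CommRing A] [Algebra ℂ A] [AddCommGroup V] [Module ℂ V] [Module A V]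
    [IsScalarTower ℂ A V] (δ : H →ₗ[ℂ] ℂ) : V ⊗[ℂ] H →ₗ[A] V :=
  (TensorProduct.AlgebraTensorModule.rid ℂ A V).toLinearMap ∘ₗ
    TensorProduct.AlgebraTensorModule.lTensor A V δ

variable {A V : Type} [CommRing A] [Algebra ℂ A] [AddCommGroup V] [Module ℂ V] [Module A V]
  [IsScalarTower ℂ A V]

@[simp] lemma contractBase_tmul (δ : H →ₗ[ℂ] ℂ) (v : V) (h : H) :
    contractBase A V δ (v ⊗ₜ h) = δ h • v := by
  simp [contractBase]

lemma contractBase_apply (δ : H →ₗ[ℂ] ℂ) (x : V ⊗[ℂ] H) :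
    contractBase A V δ x = contract V δ x := by
  induction x with
  | zero => simp
  | add x y hx hy => simp only [map_add, hx, hy]
  | tmul v h => simp

lemma contract_smul (δ : H →ₗ[ℂ] ℂ) (a : A) (x : V ⊗[ℂ] H) :
    contract V δ (a • x) = a • contract V δ x := by
  rw [← contractBase_apply (A := A), ← contractBase_apply (A := A), map_smul]

end ContractBase

/-- Reassociating moves `H` to the outside, which reduces this to `eq_zero_of_forall_contract` with
values in `N ⊗[A] V`. -/
lemma eq_zero_of_forall_lTensor_contractBase {H : Type} [CommRing H] [HopfAlgebra ℂ H]
    [Algebra.FiniteType ℂ H] [IsReduced H]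
    {A V N : Type} [CommRing A] [Algebra ℂ A] [AddCommGroup V] [Module ℂ V] [Module A V]
    [IsScalarTower ℂ A V] [AddCommGroup N] [Module ℂ N] [Module A N] [IsScalarTower ℂ A N]
    (y : N ⊗[A] (V ⊗[ℂ] H))
    (hy : ∀ g : H →ₐ[ℂ] ℂ, (contractBase A V g.toLinearMap).lTensor N y = 0) : y = 0 := by
  let e := TensorProduct.AlgebraTensorModule.assoc ℂ A A N V H
  have key : ∀ (g : H →ₐ[ℂ] ℂ) (x : (N ⊗[A] V) ⊗[ℂ] H),
      (contractBase A V g.toLinearMap).lTensor N (e x) = contract (N ⊗[A] V) g.toLinearMap x := by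
    intro g x
    induction x with
    | zero => simp
    | add x y hx hy => simp only [map_add, hx, hy]
    | tmul v h =>
      induction v with
      | zero => simp
      | add x y hx hy => simp only [map_add, hx, hy, TensorProduct.add_tmul]
      | tmul n v => simp [e]
  obtain ⟨x, rfl⟩ := e.surjective y
  have : x = 0 := eq_zero_of_forall_contract x fun g => by rw [← key, hy]
  rw [this, map_zero]

/-! ### Descent of the adjoint bundle: invariant Lie algebra valued functions -/

section Invariants

variable {H : Type} [CommRing H] [HopfAlgebra ℂ H] {A B : Type} [CommRing A] [Algebra ℂ A]
  [CommRing B] [Algebra ℂ B] [Algebra A B] [IsScalarTower ℂ A B]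

/-- Translation of functions by a point of the group. -/
def translateHom (ρ : B →ₐ[ℂ] B ⊗[ℂ] H) (g : H →ₐ[ℂ] ℂ) : B →ₐ[ℂ] B := (evalRight B g).comp ρ

lemma translateHom_apply (ρ : B →ₐ[ℂ] B ⊗[ℂ] H) (g : H →ₐ[ℂ] ℂ) (b : B) :
    translateHom ρ g b = contract B g.toLinearMap (ρ b) := evalRight_eq_contract B g _

/-- Translation of Lie algebra valued functions by a point of the group. -/
def sectionTranslate (ρ : B →ₐ[ℂ] B ⊗[ℂ] H) (g : H →ₐ[ℂ] ℂ) :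
    B ⊗[ℂ] lieAlg H →ₗ[ℂ] B ⊗[ℂ] lieAlg H :=
  TensorProduct.map (translateHom ρ g).toLinearMap (adjoint H g)

@[simp] lemma sectionTranslate_tmul (ρ : B →ₐ[ℂ] B ⊗[ℂ] H) (g : H →ₐ[ℂ] ℂ) (b : B) (X : lieAlg H) :
    sectionTranslate ρ g (b ⊗ₜ X) = translateHom ρ g b ⊗ₜ adjoint H g X := rfl

/-- The product of functions in `B ⊗ H` and in `W ⊗ H`. -/
def mulFunctions (B W H : Type) [CommRing B] [Algebra ℂ B] [AddCommGroup W] [Module ℂ W]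
    [CommRing H] [Algebra ℂ H] : (B ⊗[ℂ] H) ⊗[ℂ] (W ⊗[ℂ] H) →ₗ[ℂ] (B ⊗[ℂ] W) ⊗[ℂ] H :=
  (LinearMap.mul' ℂ H).lTensor (B ⊗[ℂ] W) ∘ₗ
    (TensorProduct.tensorTensorTensorComm ℂ B H W H).toLinearMap

@[simp] lemma mulFunctions_tmul {W : Type} [AddCommGroup W] [Module ℂ W] (b : B) (h : H) (w : W)
    (h' : H) : mulFunctions B W H ((b ⊗ₜ h) ⊗ₜ (w ⊗ₜ h')) = (b ⊗ₜ w) ⊗ₜ (h * h') := by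
  simp [mulFunctions]

lemma contract_point_mulFunctions {W : Type} [AddCommGroup W] [Module ℂ W] (g : H →ₐ[ℂ] ℂ)
    (x : B ⊗[ℂ] H) (y : W ⊗[ℂ] H) :
    contract (B ⊗[ℂ] W) g.toLinearMap (mulFunctions B W H (x ⊗ₜ y)) =
      contract B g.toLinearMap x ⊗ₜ contract W g.toLinearMap y := by
  induction x with
  | zero => simp
  | add x x' hx hx' => simp only [map_add, TensorProduct.add_tmul, hx, hx']
  | tmul b h =>
    induction y with
    | zero => simp
    | add y y' hy hy' => simp only [map_add, TensorProduct.tmul_add, hy, hy']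
    | tmul w h' => simp [← TensorProduct.smul_tmul', smul_smul, mul_comm]

lemma contract_tangent_mulFunctions {W : Type} [AddCommGroup W] [Module ℂ W] (D : lieAlg H)
    (x : B ⊗[ℂ] H) (y : W ⊗[ℂ] H) :
    contract (B ⊗[ℂ] W) (tangent D) (mulFunctions B W H (x ⊗ₜ y)) =
      contract B (Bialgebra.counitAlgHom ℂ H).toLinearMap x ⊗ₜ contract W (tangent D) y +
      contract B (tangent D) x ⊗ₜ contract W (Bialgebra.counitAlgHom ℂ H).toLinearMap y := by
  induction x with
  | zero => simp
  | add x x' hx hx' => simp only [map_add, TensorProduct.add_tmul, hx, hx']; abel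
  | tmul b h =>
    induction y with
    | zero => simp
    | add y y' hy hy' => simp only [map_add, TensorProduct.tmul_add, hy, hy']; abel
    | tmul w h' =>
      simp [tangent_mul, add_smul, ← TensorProduct.smul_tmul', smul_smul, mul_comm]

lemma adjoint_counit (X : lieAlg H) : adjoint H (Bialgebra.counitAlgHom ℂ H) X = X := by
  have h : ∀ f : H, rightTranslate (Bialgebra.counitAlgHom ℂ H) f = f := fun f => by
    rw [rightTranslate_apply]
    change TensorProduct.rid ℂ H ((Coalgebra.counit (R := ℂ)).lTensor H _) = f
    rw [Coalgebra.lTensor_counit_comul, TensorProduct.rid_tmul, one_smul]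
  exact adjoint_eq_of_forall fun f => by rw [h, h]

lemma pointMul_counit_left (g : H →ₐ[ℂ] ℂ) : pointMul (Bialgebra.counitAlgHom ℂ H) g = g := by
  refine AlgHom.ext fun f => ?_
  rw [← counit_rightTranslate, rightTranslate_mul, ← Bialgebra.counitAlgHom_apply ℂ,
    ← counit_rightTranslate g]
  rw [rightTranslate_apply]
  change Coalgebra.counit (TensorProduct.rid ℂ H ((Coalgebra.counit (R := ℂ)).lTensor H _)) = _
  rw [Coalgebra.lTensor_counit_comul, TensorProduct.rid_tmul, one_smul]

namespace IsTorsor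

variable {ρ : B →ₐ[ℂ] B ⊗[ℂ] H}

lemma translateHom_algebraMap (hρ : IsTorsor A ρ) (g : H →ₐ[ℂ] ℂ) (a : A) :
    translateHom ρ g (algebraMap A B a) = algebraMap A B a := by
  rw [translateHom_apply, hρ.map_base]
  simp

lemma translateHom_counit (hρ : IsTorsor A ρ) (b : B) :
    translateHom ρ (Bialgebra.counitAlgHom ℂ H) b = b := hρ.counit b

lemma translateHom_mul (hρ : IsTorsor A ρ) (g h : H →ₐ[ℂ] ℂ) (b : B) :
    translateHom ρ (pointMul g h) b = translateHom ρ g (translateHom ρ h b) := by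
  simp only [translateHom_apply]
  exact contract_coaction_mul ρ.toLinearMap hρ.coassoc g h b

/-- Translation of Lie algebra valued functions is linear over the base. -/
def translateBase (hρ : IsTorsor A ρ) (g : H →ₐ[ℂ] ℂ) :
    B ⊗[ℂ] lieAlg H →ₗ[A] B ⊗[ℂ] lieAlg H where
  toFun := sectionTranslate ρ g
  map_add' := map_add _
  map_smul' a s := map_smul_adjoint (translateHom ρ g) (hρ.translateHom_algebraMap g) g a s

/-- The map `b ⊗ (b' ⊗ X) ↦ b ρ(b') ⊗ X`, with the factors `H` and `𝔤` exchanged. -/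
def canSections (hρ : IsTorsor A ρ) :
    B ⊗[A] (B ⊗[ℂ] lieAlg H) ≃ₗ[ℂ] (B ⊗[ℂ] lieAlg H) ⊗[ℂ] H :=
  ((TensorProduct.AlgebraTensorModule.assoc ℂ A A B B (lieAlg H)).symm.restrictScalars ℂ).trans
    (((hρ.canEquiv.toLinearEquiv.restrictScalars ℂ).rTensor (lieAlg H)).trans
      (TensorProduct.rightComm ℂ B H (lieAlg H)))

/-- An element of `B ⊗_A (B ⊗ 𝔤)` is a function of pairs `(x, y)` in one fibre; `canSections` puts
`y = x g`, and the contraction fixes `g`. -/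
lemma contract_canSections_tmul (hρ : IsTorsor A ρ) (g : H →ₐ[ℂ] ℂ) (b b' : B) (X : lieAlg H) :
    contract _ g.toLinearMap (hρ.canSections (b ⊗ₜ (b' ⊗ₜ X))) =
      (b * translateHom ρ g b') ⊗ₜ X := by
  have h1 : hρ.canSections (b ⊗ₜ (b' ⊗ₜ X)) =
      TensorProduct.rightComm ℂ B H (lieAlg H) (hρ.canEquiv (b ⊗ₜ b') ⊗ₜ X) := rfl
  have h2 : ∀ x : B ⊗[ℂ] H, contract _ g.toLinearMap
      (TensorProduct.rightComm ℂ B H (lieAlg H) (x ⊗ₜ X)) = evalRight B g x ⊗ₜ X := by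
    intro x
    induction x with
    | zero => simp
    | add x y hx hy => simp only [map_add, TensorProduct.add_tmul, hx, hy]
    | tmul b h => simp [TensorProduct.smul_tmul']
  rw [h1, h2, canEquiv_tmul, map_mul, evalRight_tmul, map_one, one_smul]
  rfl

/-- For `y = x h`, translating the second variable by `g` leads to the point `y g = x (h g)`. -/
lemma contract_canSections_translate (hρ : IsTorsor A ρ) (g h : H →ₐ[ℂ] ℂ)
    (x : B ⊗[A] (B ⊗[ℂ] lieAlg H)) :
    contract _ h.toLinearMap (hρ.canSections ((hρ.translateBase g).lTensor B x)) =
      (adjoint H g).lTensor B (contract _ (pointMul h g).toLinearMap (hρ.canSections x)) := by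
  induction x with
  | zero => simp
  | add x y hx hy => simp only [map_add, hx, hy]
  | tmul b s =>
    induction s with
    | zero => simp
    | add x y hx hy => simp only [map_add, TensorProduct.tmul_add, hx, hy]
    | tmul b' X =>
      rw [LinearMap.lTensor_tmul]
      change contract _ _ (hρ.canSections (b ⊗ₜ (translateHom ρ g b' ⊗ₜ adjoint H g X))) = _
      rw [contract_canSections_tmul, contract_canSections_tmul, hρ.translateHom_mul,
        LinearMap.lTensor_tmul]

/-- Evaluation at the identity is restriction to the diagonal `y = x`, that is, multiplication of
the coefficients. -/
lemma contract_canSections_subtype (hρ : IsTorsor A ρ) {M : Submodule A (B ⊗[ℂ] lieAlg H)}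
    (x : B ⊗[A] M) :
    contract _ (Bialgebra.counitAlgHom ℂ H).toLinearMap
      (hρ.canSections (M.subtype.lTensor B x)) = M.subtype.liftBaseChange B x := by
  induction x with
  | zero => simp
  | add x y hx hy => simp only [map_add, hx, hy]
  | tmul b s =>
    rw [LinearMap.lTensor_tmul, LinearMap.liftBaseChange_tmul]
    generalize M.subtype s = t
    induction t with
    | zero => simp
    | add x y hx hy => simp only [map_add, TensorProduct.tmul_add, smul_add, hx, hy]
    | tmul b' X =>
      rw [contract_canSections_tmul, hρ.translateHom_counit, TensorProduct.smul_tmul', smul_eq_mul]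

variable [Algebra.FiniteType ℂ H]

variable (ρ) in
/-- The coaction on Lie algebra valued functions. -/
def sectionCoaction : B ⊗[ℂ] lieAlg H →ₗ[ℂ] (B ⊗[ℂ] lieAlg H) ⊗[ℂ] H :=
  mulFunctions B (lieAlg H) H ∘ₗ TensorProduct.map ρ.toLinearMap (adjointCoaction H)

variable (ρ) in
lemma contract_sectionCoaction (g : H →ₐ[ℂ] ℂ) (s : B ⊗[ℂ] lieAlg H) :
    contract _ g.toLinearMap (sectionCoaction ρ s) = sectionTranslate ρ g s := by
  induction s with
  | zero => simp
  | add x y hx hy => simp only [map_add, hx, hy]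
  | tmul b X =>
    rw [sectionCoaction, LinearMap.comp_apply, TensorProduct.map_tmul, contract_point_mulFunctions,
      contract_adjointCoaction, sectionTranslate_tmul, translateHom_apply]
    rfl

/-- Product rule: the derivative of `Ad` acts on the values and the fundamental field on the
coefficients. -/
lemma contract_tangent_sectionCoaction (hρ : IsTorsor A ρ) (D : lieAlg H)
    (s : B ⊗[ℂ] lieAlg H) : contract _ (tangent D) (sectionCoaction ρ s) =
      (LieAlgebra.ad ℂ (lieAlg H) D).lTensor B s +
        ((coactionField ρ hρ.counit D : Derivation ℂ B B) : B →ₗ[ℂ] B).rTensor _ s := by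
  induction s with
  | zero => simp
  | add x y hx hy => simp only [map_add, hx, hy]; abel
  | tmul b X =>
    rw [sectionCoaction, LinearMap.comp_apply, TensorProduct.map_tmul,
      contract_tangent_mulFunctions, contract_tangent_adjointCoaction, contract_adjointCoaction,
      adjoint_counit, ← evalRight_eq_contract]
    have := hρ.counit b
    change evalRight B (Bialgebra.counitAlgHom ℂ H) (ρ b) ⊗ₜ _ + _ = _
    rw [this]
    rfl

variable [IsReduced H]

/-- The difference of the coaction and the trivial coaction is linear over the base. -/
def coactionDiff (hρ : IsTorsor A ρ) : B ⊗[ℂ] lieAlg H →ₗ[A] (B ⊗[ℂ] lieAlg H) ⊗[ℂ] H where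
  toFun s := sectionCoaction ρ s - s ⊗ₜ 1
  map_add' s t := by rw [map_add, TensorProduct.add_tmul]; abel
  map_smul' a s := eq_of_forall_contract fun g => by
    rw [RingHom.id_apply, contract_smul, map_sub, map_sub, contract_sectionCoaction,
      contract_sectionCoaction, contract_tmul, contract_tmul, smul_sub, smul_comm a]
    congr 1
    exact (hρ.translateBase g).map_smul a s

lemma contractBase_comp_coactionDiff (hρ : IsTorsor A ρ) (g : H →ₐ[ℂ] ℂ) :
    contractBase A _ g.toLinearMap ∘ₗ hρ.coactionDiff = hρ.translateBase g - LinearMap.id := by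
  refine LinearMap.ext fun s => ?_
  rw [LinearMap.comp_apply, contractBase_apply]
  change contract _ _ (sectionCoaction ρ s - s ⊗ₜ 1) = _
  rw [map_sub, contract_sectionCoaction, contract_tmul]
  simp
  rfl

variable {M : Submodule A (B ⊗[ℂ] lieAlg H)}

/-- Since points detect elements of a tensor product with `H`, invariance under all points is the
vanishing of a single `A`-linear map. A kernel, unlike an infinite family of conditions, passes
through flat base change. -/
lemma exact_subtype_coactionDiff (hρ : IsTorsor A ρ)
    (hM : ∀ s, s ∈ M ↔ ∀ g, sectionTranslate ρ g s = s) :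
    Function.Exact M.subtype hρ.coactionDiff := by
  intro s
  have h1 : s ∈ Set.range M.subtype ↔ s ∈ M := by simp
  rw [h1, hM]
  constructor
  · intro h g
    have h2 := LinearMap.congr_fun (hρ.contractBase_comp_coactionDiff g) s
    rw [LinearMap.comp_apply, h, map_zero] at h2
    exact (sub_eq_zero.1 h2.symm)
  · intro h
    refine eq_zero_of_forall_contract _ fun g => ?_
    have h2 := LinearMap.congr_fun (hρ.contractBase_comp_coactionDiff g) s
    rw [LinearMap.comp_apply, contractBase_apply] at h2
    exact h2.trans (sub_eq_zero.2 (h g))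

/-- Taking invariants commutes with flat base change. -/
lemma exists_of_invariant (hρ : IsTorsor A ρ)
    (hM : ∀ s, s ∈ M ↔ ∀ g, sectionTranslate ρ g s = s)
    (N : Type) [AddCommGroup N] [Module ℂ N] [Module A N] [IsScalarTower ℂ A N] [Module.Flat A N]
    (x : N ⊗[A] (B ⊗[ℂ] lieAlg H)) (hx : ∀ g, (hρ.translateBase g).lTensor N x = x) :
    ∃ m : N ⊗[A] M, M.subtype.lTensor N m = x := by
  have hex := hρ.exact_subtype_coactionDiff hM
  have h2 := @Module.Flat.lTensor_exact A N _ _ _ _ M (B ⊗[ℂ] lieAlg H)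
    ((B ⊗[ℂ] lieAlg H) ⊗[ℂ] H) _ _ _ _ _ _ M.subtype hρ.coactionDiff hex
  refine (h2 x).1 ?_
  refine eq_zero_of_forall_lTensor_contractBase _ fun g => ?_
  rw [← LinearMap.lTensor_comp_apply, contractBase_comp_coactionDiff, LinearMap.lTensor_sub,
    LinearMap.sub_apply, hx, LinearMap.lTensor_id, LinearMap.id_apply, sub_self]

/-- An invariant section `s` satisfies `D s + [D, s] = 0`. -/
lemma field_add_ad_eq_zero (hρ : IsTorsor A ρ) (s : B ⊗[ℂ] lieAlg H)
    (hs : ∀ g, sectionTranslate ρ g s = s) (D : lieAlg H) :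
    ((coactionField ρ hρ.counit D : Derivation ℂ B B) : B →ₗ[ℂ] B).rTensor _ s +
      (LieAlgebra.ad ℂ (lieAlg H) D).lTensor B s = 0 := by
  -- Invariance at all points makes `s` coinvariant; differentiating at the identity gives the
  -- claim.
  have h1 : sectionCoaction ρ s = s ⊗ₜ 1 := eq_of_forall_contract fun g => by
    rw [contract_sectionCoaction, hs, contract_tmul]
    simp
  have h2 := hρ.contract_tangent_sectionCoaction D s
  rw [h1, contract_tmul, tangent_one, zero_smul, add_comm] at h2
  exact h2.symm

/-- Elements of `B ⊗_A M` are the functions of `(x, x g)` that are equivariant in the second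
variable. Such a function is determined by its values at `g = e`, and these may be prescribed
arbitrarily. -/
lemma liftBaseChange_bijective (hρ : IsTorsor A ρ)
    (hM : ∀ s, s ∈ M ↔ ∀ g, sectionTranslate ρ g s = s) :
    Function.Bijective (M.subtype.liftBaseChange B) := by
  have := hρ.faithfullyFlat
  constructor
  · rw [injective_iff_map_eq_zero]
    intro x hx
    rw [← hρ.contract_canSections_subtype] at hx
    have hinj : Function.Injective (M.subtype.lTensor B) :=
      Module.Flat.lTensor_preserves_injective_linearMap _ M.injective_subtype
    refine (map_eq_zero_iff _ hinj).1 ((map_eq_zero_iff _ hρ.canSections.injective).1 ?_)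
    refine eq_zero_of_forall_contract _ fun g => ?_
    have h1 : (hρ.translateBase g).lTensor B (M.subtype.lTensor B x) = M.subtype.lTensor B x := by
      rw [← LinearMap.lTensor_comp_apply]
      congr 2
      exact LinearMap.ext fun s => (hM _).1 s.2 g
    -- Equivariance carries the vanishing at the identity to every point `g`, up to the injective
    -- map `Ad(g)`.
    have h2 := hρ.contract_canSections_translate g (Bialgebra.counitAlgHom ℂ H)
      (M.subtype.lTensor B x)
    rw [h1, hx, pointMul_counit_left] at h2
    have hinj' : Function.Injective ((adjoint H g).lTensor B) :=
      Module.Flat.lTensor_preserves_injective_linearMap _ (adjoint_injective g)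
    exact (map_eq_zero_iff _ hinj').1 h2.symm
  · have key : ∀ X : lieAlg H, ∃ x, M.subtype.liftBaseChange B x = (1 : B) ⊗ₜ[ℂ] X := by
      intro X
      -- The equivariant extension of the constant `X`: the function `(x, x g) ↦ Ad(g⁻¹) X`.
      let z : (B ⊗[ℂ] lieAlg H) ⊗[ℂ] H := (TensorProduct.mk ℂ B (lieAlg H) 1).rTensor H
        ((HopfAlgebra.antipode ℂ).lTensor (lieAlg H) (adjointCoaction H X))
      have hz : ∀ g : H →ₐ[ℂ] ℂ, contract _ g.toLinearMap z =
          1 ⊗ₜ adjoint H (pointInv g) X := by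
        intro g
        have h1 : ∀ y : lieAlg H ⊗[ℂ] H, contract _ g.toLinearMap
            ((HopfAlgebra.antipode ℂ).lTensor (lieAlg H) y) =
            contract _ (pointInv g).toLinearMap y := by
          intro y
          induction y with
          | zero => simp
          | add x y hx hy => simp only [map_add, hx, hy]
          | tmul b h => simp [pointInv]
        rw [contract_rTensor, h1, contract_adjointCoaction]
        rfl
      obtain ⟨m, hm⟩ := hρ.exists_of_invariant hM B (hρ.canSections.symm z) fun g => by
        apply hρ.canSections.injective
        refine eq_of_forall_contract fun h => ?_
        rw [contract_canSections_translate, LinearEquiv.apply_symm_apply, hz, hz,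
          LinearMap.lTensor_tmul, adjoint_inv_mul]
      refine ⟨m, ?_⟩
      rw [← hρ.contract_canSections_subtype, hm, LinearEquiv.apply_symm_apply, hz]
      congr 1
      have h1 := adjoint_adjoint_inv (Bialgebra.counitAlgHom ℂ H) X
      rwa [adjoint_counit] at h1
    intro s
    induction s with
    | zero => exact ⟨0, map_zero _⟩
    | add s t hs ht =>
      obtain ⟨x, rfl⟩ := hs
      obtain ⟨y, rfl⟩ := ht
      exact ⟨x + y, map_add _ _ _⟩
    | tmul b X =>
      obtain ⟨x, hx⟩ := key X
      refine ⟨b • x, ?_⟩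
      rw [map_smul, hx, TensorProduct.smul_tmul', smul_eq_mul, mul_one]

end IsTorsor

end Invariants

section Forms

/-! ### Forms on the total space -/

variable {B B' : Type} [CommRing B] [Algebra ℂ B] [CommRing B'] [Algebra ℂ B']

lemma kaehler_induction {p : Ω[B⁄ℂ] → Prop} (τ : Ω[B⁄ℂ]) (zero : p 0)
    (add : ∀ x y, p x → p y → p (x + y))
    (smul_D : ∀ b b' : B, p (b • KaehlerDifferential.D ℂ B b')) : p τ := by
  have h : τ ∈ Submodule.span B (Set.range (KaehlerDifferential.D ℂ B)) := by
    rw [KaehlerDifferential.span_range_derivation]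
    trivial
  induction h using Submodule.closure_induction with
  | zero => exact zero
  | add x y _ _ hx hy => exact add x y hx hy
  | smul_mem b x hx =>
    obtain ⟨b', rfl⟩ := hx
    exact smul_D b b'

lemma kmap_comp {B'' : Type} [CommRing B''] [Algebra ℂ B''] (φ : B →ₐ[ℂ] B') (ψ : B' →ₐ[ℂ] B'')
    (τ : Ω[B⁄ℂ]) : kmap ψ (kmap φ τ) = kmap (ψ.comp φ) τ := by
  induction τ using kaehler_induction with
  | zero => simp
  | add x y hx hy => simp only [map_add, hx, hy]
  | smul_D b b' => simp [kmap_smul, kmap_D]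

lemma kmap_congr {φ ψ : B →ₐ[ℂ] B'} (h : ∀ b, φ b = ψ b) (τ : Ω[B⁄ℂ]) : kmap φ τ = kmap ψ τ := by
  rw [AlgHom.ext h]

variable (B) in
/-- The contraction of vector-valued one-forms with a vector field. -/
def contractForm (V : Type) [AddCommGroup V] [Module ℂ V] (D : Derivation ℂ B B) :
    Ω[B⁄ℂ] ⊗[ℂ] V →ₗ[B] B ⊗[ℂ] V :=
  TensorProduct.AlgebraTensorModule.rTensor ℂ V D.liftKaehlerDifferential

end Forms

section Apply

/-! ### Endomorphism-valued functions and forms -/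

variable {B : Type} [CommRing B] [Algebra ℂ B] (N : Type) [AddCommGroup N] [Module ℂ N] [Module B N]
  [IsScalarTower ℂ B N] (V : Type) [AddCommGroup V] [Module ℂ V]

variable (B) in
/-- The action `(n ⊗ T, b ⊗ v) ↦ b n ⊗ T v` of endomorphisms with coefficients in a module. -/
def endApply : N ⊗[ℂ] Module.End ℂ V →ₗ[ℂ] B ⊗[ℂ] V →ₗ[ℂ] N ⊗[ℂ] V :=
  TensorProduct.map₂ (Algebra.lsmul ℂ ℂ N : B →ₐ[ℂ] _).toLinearMap.flip LinearMap.id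

@[simp] lemma endApply_tmul (n : N) (T : Module.End ℂ V) (b : B) (v : V) :
    endApply B N V (n ⊗ₜ T) (b ⊗ₜ v) = (b • n) ⊗ₜ T v := rfl

lemma formApply_eq_endApply : formApply (B := B) V = endApply B Ω[B⁄ℂ] V := rfl

variable {N V}

lemma endApply_smul (θ : N ⊗[ℂ] Module.End ℂ V) (b : B) (s : B ⊗[ℂ] V) :
    endApply B N V θ (b • s) = b • endApply B N V θ s := by
  induction s with
  | zero => simp
  | add x y hx hy => simp only [map_add, smul_add, hx, hy]
  | tmul b' v =>
    induction θ with
    | zero => simp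
    | add x y hx hy => simp only [map_add, LinearMap.add_apply, smul_add, hx, hy]
    | tmul n T => simp [TensorProduct.smul_tmul', mul_smul]

variable [FiniteDimensional ℂ V]

-- A `B`-linear map on `B ⊗ V` is determined by its values on `V`, and `Hom(V, N ⊗ V) ≅ N ⊗ End V`
-- because `V` is finite-dimensional.
variable (B) in
lemma exists_endApply (f : B ⊗[ℂ] V →ₗ[B] N ⊗[ℂ] V) :
    ∃ θ : N ⊗[ℂ] Module.End ℂ V, ∀ s, endApply B N V θ s = f s := by
  let e := lTensorHomEquivHomLTensor ℂ V N V
  refine ⟨e.symm ((f.restrictScalars ℂ) ∘ₗ TensorProduct.mk ℂ B V 1), fun s => ?_⟩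
  have key : ∀ (θ : N ⊗[ℂ] Module.End ℂ V) (v : V),
      endApply B N V θ (1 ⊗ₜ v) = e θ v := by
    intro θ v
    induction θ with
    | zero => simp
    | add x y hx hy => simp only [map_add, LinearMap.add_apply, hx, hy]
    | tmul n T => simp [e]
  induction s with
  | zero => simp
  | add x y hx hy => simp only [map_add, hx, hy]
  | tmul b v =>
    have h1 : b ⊗ₜ[ℂ] v = b • ((1 : B) ⊗ₜ[ℂ] v) := by simp [TensorProduct.smul_tmul']
    rw [h1, endApply_smul, key, LinearEquiv.apply_symm_apply, map_smul]
    rfl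

lemma eq_zero_of_endApply (θ : N ⊗[ℂ] Module.End ℂ V)
    (h : ∀ v : V, endApply B N V θ (1 ⊗ₜ v) = 0) : θ = 0 := by
  let e := lTensorHomEquivHomLTensor ℂ V N V
  have key : ∀ (θ : N ⊗[ℂ] Module.End ℂ V) (v : V),
      endApply B N V θ (1 ⊗ₜ v) = e θ v := by
    intro θ v
    induction θ with
    | zero => simp
    | add x y hx hy => simp only [map_add, LinearMap.add_apply, hx, hy]
    | tmul n T => simp [e]
  refine (map_eq_zero_iff _ e.injective).1 (LinearMap.ext fun v => ?_)
  rw [← key, h, LinearMap.zero_apply]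

/-- An endomorphism-valued form is determined by its action on (the pullback of) a set of
generators. -/
lemma endApply_ext {B₀ : Type} [CommRing B₀] [Algebra ℂ B₀] (φ : B₀ →ₐ[ℂ] B)
    {S : Set (B₀ ⊗[ℂ] V)} (hS : Submodule.span B₀ S = ⊤) {θ θ' : N ⊗[ℂ] Module.End ℂ V}
    (h : ∀ s ∈ S, endApply B N V θ (φ.toLinearMap.rTensor V s) =
      endApply B N V θ' (φ.toLinearMap.rTensor V s)) : θ = θ' := by
  rw [← sub_eq_zero]
  refine eq_zero_of_endApply (B := B) _ fun v => ?_
  have h1 : ∀ s : B₀ ⊗[ℂ] V, endApply B N V (θ - θ') (φ.toLinearMap.rTensor V s) = 0 := by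
    intro s
    have hs : s ∈ Submodule.span B₀ S := by rw [hS]; trivial
    induction hs using Submodule.span_induction with
    | mem s hs => rw [map_sub, LinearMap.sub_apply, h s hs, sub_self]
    | zero => simp
    | add x y _ _ hx hy => rw [map_add, map_add, hx, hy, add_zero]
    | smul b s _ hs =>
      rw [rTensor_smul φ φ (fun _ => rfl) V b s, endApply_smul, hs, smul_zero]
  simpa using h1 (1 ⊗ₜ v)

end Apply

/-! ### Horizontal forms and their descent to the base -/

section Horizontal

variable {H : Type} [CommRing H] [HopfAlgebra ℂ H] {A B : Type} [CommRing A] [Algebra ℂ A]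
  [CommRing B] [Algebra ℂ B] [Algebra A B] [IsScalarTower ℂ A B]

lemma kmap_toAlgHom (τ : Ω[A⁄ℂ]) :
    kmap (IsScalarTower.toAlgHom ℂ A B) τ = KaehlerDifferential.map ℂ ℂ A B τ := by
  induction τ using kaehler_induction with
  | zero => simp
  | add x y hx hy => simp only [map_add, hx, hy]
  | smul_D b b' => simp [kmap_smul, kmap_D]

variable (A B) in
/-- The pullback of Lie algebra valued forms. -/
def pullTensor (W : Type) [AddCommGroup W] [Module ℂ W] :
    Ω[A⁄ℂ] ⊗[A] (B ⊗[ℂ] W) →ₗ[ℂ] Ω[B⁄ℂ] ⊗[ℂ] W :=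
  ((((KaehlerDifferential.mapBaseChange ℂ A B).restrictScalars A) ∘ₗ
    (TensorProduct.comm A Ω[A⁄ℂ] B).toLinearMap).restrictScalars ℂ).rTensor W ∘ₗ
  ((TensorProduct.AlgebraTensorModule.assoc ℂ A A Ω[A⁄ℂ] B W).symm.restrictScalars ℂ).toLinearMap

lemma pullTensor_tmul {W : Type} [AddCommGroup W] [Module ℂ W] (τ : Ω[A⁄ℂ]) (s : B ⊗[ℂ] W) :
    pullTensor A B W (τ ⊗ₜ s) = formMul W (kmap (IsScalarTower.toAlgHom ℂ A B) τ) s := by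
  induction s with
  | zero => simp
  | add x y hx hy => simp only [map_add, TensorProduct.tmul_add, hx, hy]
  | tmul b X =>
    rw [kmap_toAlgHom]
    simp [pullTensor, formMul]

namespace IsTorsor

variable {ρ : B →ₐ[ℂ] B ⊗[ℂ] H}

/-- Translation fixes the forms pulled back from the base, so it acts only on their coefficients. -/
lemma pullTensor_translate (hρ : IsTorsor A ρ) (g : H →ₐ[ℂ] ℂ)
    (x : Ω[A⁄ℂ] ⊗[A] (B ⊗[ℂ] lieAlg H)) :
    pullTensor A B _ ((hρ.translateBase g).lTensor _ x) =
      TensorProduct.map (kmap (translateHom ρ g)) (adjoint H g) (pullTensor A B _ x) := by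
  induction x with
  | zero => simp
  | add x y hx hy => simp only [map_add, hx, hy]
  | tmul τ s =>
    induction s with
    | zero => simp
    | add x y hx hy => simp only [map_add, TensorProduct.tmul_add, hx, hy]
    | tmul b X =>
      rw [LinearMap.lTensor_tmul]
      change pullTensor A B _ (τ ⊗ₜ (translateHom ρ g b ⊗ₜ adjoint H g X)) = _
      rw [pullTensor_tmul, pullTensor_tmul]
      simp only [formMul, LinearMap.rTensor_tmul, LinearMap.coe_restrictScalars,
        LinearMap.toSpanSingleton_apply, TensorProduct.map_tmul, kmap_smul, kmap_comp]
      rw [kmap_congr (ψ := (translateHom ρ g).comp (IsScalarTower.toAlgHom ℂ A B)) fun a =>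
        (hρ.translateHom_algebraMap g a).symm]

variable [Algebra.FiniteType ℂ H]

/-- A horizontal form comes from the base. -/
lemma exists_pullTensor_eq (hρ : IsTorsor A ρ) (W : Type) [AddCommGroup W] [Module ℂ W]
    (z : Ω[B⁄ℂ] ⊗[ℂ] W) (hz : ∀ D, contractForm B W (coactionField ρ hρ.counit D) z = 0) :
    ∃ x, pullTensor A B W x = z := by
  -- Coordinates in a basis of `W` reduce to scalar forms, where `mem_range_mapBaseChange` applies.
  let b := Module.Free.chooseBasis ℂ W
  have key : ∀ (D : Derivation ℂ B B) i z, D.liftKaehlerDifferential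
      (TensorProduct.equivFinsuppOfBasisRight b z i) =
      TensorProduct.equivFinsuppOfBasisRight b (contractForm B W D z) i := by
    intro D i z
    induction z with
    | zero => simp
    | add x y hx hy => simp only [map_add, Finsupp.add_apply, hx, hy]
    | tmul τ w =>
      simp [contractForm]
  have h1 : ∀ i, ∃ x, KaehlerDifferential.mapBaseChange ℂ A B x =
      TensorProduct.equivFinsuppOfBasisRight b z i := fun i =>
    hρ.mem_range_mapBaseChange _ fun D => by rw [key, hz]; simp
  rw [← (TensorProduct.equivFinsuppOfBasisRight b).symm_apply_apply z,
    TensorProduct.equivFinsuppOfBasisRight_symm_apply]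
  refine Submodule.sum_mem (LinearMap.range (pullTensor A B W)) fun i _ => ?_
  obtain ⟨x, hx⟩ := h1 i
  refine ⟨TensorProduct.AlgebraTensorModule.assoc ℂ A A Ω[A⁄ℂ] B W
    ((TensorProduct.comm A Ω[A⁄ℂ] B).symm x ⊗ₜ b i), ?_⟩
  simp [pullTensor, hx]

variable [IsReduced H]

lemma pullTensor_injective (hρ : IsTorsor A ρ) (W : Type) [AddCommGroup W] [Module ℂ W] :
    Function.Injective (pullTensor A B W) := by
  have h1 : Function.Injective (((KaehlerDifferential.mapBaseChange ℂ A B).restrictScalars A) ∘ₗ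
      (TensorProduct.comm A Ω[A⁄ℂ] B).toLinearMap) :=
    hρ.mapBaseChange_injective.comp (TensorProduct.comm A Ω[A⁄ℂ] B).injective
  exact (Module.Flat.rTensor_preserves_injective_linearMap (R := ℂ) (M := W)
    ((((KaehlerDifferential.mapBaseChange ℂ A B).restrictScalars A) ∘ₗ
      (TensorProduct.comm A Ω[A⁄ℂ] B).toLinearMap).restrictScalars ℂ) h1).comp
    (TensorProduct.AlgebraTensorModule.assoc ℂ A A Ω[A⁄ℂ] B W).symm.injective

/-- A horizontal invariant form comes from a form on the base with values in the adjoint bundle. -/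
lemma exists_form_of_horizontal (hρ : IsTorsor A ρ) [Module.Flat A Ω[A⁄ℂ]]
    {M : Submodule A (B ⊗[ℂ] lieAlg H)} (hM : ∀ s, s ∈ M ↔ ∀ g, sectionTranslate ρ g s = s)
    (z : Ω[B⁄ℂ] ⊗[ℂ] lieAlg H)
    (hz : ∀ D, contractForm B _ (coactionField ρ hρ.counit D) z = 0)
    (hz' : ∀ g, TensorProduct.map (kmap (translateHom ρ g)) (adjoint H g) z = z) :
    ∃ m : Ω[A⁄ℂ] ⊗[A] M, pullTensor A B _ (M.subtype.lTensor _ m) = z := by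
  obtain ⟨x, rfl⟩ := hρ.exists_pullTensor_eq _ z hz
  -- The preimage `x` is invariant because its pullback is and the pullback is injective; flatness
  -- of `Ω[A⁄ℂ]` then gives it values in `M`.
  obtain ⟨m, rfl⟩ := hρ.exists_of_invariant hM Ω[A⁄ℂ] x fun g =>
    hρ.pullTensor_injective _ (by rw [pullTensor_translate, hz'])
  exact ⟨m, rfl⟩

lemma pullTensor_subtype_injective (hρ : IsTorsor A ρ) [Module.Flat A Ω[A⁄ℂ]]
    (M : Submodule A (B ⊗[ℂ] lieAlg H)) :
    Function.Injective fun m : Ω[A⁄ℂ] ⊗[A] M => pullTensor A B _ (M.subtype.lTensor _ m) :=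
  (hρ.pullTensor_injective _).comp
    (Module.Flat.lTensor_preserves_injective_linearMap _ M.injective_subtype)

lemma span_sections (hρ : IsTorsor A ρ) {M : Submodule A (B ⊗[ℂ] lieAlg H)}
    (hM : ∀ s, s ∈ M ↔ ∀ g, sectionTranslate ρ g s = s) :
    Submodule.span B (M : Set (B ⊗[ℂ] lieAlg H)) = ⊤ := by
  refine eq_top_iff.2 fun s hs => ?_
  clear hs
  obtain ⟨x, rfl⟩ := (hρ.liftBaseChange_bijective hM).2 s
  induction x with
  | zero => simp
  | add x y hx hy => rw [map_add]; exact add_mem hx hy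
  | tmul b s =>
    rw [LinearMap.liftBaseChange_tmul]
    exact Submodule.smul_mem _ _ (Submodule.subset_span s.2)

/-- Linear maps on the invariant sections extend uniquely to endomorphism-valued forms. -/
lemma exists_formApply (hρ : IsTorsor A ρ) {M : Submodule A (B ⊗[ℂ] lieAlg H)}
    (hM : ∀ s, s ∈ M ↔ ∀ g, sectionTranslate ρ g s = s) (f : M →ₗ[A] Ω[B⁄ℂ] ⊗[ℂ] lieAlg H) :
    ∃ θ, ∀ s : M, formApply (B := B) (lieAlg H) θ s.1 = f s := by
  -- Extend `f` to a `B`-linear map on `B ⊗_A M ≅ B ⊗ 𝔤`, which `exists_endApply` represents by a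
  -- form.
  let e := LinearEquiv.ofBijective _ (hρ.liftBaseChange_bijective hM)
  obtain ⟨θ, hθ⟩ := exists_endApply B (f.liftBaseChange B ∘ₗ e.symm.toLinearMap)
  refine ⟨θ, fun s => ?_⟩
  rw [formApply_eq_endApply, hθ]
  have h1 : e (1 ⊗ₜ s) = s.1 := by
    change M.subtype.liftBaseChange B (1 ⊗ₜ s) = _
    simp
  rw [← h1]
  simp

end IsTorsor

end Horizontal

/-! ### Principal bundles in terms of rings -/

section Spec

variable {R R' : Type} [CommRing R] [Algebra ℂ R] [CommRing R'] [Algebra ℂ R']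

lemma specMap_injective {φ ψ : R →ₐ[ℂ] R'} (h : specMap φ = specMap ψ) : φ = ψ := by
  have h1 : Spec.map (CommRingCat.ofHom φ.toRingHom) = Spec.map (CommRingCat.ofHom ψ.toRingHom) :=
    congrArg (fun f => f.left) h
  have h2 := Spec.map_injective h1
  exact AlgHom.ext fun x => congrArg (fun f => f.hom x) h2

lemma specMap_surjective (f : SpecC R' ⟶ SpecC R) : ∃ φ : R →ₐ[ℂ] R', specMap φ = f := by
  obtain ⟨φ, hφ⟩ := Spec.map_surjective f.left
  have h1 : CommRingCat.ofHom (algebraMap ℂ R) ≫ φ = CommRingCat.ofHom (algebraMap ℂ R') := by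
    apply Spec.map_injective
    rw [Spec.map_comp, hφ]
    exact Over.w f
  refine ⟨{ φ.hom with commutes' := fun c => congrArg (fun f => f.hom c) h1 }, ?_⟩
  ext : 1
  exact hφ

/-- Together with `specMap_fromSpecC_injective`, this converts between morphisms into an affine open
subset and homomorphisms of its coordinate ring. -/
lemma specMap_pullSpec {Y : CScheme} (f : SpecC R ⟶ Y) {U : Y.left.Opens} (hU : IsAffineOpen U)
    (h : ⊤ ≤ f.left ⁻¹ᵁ U) : specMap (pullSpec f U h) ≫ fromSpecC hU = f := by
  have h1 := hU.SpecMap_appLE_fromSpec f.left (isAffineOpen_top (Spec (.of R))) (i := h)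
  have h2 : Spec.map (Scheme.ΓSpecIso (.of R)).hom ≫
      (isAffineOpen_top (Spec (.of R))).fromSpec = 𝟙 _ := by
    rw [IsAffineOpen.fromSpec_top, Scheme.isoSpec_Spec_inv, ← Spec.map_comp, Iso.inv_hom_id,
      Spec.map_id]
  ext : 1
  refine (congrArg (fun x => x ≫ hU.fromSpec) (Spec.map_comp (f.left.appLE U ⊤ h)
    (Scheme.ΓSpecIso (.of R)).hom)).trans ?_
  refine (Category.assoc _ _ _).trans ((congrArg (fun x => _ ≫ x) h1).trans ?_)
  refine (Category.assoc _ _ _).symm.trans ?_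
  exact (congrArg (fun x => x ≫ f.left) h2).trans (Category.id_comp _)

lemma specMap_fromSpecC_injective {Y : CScheme} {U : Y.left.Opens} (hU : IsAffineOpen U)
    {φ ψ : Γ(Y.left, U) →ₐ[ℂ] R} (h : specMap φ ≫ fromSpecC hU = specMap ψ ≫ fromSpecC hU) :
    φ = ψ := by
  apply specMap_injective
  have h1 : (specMap φ).left ≫ hU.fromSpec = (specMap ψ).left ≫ hU.fromSpec :=
    congrArg (fun f => f.left) h
  ext : 1
  exact (cancel_mono hU.fromSpec).1 h1

/-- The product of two `R`-points. As the multiplication is the spectrum of the comultiplication,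
only the two projections of a map to `G × G` have to be compared. -/
lemma lift_specMap_mul {H : Type} [CommRing H] [HopfAlgebra ℂ H] (f g : H →ₐ[ℂ] R) :
    lift (specMap f) (specMap g) ≫ μ[SpecC H] =
      specMap ((Algebra.TensorProduct.lift f g fun _ _ => Commute.all _ _).comp
        (Bialgebra.comulAlgHom ℂ H)) := by
  rw [specMap_comp]
  ext : 1
  rw [Over.comp_left, Over.comp_left]
  have h1 : μ[SpecC H].left = (pullbackSpecIso ℂ H H).hom ≫
      Spec.map (CommRingCat.ofHom (Bialgebra.comulAlgHom ℂ H).toRingHom) :=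
    mul_spec_asOver_spec_left
  refine (congrArg (fun x => _ ≫ x) h1).trans ((Category.assoc _ _ _).symm.trans
    (congrArg (fun x => x ≫ _) ?_))
  refine (Iso.eq_comp_inv (pullbackSpecIso ℂ H H)).1 ?_
  apply Limits.pullback.hom_ext
  · refine Eq.trans (b := (specMap f).left)
      (congrArg (fun x => x.left) (lift_fst (specMap f) (specMap g))) (Eq.symm ?_)
    refine (Category.assoc _ _ _).trans
      ((congrArg (fun x => _ ≫ x) (pullbackSpecIso_inv_fst ℂ H H)).trans ?_)
    have h2 : specMap (Algebra.TensorProduct.lift f g fun _ _ => Commute.all _ _) ≫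
        specMap (Algebra.TensorProduct.includeLeft : H →ₐ[ℂ] H ⊗[ℂ] H) = specMap f := by
      rw [← specMap_comp]
      congr 1
      exact AlgHom.ext fun x => by simp
    exact congrArg (fun x => x.left) h2
  · refine Eq.trans (b := (specMap g).left)
      (congrArg (fun x => x.left) (lift_snd (specMap f) (specMap g))) (Eq.symm ?_)
    refine (Category.assoc _ _ _).trans
      ((congrArg (fun x => _ ≫ x) (pullbackSpecIso_inv_snd ℂ H H)).trans ?_)
    have h2 : specMap (Algebra.TensorProduct.lift f g fun _ _ => Commute.all _ _) ≫
        specMap (Algebra.TensorProduct.includeRight : H →ₐ[ℂ] H ⊗[ℂ] H) = specMap g := by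
      rw [← specMap_comp]
      congr 1
      exact AlgHom.ext fun x => by simp
    exact congrArg (fun x => x.left) h2

end Spec

namespace PrincipalBundle

variable {H : Type} [CommRing H] [HopfAlgebra ℂ H] {C : CScheme} (P : PrincipalBundle H C)
  (U : C.left.affineOpens)

lemma specMap_coact : specMap (P.coact U) ≫ fromSpecC (P.isAffineOpen_above U) = P.univAct U :=
  specMap_pullSpec _ _ _

lemma specMap_comp_univAct {R : Type} [CommRing R] [Algebra ℂ R] (φ : P.fn U ⊗[ℂ] H →ₐ[ℂ] R) :
    specMap φ ≫ P.univAct U =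
      lift (specMap (φ.comp (P.inl U)) ≫ fromSpecC (P.isAffineOpen_above U))
        (specMap (φ.comp (P.inr U))) ≫ P.act := by
  rw [univAct, comp_lift_assoc, specMap_comp, specMap_comp, Category.assoc]

lemma lift_lift_act {X : CScheme} (x : X ⟶ P.tot) (g h : X ⟶ SpecC H) :
    lift (lift x g ≫ P.act) h ≫ P.act = lift x (lift g h ≫ μ[SpecC H]) ≫ P.act := by
  have h1 := congrArg (fun f => lift (lift x g) h ≫ f) P.act_mul
  simpa using h1.symm

/-- This is `(x g) h = x (g h)` for the tautological `x`, `g`, `h` over `B ⊗ H ⊗ H`: `φ` classifies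
the pair `(x g, h)` and `ψ` the pair `(x, g h)`. -/
lemma coact_coassoc (b : P.fn U) :
    TensorProduct.assoc ℂ (P.fn U) H H ((P.coact U).toLinearMap.rTensor H (P.coact U b)) =
      (Coalgebra.comul (R := ℂ)).lTensor (P.fn U) (P.coact U b) := by
  let x : P.fn U →ₐ[ℂ] P.fn U ⊗[ℂ] (H ⊗[ℂ] H) := Algebra.TensorProduct.includeLeft
  let g : H →ₐ[ℂ] P.fn U ⊗[ℂ] (H ⊗[ℂ] H) :=
    (Algebra.TensorProduct.includeRight (R := ℂ) (A := P.fn U)).comp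
    Algebra.TensorProduct.includeLeft
  let h : H →ₐ[ℂ] P.fn U ⊗[ℂ] (H ⊗[ℂ] H) :=
    (Algebra.TensorProduct.includeRight (R := ℂ) (A := P.fn U)).comp
    Algebra.TensorProduct.includeRight
  let φ : P.fn U ⊗[ℂ] H →ₐ[ℂ] P.fn U ⊗[ℂ] (H ⊗[ℂ] H) :=
    (Algebra.TensorProduct.assoc ℂ ℂ ℂ (P.fn U) H H).toAlgHom.comp
      (Algebra.TensorProduct.map (P.coact U) (AlgHom.id ℂ H))
  let ψ : P.fn U ⊗[ℂ] H →ₐ[ℂ] P.fn U ⊗[ℂ] (H ⊗[ℂ] H) :=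
    Algebra.TensorProduct.map (AlgHom.id ℂ (P.fn U)) (Bialgebra.comulAlgHom ℂ H)
  let incl : P.fn U ⊗[ℂ] H →ₐ[ℂ] P.fn U ⊗[ℂ] (H ⊗[ℂ] H) :=
    (Algebra.TensorProduct.assoc ℂ ℂ ℂ (P.fn U) H H).toAlgHom.comp
      Algebra.TensorProduct.includeLeft
  have e1 : φ.comp (P.inl U) = incl.comp (P.coact U) := AlgHom.ext fun a => by simp [φ, incl]
  have e2 : φ.comp (P.inr U) = h := AlgHom.ext fun a => by
    simp [φ, h, Algebra.TensorProduct.one_def]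
  have e3 : incl.comp (P.inl U) = x := AlgHom.ext fun a => by
    simp [incl, x, Algebra.TensorProduct.one_def]
  have e4 : incl.comp (P.inr U) = g := AlgHom.ext fun a => by simp [incl, g]
  have e5 : ψ.comp (P.inl U) = x := AlgHom.ext fun a => by simp [ψ, x]
  have e6 : ψ.comp (P.inr U) = (Algebra.TensorProduct.lift g h fun _ _ => Commute.all _ _).comp
      (Bialgebra.comulAlgHom ℂ H) := AlgHom.ext fun a => by
    simp only [ψ, AlgHom.comp_apply, Algebra.TensorProduct.includeRight_apply,
      Algebra.TensorProduct.map_tmul, map_one]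
    generalize Bialgebra.comulAlgHom ℂ H a = y
    induction y with
    | zero => simp
    | add y z hy hz => rw [TensorProduct.tmul_add, hy, hz, map_add]
    | tmul a b => simp [g, h]
  have key : specMap φ ≫ P.univAct U = specMap ψ ≫ P.univAct U := by
    rw [specMap_comp_univAct, specMap_comp_univAct, e1, e2, e5, e6, ← lift_specMap_mul,
      ← lift_lift_act, specMap_comp, Category.assoc, specMap_coact, specMap_comp_univAct, e3, e4]
  have h1 : φ.comp (P.coact U) = ψ.comp (P.coact U) := by
    apply specMap_fromSpecC_injective (P.isAffineOpen_above U)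
    rw [specMap_comp (P.coact U) φ, specMap_comp (P.coact U) ψ, Category.assoc, Category.assoc,
      specMap_coact, key]
  exact congrArg (fun f => f b) h1

/-- Flatness is local. For surjectivity on spectra, any preimage of a point of `U` lies over `U`,
hence in the spectrum of `P.fn U`. -/
instance faithfullyFlat_fn : Module.FaithfullyFlat Γ(C.left, U.1) (P.fn U) := by
  have := P.flat
  have := P.surjective
  have h1 : (P.proj.left.appLE U.1 (P.above U) le_rfl).hom.Flat :=
    HasRingHomProperty.appLE @Flat P.proj.left P.flat U ⟨_, P.isAffineOpen_above U⟩ le_rfl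
  have h2 : Module.Flat Γ(C.left, U.1) (P.fn U) := h1
  refine Module.FaithfullyFlat.of_comap_surjective fun x => ?_
  have h3 := U.2.SpecMap_appLE_fromSpec P.proj.left (P.isAffineOpen_above U) (i := le_rfl)
  obtain ⟨y, hy⟩ := P.proj.left.surjective (U.2.fromSpec x)
  have hyU : y ∈ P.above U := by
    change P.proj.left y ∈ U.1
    rw [hy]
    have : U.2.fromSpec x ∈ Set.range U.2.fromSpec := ⟨x, rfl⟩
    rwa [U.2.range_fromSpec] at this
  rw [← SetLike.mem_coe, ← (P.isAffineOpen_above U).range_fromSpec] at hyU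
  obtain ⟨z, rfl⟩ := hyU
  have hinj : Function.Injective U.2.fromSpec :=
    (IsAffineOpen.isOpenImmersion_fromSpec U.2).base_open.injective
  refine ⟨z, hinj ?_⟩
  rw [← hy]
  exact congrArg (fun f => f z) h3

/-- The inverse comes from the cartesian square: the two tautological points `l`, `r` over `B ⊗_A B`
lie in one fibre, so they differ by a point `χ` of `G`, and `(l, χ)` defines `τ`. -/
lemma canMap_bijective :
    Function.Bijective (canMap (A := Γ(C.left, U.1)) (P.coact U) (P.coact_algebraMap U)) := by
  set A := Γ(C.left, U.1)
  set hU := P.isAffineOpen_above U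
  let can : P.fn U ⊗[A] P.fn U →ₐ[ℂ] P.fn U ⊗[ℂ] H :=
    (canMap (A := A) (P.coact U) (P.coact_algebraMap U)).restrictScalars ℂ
  let l : P.fn U →ₐ[ℂ] P.fn U ⊗[A] P.fn U :=
    (Algebra.TensorProduct.includeLeft : P.fn U →ₐ[A] P.fn U ⊗[A] P.fn U).restrictScalars ℂ
  let r : P.fn U →ₐ[ℂ] P.fn U ⊗[A] P.fn U :=
    (Algebra.TensorProduct.includeRight : P.fn U →ₐ[A] P.fn U ⊗[A] P.fn U).restrictScalars ℂ
  have hproj : specMap (pull P.proj U.1 (P.above U) le_rfl) ≫ fromSpecC U.2 =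
      fromSpecC hU ≫ P.proj := specMap_pull_fromSpecC _ _ _ _
  have hlr : (specMap l ≫ fromSpecC hU) ≫ P.proj = (specMap r ≫ fromSpecC hU) ≫ P.proj := by
    rw [Category.assoc, Category.assoc, ← hproj, ← Category.assoc, ← Category.assoc,
      ← specMap_comp, ← specMap_comp]
    congr 2
    refine AlgHom.ext fun a => ?_
    change algebraMap A (P.fn U) a ⊗ₜ[A] (1 : P.fn U) = 1 ⊗ₜ[A] algebraMap A (P.fn U) a
    rw [Algebra.algebraMap_eq_smul_one, TensorProduct.smul_tmul]
  obtain ⟨z, hz1, hz2⟩ : ∃ z : SpecC (P.fn U ⊗[A] P.fn U) ⟶ P.tot ⊗ SpecC H,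
      z ≫ fst _ _ = specMap l ≫ fromSpecC hU ∧ z ≫ P.act = specMap r ≫ fromSpecC hU :=
    ⟨P.isPullback.lift _ _ hlr, P.isPullback.lift_fst _ _ _, P.isPullback.lift_snd _ _ _⟩
  obtain ⟨χ, hχ⟩ := specMap_surjective (z ≫ snd _ _)
  have hz : z = lift (specMap l ≫ fromSpecC hU) (specMap χ) := by
    ext1
    · rw [hz1, lift_fst]
    · rw [hχ, lift_snd]
  let τ : P.fn U ⊗[ℂ] H →ₐ[ℂ] P.fn U ⊗[A] P.fn U :=
    Algebra.TensorProduct.lift l χ fun _ _ => Commute.all _ _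
  have τl : τ.comp (P.inl U) = l := AlgHom.ext fun b => by simp [τ]
  have τr : τ.comp (P.inr U) = χ := AlgHom.ext fun b => by simp [τ]
  have hτ : ∀ b, τ (P.coact U b) = r b := by
    have h1 : τ.comp (P.coact U) = r := by
      apply specMap_fromSpecC_injective hU
      rw [specMap_comp, Category.assoc, specMap_coact, specMap_comp_univAct, τl, τr, ← hz, hz2]
    exact fun b => congrArg (fun f => f b) h1
  have canl : can.comp l = P.inl U := AlgHom.ext fun b => by
    change canMap (A := A) (P.coact U) (P.coact_algebraMap U) (b ⊗ₜ 1) = b ⊗ₜ 1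
    rw [canMap_tmul, map_one, mul_one]
  have canr : can.comp r = P.coact U := AlgHom.ext fun b => by
    change canMap (A := A) (P.coact U) (P.coact_algebraMap U) (1 ⊗ₜ b) = P.coact U b
    rw [canMap_tmul]
    exact one_mul _
  -- After `can` the two points become `x` and `x g`, so uniqueness in the cartesian square
  -- identifies their difference with `g`.
  have canχ : can.comp χ = P.inr U := by
    apply specMap_injective
    have h1 : specMap can ≫ z = lift (specMap (P.inl U) ≫ fromSpecC hU) (specMap (P.inr U)) := by
      apply P.isPullback.hom_ext
      · rw [Category.assoc, hz1, ← Category.assoc, ← specMap_comp, canl, lift_fst]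
      · rw [Category.assoc, hz2, ← Category.assoc, ← specMap_comp, canr, specMap_coact]
        rfl
    rw [specMap_comp, hχ, ← Category.assoc, h1, lift_snd]
  have hcanτ : can.comp τ = AlgHom.id ℂ _ := by
    refine Algebra.TensorProduct.ext ?_ ?_
    · refine AlgHom.ext fun b => ?_
      refine (congrArg can (congrArg (fun f => f b) τl)).trans ?_
      exact congrArg (fun f => f b) canl
    · refine AlgHom.ext fun b => ?_
      refine (congrArg can (congrArg (fun f => f b) τr)).trans ?_
      exact congrArg (fun f => f b) canχ
  constructor
  · refine Function.LeftInverse.injective (g := τ) fun x => ?_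
    induction x with
    | zero => simp
    | add x y hx hy => simp only [map_add, hx, hy]
    | tmul b b' =>
      rw [canMap_tmul, map_mul, hτ]
      have : τ (b ⊗ₜ 1) = l b := by rw [← τl]; rfl
      rw [this]
      change (b ⊗ₜ[A] 1) * (1 ⊗ₜ[A] b') = b ⊗ₜ[A] b'
      rw [Algebra.TensorProduct.tmul_mul_tmul, one_mul, mul_one]
  · exact fun y => ⟨τ y, congrArg (fun f => f y) hcanτ⟩

lemma isTorsor_coact : IsTorsor Γ(C.left, U.1) (P.coact U) where
  map_base := P.coact_algebraMap U
  counit := P.coact_counit U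
  coassoc := P.coact_coassoc U
  bijective := P.canMap_bijective U
  faithfullyFlat := P.faithfullyFlat_fn U

end PrincipalBundle

/-- Differentials of a formally smooth algebra are projective; what is needed later is the resulting
flatness. -/
lemma projective_kaehler (C : CScheme) [Smooth (str C)] (U : C.left.affineOpens) :
    Module.Projective Γ(C.left, U.1) Ω[Γ(C.left, U.1)⁄ℂ] := by
  have h1 : ((str C).appLE ⊤ U.1 (le_preimage_top _ _)).hom.Smooth :=
    (str C).smooth_appLE (isAffineOpen_top _) U.2 _
  have h2 : (algebraMap ℂ Γ(C.left, U.1)).FormallySmooth := by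
    refine RingHom.FormallySmooth.comp (RingHom.FormallySmooth.of_bijective ?_) h1.formallySmooth
    exact ConcreteCategory.bijective_of_isIso (Scheme.ΓSpecIso (.of ℂ)).inv
  have := RingHom.formallySmooth_algebraMap.1 h2
  infer_instance

/-! ### Naturality of the operations on forms -/

section Naturality

variable {B B' : Type} [CommRing B] [Algebra ℂ B] [CommRing B'] [Algebra ℂ B']
  {V V' : Type} [AddCommGroup V] [Module ℂ V] [AddCommGroup V'] [Module ℂ V']

lemma map_kmap_formMul (φ : B →ₐ[ℂ] B') (e : V →ₗ[ℂ] V') (τ : Ω[B⁄ℂ]) (s : B ⊗[ℂ] V) :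
    TensorProduct.map (kmap φ) e (formMul V τ s) =
      formMul V' (kmap φ τ) (TensorProduct.map φ.toLinearMap e s) := by
  induction s with
  | zero => simp
  | add x y hx hy => simp only [map_add, hx, hy]
  | tmul b v => simp [formMul, kmap_smul]

lemma map_kmap_dSection (φ : B →ₐ[ℂ] B') (e : V →ₗ[ℂ] V') (s : B ⊗[ℂ] V) :
    TensorProduct.map (kmap φ) e (dSection V s) =
      dSection V' (TensorProduct.map φ.toLinearMap e s) := by
  induction s with
  | zero => simp
  | add x y hx hy => simp only [map_add, hx, hy]
  | tmul b v => simp [dSection, kmap_D]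

lemma map_kmap_formApply (φ : B →ₐ[ℂ] B') (e : V ≃ₗ[ℂ] V') (θ : Ω[B⁄ℂ] ⊗[ℂ] Module.End ℂ V)
    (s : B ⊗[ℂ] V) :
    TensorProduct.map (kmap φ) (e : V →ₗ[ℂ] V') (formApply V θ s) =
      formApply V' (TensorProduct.map (kmap φ) (e.conj : Module.End ℂ V →ₗ[ℂ] Module.End ℂ V') θ)
        (TensorProduct.map φ.toLinearMap (e : V →ₗ[ℂ] V') s) := by
  induction s with
  | zero => simp
  | add x y hx hy => simp only [map_add, hx, hy]
  | tmul b v =>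
    induction θ with
    | zero => simp
    | add x y hx hy => simp only [map_add, LinearMap.add_apply, hx, hy]
    | tmul τ T => simp [formApply_tmul, kmap_smul]

lemma rTensor_kmap_formMul (φ : B →ₐ[ℂ] B') (τ : Ω[B⁄ℂ]) (s : B ⊗[ℂ] V) :
    (kmap φ).rTensor V (formMul V τ s) = formMul V (kmap φ τ) (φ.toLinearMap.rTensor V s) :=
  map_kmap_formMul φ LinearMap.id τ s

lemma rTensor_kmap_dSection (φ : B →ₐ[ℂ] B') (s : B ⊗[ℂ] V) :
    (kmap φ).rTensor V (dSection V s) = dSection V (φ.toLinearMap.rTensor V s) :=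
  map_kmap_dSection φ LinearMap.id s

lemma rTensor_kmap_formApply (φ : B →ₐ[ℂ] B') (θ : Ω[B⁄ℂ] ⊗[ℂ] Module.End ℂ V)
    (s : B ⊗[ℂ] V) : (kmap φ).rTensor V (formApply V θ s) =
      formApply V ((kmap φ).rTensor _ θ) (φ.toLinearMap.rTensor V s) := by
  have h1 : ((LinearEquiv.refl ℂ V).conj : Module.End ℂ V →ₗ[ℂ] Module.End ℂ V) =
      LinearMap.id := by ext; simp
  have h2 := map_kmap_formApply φ (LinearEquiv.refl ℂ V) θ s
  rw [h1] at h2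
  exact h2

lemma contractForm_dSection (D : Derivation ℂ B B) (s : B ⊗[ℂ] V) :
    contractForm B V D (dSection V s) = (D : B →ₗ[ℂ] B).rTensor V s := by
  induction s with
  | zero => simp
  | add x y hx hy => simp only [map_add, hx, hy]
  | tmul b v => simp [dSection, contractForm]

lemma contractForm_formApply (D : Derivation ℂ B B) (θ : Ω[B⁄ℂ] ⊗[ℂ] Module.End ℂ V)
    (s : B ⊗[ℂ] V) : contractForm B V D (formApply V θ s) =
      endApply B B V (contractForm B _ D θ) s := by
  induction s with
  | zero => simp
  | add x y hx hy => simp only [map_add, hx, hy]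
  | tmul b v =>
    induction θ with
    | zero => simp
    | add x y hx hy => simp only [map_add, LinearMap.add_apply, hx, hy]
    | tmul τ T => simp [formApply_tmul, contractForm]

lemma contractForm_lTensor (D : Derivation ℂ B B) (T : V →ₗ[ℂ] V') (z : Ω[B⁄ℂ] ⊗[ℂ] V) :
    contractForm B V' D (T.lTensor _ z) = T.lTensor B (contractForm B V D z) := by
  induction z with
  | zero => simp
  | add x y hx hy => simp only [map_add, hx, hy]
  | tmul τ v => simp [contractForm]

lemma endApply_one_tmul (T : Module.End ℂ V) (s : B ⊗[ℂ] V) :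
    endApply B B V (1 ⊗ₜ T) s = T.lTensor B s := by
  induction s with
  | zero => simp
  | add x y hx hy => simp only [map_add, hx, hy]
  | tmul b v => simp

variable {A : Type} [CommRing A] [Algebra ℂ A] [Algebra A B] [IsScalarTower ℂ A B]

/-- Forms pulled back from the base are generated by differentials of base functions, which a
vertical derivation kills. -/
lemma contractForm_pullTensor (D : Derivation ℂ B B) (hD : ∀ a, D (algebraMap A B a) = 0)
    (x : Ω[A⁄ℂ] ⊗[A] (B ⊗[ℂ] V)) : contractForm B V D (pullTensor A B V x) = 0 := by
  have h1 : ∀ τ : Ω[A⁄ℂ],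
      D.liftKaehlerDifferential (kmap (IsScalarTower.toAlgHom ℂ A B) τ) = 0 := by
    intro τ
    induction τ using kaehler_induction with
    | zero => simp
    | add x y hx hy => rw [map_add, map_add, hx, hy, add_zero]
    | smul_D a a' => simp [kmap_smul, kmap_D, hD]
  induction x with
  | zero => simp
  | add x y hx hy => rw [map_add, map_add, hx, hy, add_zero]
  | tmul τ s =>
    rw [pullTensor_tmul]
    induction s with
    | zero => simp
    | add x y hx hy => rw [map_add, map_add, hx, hy, add_zero]
    | tmul b v => simp [formMul, contractForm, h1]

lemma pullTensor_smul (a : A) (x : Ω[A⁄ℂ] ⊗[A] (B ⊗[ℂ] V)) :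
    pullTensor A B V (a • x) = a • pullTensor A B V x := by
  induction x with
  | zero => simp
  | add x y hx hy => simp only [map_add, smul_add, hx, hy]
  | tmul τ s =>
    rw [TensorProduct.smul_tmul', pullTensor_tmul, pullTensor_tmul, kmap_smul]
    induction s with
    | zero => simp
    | add x y hx hy => simp only [map_add, smul_add, hx, hy]
    | tmul b v =>
      simp only [formMul, LinearMap.rTensor_tmul, LinearMap.coe_restrictScalars,
        LinearMap.toSpanSingleton_apply, TensorProduct.smul_tmul']
      congr 1
      rw [smul_comm b]
      exact algebraMap_smul B a _

lemma dSection_smul (a : A) (s : B ⊗[ℂ] V) : dSection V (a • s) =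
    a • dSection V s + formMul V (KaehlerDifferential.D ℂ B (algebraMap A B a)) s := by
  induction s with
  | zero => simp
  | add x y hx hy => simp only [map_add, smul_add, hx, hy]; abel
  | tmul b v =>
    simp only [dSection, formMul, LinearMap.rTensor_tmul, LinearMap.coe_restrictScalars,
        LinearMap.toSpanSingleton_apply, TensorProduct.smul_tmul', ← TensorProduct.add_tmul]
    congr 1
    rw [Algebra.smul_def]
    refine ((KaehlerDifferential.D ℂ B).leibniz _ _).trans ?_
    rw [algebraMap_smul]
    rfl

lemma rTensor_kmap_formBracket {H : Type} [CommRing H] [HopfAlgebra ℂ H] (φ : B →ₐ[ℂ] B')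
    (ω : Ω[B⁄ℂ] ⊗[ℂ] lieAlg H) (s : B ⊗[ℂ] lieAlg H) :
    (kmap φ).rTensor _ (formBracket (lieAlg H) ω s) =
      formBracket (lieAlg H) ((kmap φ).rTensor _ ω) (φ.toLinearMap.rTensor _ s) := by
  refine (rTensor_kmap_formApply φ _ s).trans ?_
  rw [formBracket, LinearMap.comp_apply, ← LinearMap.comp_apply (LinearMap.rTensor _ _),
    LinearMap.rTensor_comp_lTensor, ← LinearMap.lTensor_comp_rTensor]
  rfl

lemma formBracket_smul_right {H : Type} [CommRing H] [HopfAlgebra ℂ H]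
    (ω : Ω[B⁄ℂ] ⊗[ℂ] lieAlg H) (a : A) (s : B ⊗[ℂ] lieAlg H) :
    formBracket (lieAlg H) ω (a • s) = a • formBracket (lieAlg H) ω s := by
  rw [← algebraMap_smul B a s, ← algebraMap_smul B a (formBracket (lieAlg H) ω s)]
  exact endApply_smul _ _ _

end Naturality

/-! ### Forms with values in the adjoint bundle, pulled back to the total space -/

namespace PrincipalBundle

variable {H : Type} [CommRing H] [HopfAlgebra ℂ H] {C : CScheme} {P Q : PrincipalBundle H C}

/-- `Ad(g)` preserves brackets, so it conjugates `ad X` to `ad (Ad(g) X)`. -/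
lemma map_conj_lTensor_ad [Algebra.FiniteType ℂ H] {N N' : Type} [AddCommGroup N] [Module ℂ N]
    [AddCommGroup N'] [Module ℂ N'] (φ : N →ₗ[ℂ] N') (g : H →ₐ[ℂ] ℂ) (ω : N ⊗[ℂ] lieAlg H) :
    TensorProduct.map φ
      ((adjointEquiv g).conj : Module.End ℂ (lieAlg H) →ₗ[ℂ] Module.End ℂ (lieAlg H))
      ((LieAlgebra.ad ℂ (lieAlg H) : lieAlg H →ₗ[ℂ] Module.End ℂ (lieAlg H)).lTensor _ ω) =
    (LieAlgebra.ad ℂ (lieAlg H) : lieAlg H →ₗ[ℂ] Module.End ℂ (lieAlg H)).lTensor _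
      (TensorProduct.map φ (adjoint H g) ω) := by
  induction ω with
  | zero => simp
  | add x y hx hy => simp only [map_add, hx, hy]
  | tmul n X =>
    simp only [LinearMap.lTensor_tmul, TensorProduct.map_tmul]
    congr 1
    ext Y : 1
    obtain ⟨Y, rfl⟩ := (adjointEquiv g).surjective Y
    change adjoint H g ⁅X, (adjointEquiv g).symm (adjointEquiv g Y)⁆ = _
    rw [LinearEquiv.symm_apply_apply]
    exact adjoint_lie g X Y

/-- This makes the ring-theoretic results on `pullTensor` available for the bundle. -/
lemma pullAdForms_eq (U : C.left.affineOpens) (ζ : P.AdForms U) :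
    P.pullAdForms U ζ = pullTensor Γ(C.left, U.1) (P.fn U) _
      ((P.adSections U).subtype.lTensor _ ζ) := by
  induction ζ using TensorProduct.induction_on with
  | zero => simp
  | add x y hx hy => simp only [map_add, hx, hy]
  | tmul τ s =>
    rw [LinearMap.lTensor_tmul, pullTensor_tmul]
    rfl

lemma pullAdForms_tmul (U : C.left.affineOpens) (τ : Ω[Γ(C.left, U.1)⁄ℂ]) (s : P.adSections U) :
    P.pullAdForms U (τ ⊗ₜ s) =
      formMul (lieAlg H) (kmap (pull P.proj U.1 (P.above U) le_rfl) τ) s.1 := rfl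

lemma pullAdForms_adFormsComap (f : Hom P Q) {U V : C.left.affineOpens} (h : V ≤ U)
    (ζ : Q.AdForms U) : P.pullAdForms V (f.adFormsComap h ζ) =
      (kmap (f.comap h)).rTensor _ (Q.pullAdForms U ζ) := by
  induction ζ using TensorProduct.induction_on with
  | zero => simp
  | add x y hx hy => simp only [map_add, hx, hy]
  | tmul τ s =>
    have h1 : f.adFormsComap h (τ ⊗ₜ s) = kmap (resBase h) τ ⊗ₜ f.adComap h s := rfl
    rw [h1, pullAdForms_tmul, pullAdForms_tmul, rTensor_kmap_formMul, kmap_comp, kmap_comp]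
    refine congrArg (fun x => formMul (lieAlg H) x _) (kmap_congr (fun a => ?_) τ)
    exact (f.comap_algebraMap h a).symm

lemma pullAdForms_smul (U : C.left.affineOpens) (a : Γ(C.left, U.1)) (ζ : P.AdForms U) :
    P.pullAdForms U (a • ζ) = a • P.pullAdForms U ζ := by
  rw [pullAdForms_eq, map_smul, pullTensor_smul, ← pullAdForms_eq]

lemma fundamentalField_algebraMap (U : C.left.affineOpens) (X : lieAlg H) (a : Γ(C.left, U.1)) :
    P.fundamentalField U X (algebraMap _ (P.fn U) a) = 0 :=
  ((P.isTorsor_coact U).field X).map_algebraMap a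

lemma pullAdForms_smul_complex (U : C.left.affineOpens) (c : ℂ) (ζ : P.AdForms U) :
    P.pullAdForms U (c • ζ) = c • P.pullAdForms U ζ := by
  rw [← algebraMap_smul Γ(C.left, U.1) c ζ, pullAdForms_smul,
    algebraMap_smul Γ(C.left, U.1) c (P.pullAdForms U ζ)]

/-- The difference of a connection on the adjoint bundle and the exterior derivative. -/
def connectionDiff (D : P.AdConnection) (U : C.left.affineOpens) (s : P.adSections U) :
    Ω[P.fn U⁄ℂ] ⊗[ℂ] lieAlg H :=
  P.pullAdForms U (D.nabla U s) - dSection (lieAlg H) s.1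

lemma pullAdForms_leibniz (D : P.AdConnection) (U : C.left.affineOpens) (a : Γ(C.left, U.1))
    (s : P.adSections U) : P.pullAdForms U (D.nabla U (a • s)) =
      a • P.pullAdForms U (D.nabla U s) +
      formMul (lieAlg H) (KaehlerDifferential.D ℂ (P.fn U) (algebraMap _ (P.fn U) a)) s.1 := by
  rw [D.leibniz, map_add, pullAdForms_tmul, kmap_D, pullAdForms_smul]
  rfl

/-- The Leibniz terms of the connection and of the exterior derivative cancel. -/
lemma connectionDiff_smul (D : P.AdConnection) (U : C.left.affineOpens) (a : Γ(C.left, U.1))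
    (s : P.adSections U) : connectionDiff D U (a • s) = a • connectionDiff D U s := by
  have h1 : dSection (lieAlg H) (a • s).1 = a • dSection (lieAlg H) s.1 +
      formMul (lieAlg H) (KaehlerDifferential.D ℂ (P.fn U) (algebraMap _ (P.fn U) a)) s.1 :=
    dSection_smul a s.1
  rw [connectionDiff, connectionDiff, pullAdForms_leibniz, h1, smul_sub, add_sub_add_right_eq_sub]

lemma connectionDiff_add (D : P.AdConnection) (U : C.left.affineOpens) (s t : P.adSections U) :
    connectionDiff D U (s + t) = connectionDiff D U s + connectionDiff D U t := by
  rw [connectionDiff, connectionDiff, connectionDiff, map_add, map_add, Submodule.coe_add, map_add,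
    add_sub_add_comm]

lemma map_translate_pullAdForms (U : C.left.affineOpens) (g : H →ₐ[ℂ] ℂ) (ζ : P.AdForms U) :
    TensorProduct.map (kmap (P.translate U g)) (adjoint H g) (P.pullAdForms U ζ) =
      P.pullAdForms U ζ := by
  rw [pullAdForms_eq]
  refine ((P.isTorsor_coact U).pullTensor_translate g _).symm.trans ?_
  rw [← LinearMap.lTensor_comp_apply]
  congr 2
  refine congrArg (fun T => LinearMap.lTensor _ T) (LinearMap.ext fun s => s.2 g)

variable [Algebra.FiniteType ℂ H] [IsReduced H]

lemma span_adSections (U : C.left.affineOpens) :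
    Submodule.span (P.fn U) (P.adSections U : Set (P.fn U ⊗[ℂ] lieAlg H)) = ⊤ :=
  (P.isTorsor_coact U).span_sections fun _ => Iff.rfl

lemma formApply_ext (f : Hom P Q) {U V : C.left.affineOpens} (h : V ≤ U)
    {θ θ' : Ω[P.fn V⁄ℂ] ⊗[ℂ] Module.End ℂ (lieAlg H)}
    (hθ : ∀ s : Q.adSections U, formApply (lieAlg H) θ (f.adComap h s).1 =
      formApply (lieAlg H) θ' (f.adComap h s).1) : θ = θ' :=
  endApply_ext (f.comap h) (span_adSections U) fun s hs => hθ ⟨s, hs⟩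

lemma endApply_ext_adSections {U : C.left.affineOpens} {N : Type} [AddCommGroup N] [Module ℂ N]
    [Module (P.fn U) N] [IsScalarTower ℂ (P.fn U) N] {θ θ' : N ⊗[ℂ] Module.End ℂ (lieAlg H)}
    (hθ : ∀ s : P.adSections U, endApply (P.fn U) N (lieAlg H) θ s.1 =
      endApply (P.fn U) N (lieAlg H) θ' s.1) : θ = θ' := by
  refine endApply_ext (AlgHom.id ℂ (P.fn U)) (span_adSections U) fun s hs => ?_
  have h1 : (AlgHom.id ℂ (P.fn U)).toLinearMap.rTensor (lieAlg H) s = s :=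
    LinearMap.congr_fun (LinearMap.rTensor_id _ _) s
  rw [h1]
  exact hθ ⟨s, hs⟩

/-! ### The connection form -/

lemma exists_connectionForm_val (D : P.AdConnection) (U : C.left.affineOpens) :
    ∃ θ, ∀ s : P.adSections U, formApply (B := P.fn U) (lieAlg H) θ s.1 = connectionDiff D U s :=
  (P.isTorsor_coact U).exists_formApply (fun _ => Iff.rfl)
    { toFun := connectionDiff D U
      map_add' := connectionDiff_add D U
      map_smul' := connectionDiff_smul D U }

/-- Both forms act alike on pulled-back sections, which generate. The case `f = Hom.id P` gives
compatibility with restriction, the case `U = V` naturality. -/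
lemma connectionForm_natural (f : Hom P Q) {U V : C.left.affineOpens} (h : V ≤ U)
    {D : P.AdConnection} {D' : Q.AdConnection}
    (hD : ∀ s, f.adFormsComap h (D'.nabla U s) = D.nabla V (f.adComap h s))
    {θ : Ω[P.fn V⁄ℂ] ⊗[ℂ] Module.End ℂ (lieAlg H)}
    {θ' : Ω[Q.fn U⁄ℂ] ⊗[ℂ] Module.End ℂ (lieAlg H)}
    (hθ : ∀ s : P.adSections V, formApply (lieAlg H) θ s.1 = connectionDiff D V s)
    (hθ' : ∀ s : Q.adSections U, formApply (lieAlg H) θ' s.1 = connectionDiff D' U s) :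
    (kmap (f.comap h)).rTensor _ θ' = θ := by
  refine formApply_ext f h fun s => ?_
  rw [hθ]
  refine (rTensor_kmap_formApply (f.comap h) θ' s.1).symm.trans ?_
  rw [hθ']
  change (kmap (f.comap h)).rTensor _ (Q.pullAdForms U (D'.nabla U s) - dSection _ s.1) =
    P.pullAdForms V (D.nabla V (f.adComap h s)) - dSection _ (f.adComap h s).1
  rw [map_sub, ← pullAdForms_adFormsComap, hD, rTensor_kmap_dSection]
  rfl

/-- The connection form of a connection on the adjoint bundle. -/
def connectionForm (D : P.AdConnection) : P.Form (Module.End ℂ (lieAlg H)) where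
  val U := (exists_connectionForm_val D U).choose
  compat U U' h := connectionForm_natural (Hom.id P) h (D.compat U U' h)
    (exists_connectionForm_val D U').choose_spec (exists_connectionForm_val D U).choose_spec

lemma formApply_connectionForm (D : P.AdConnection) (U : C.left.affineOpens)
    (s : P.adSections U) :
    formApply (lieAlg H) ((connectionForm D).val U) s.1 = connectionDiff D U s :=
  (exists_connectionForm_val D U).choose_spec s

lemma isConnectionForm_iff (D : P.AdConnection) (θ : P.Form (Module.End ℂ (lieAlg H))) :
    IsConnectionForm D θ ↔ θ = connectionForm D := by
  have h1 : IsConnectionForm D (connectionForm D) := fun U s => by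
    rw [formApply_connectionForm]
    exact (add_sub_cancel _ _).symm
  constructor
  · intro h
    refine Form.ext (funext fun U => ?_)
    refine endApply_ext_adSections (P := P) (U := U) (N := Ω[P.fn U⁄ℂ]) fun s => ?_
    exact add_left_cancel ((h U s).symm.trans (h1 U s))
  · rintro rfl
    exact h1

/-- The section `s`, its differential and the pullback of its covariant derivative are all
invariant, so the transformed form acts on `s` as the original one does; sections determine the
form. -/
lemma connectionForm_equivariant (D : P.AdConnection) (U : C.left.affineOpens)
    (g : H →ₐ[ℂ] ℂ) :
    TensorProduct.map (kmap (P.translate U g))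
      ((adjointEquiv g).conj : Module.End ℂ (lieAlg H) →ₗ[ℂ] Module.End ℂ (lieAlg H))
      ((connectionForm D).val U) = (connectionForm D).val U := by
  refine endApply_ext_adSections (P := P) (U := U) (N := Ω[P.fn U⁄ℂ]) fun s => ?_
  have h1 := map_kmap_formApply (P.translate U g) (adjointEquiv g) ((connectionForm D).val U) s.1
  rw [adjointEquiv_coe, s.2 g, formApply_connectionForm] at h1
  refine h1.symm.trans ?_
  refine Eq.trans ?_ (formApply_connectionForm D U s).symm
  change TensorProduct.map _ _ (P.pullAdForms U (D.nabla U s) - dSection (lieAlg H) s.1) =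
    P.pullAdForms U (D.nabla U s) - dSection (lieAlg H) s.1
  rw [map_sub, map_translate_pullAdForms, map_kmap_dSection, s.2 g]

/-- The pullback of the covariant derivative of `s` is horizontal, so the contraction sends `s` to
minus its derivative along the fundamental field, which is `[X, s]` by invariance. -/
lemma contractForm_connectionForm (D : P.AdConnection) (U : C.left.affineOpens) (X : lieAlg H) :
    contractForm (P.fn U) _ (P.fundamentalField U X) ((connectionForm D).val U) =
      1 ⊗ₜ LieAlgebra.ad ℂ (lieAlg H) X := by
  refine endApply_ext_adSections (P := P) (U := U) (N := P.fn U) fun s => ?_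
  rw [← contractForm_formApply, formApply_connectionForm, endApply_one_tmul]
  change contractForm (P.fn U) _ _
    (P.pullAdForms U (D.nabla U s) - dSection (lieAlg H) s.1) = _
  rw [map_sub, pullAdForms_eq, contractForm_pullTensor _ (fundamentalField_algebraMap U X),
    contractForm_dSection, zero_sub, neg_eq_iff_add_eq_zero]
  exact (P.isTorsor_coact U).field_add_ad_eq_zero s.1 s.2 X

/-- The connection on the principal bundle that is the projection of the connection form of a
connection on the adjoint bundle. -/
def projectConnection [LieAlgebra.IsKilling ℂ (lieAlg H)]
    {p : Module.End ℂ (lieAlg H) →ₗ[ℂ] lieAlg H}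
    (hp : IsTraceOrthogonalProjection (lieAlg H) p) (D : P.AdConnection) : P.Connection where
  toForm := (connectionForm D).map p
  equivariant U g := by
    change TensorProduct.map (kmap (P.translate U g)) (adjoint H g)
      (p.lTensor _ ((connectionForm D).val U)) = p.lTensor _ ((connectionForm D).val U)
    refine Eq.trans ?_ (congrArg (p.lTensor _) (connectionForm_equivariant D U g))
    generalize (connectionForm D).val U = θ
    induction θ with
    | zero => simp
    | add x y hx hy => simp only [map_add, hx, hy]
    | tmul τ T =>
      simp only [LinearMap.lTensor_tmul, TensorProduct.map_tmul]
      congr 1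
      -- The projection commutes with the automorphism `Ad(g)`.
      exact (hp.conj (adjointEquiv g) (adjoint_lie g) T).symm
  vertical U X := by
    change contractForm (P.fn U) _ _ (p.lTensor _ _) = _
    rw [contractForm_lTensor, contractForm_connectionForm, LinearMap.lTensor_tmul, hp.1]

/-! ### The induced connection on the adjoint bundle -/

variable [Smooth (str C)]

lemma pullAdForms_injective (U : C.left.affineOpens) : Function.Injective (P.pullAdForms U) := by
  have := projective_kaehler C U
  have h1 := (P.isTorsor_coact U).pullTensor_subtype_injective (P.adSections U)
  intro ζ ζ' h
  rw [pullAdForms_eq, pullAdForms_eq] at h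
  exact h1 h

/-- The form on the right descends: contracted with the fundamental field of `X` it is `X s + [X, s]
= 0`, and it is invariant because `s` and `ω` are. -/
lemma exists_pullAdForms_eq (ω : P.Connection) (U : C.left.affineOpens) (s : P.adSections U) :
    ∃ ζ, P.pullAdForms U ζ =
      dSection (lieAlg H) s.1 + formBracket (lieAlg H) (ω.val U) s.1 := by
  have := projective_kaehler C U
  obtain ⟨m, hm⟩ := (P.isTorsor_coact U).exists_form_of_horizontal (M := P.adSections U)
    (fun _ => Iff.rfl) (dSection (lieAlg H) s.1 + formBracket (lieAlg H) (ω.val U) s.1)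
    (fun X => by
      have h1 : contractForm (P.fn U) _ (P.fundamentalField U X) (ω.val U) = 1 ⊗ₜ X :=
        ω.vertical U X
      change contractForm (P.fn U) _ (P.fundamentalField U X) _ = 0
      rw [map_add, contractForm_dSection, formBracket, LinearMap.comp_apply,
        contractForm_formApply, contractForm_lTensor, h1, LinearMap.lTensor_tmul]
      refine (congrArg (fun x => _ + x) (endApply_one_tmul _ _)).trans ?_
      exact (P.isTorsor_coact U).field_add_ad_eq_zero s.1 s.2 X)
    (fun g => by
      have h1 := map_kmap_formApply (P.translate U g) (adjointEquiv g)
        ((LieAlgebra.ad ℂ (lieAlg H) : lieAlg H →ₗ[ℂ] _).lTensor _ (ω.val U)) s.1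
      rw [map_conj_lTensor_ad, ω.equivariant U g, adjointEquiv_coe, s.2 g] at h1
      change TensorProduct.map (kmap (P.translate U g)) (adjoint H g) _ = _
      rw [map_add, map_kmap_dSection, s.2 g]
      exact congrArg (fun x => _ + x) h1)
  exact ⟨m, (pullAdForms_eq U m).trans hm⟩

/-- The form `ds + [ω, s]` on the base. -/
def inducedNabla (ω : P.Connection) (U : C.left.affineOpens) (s : P.adSections U) : P.AdForms U :=
  (exists_pullAdForms_eq ω U s).choose

lemma pullAdForms_inducedNabla (ω : P.Connection) (U : C.left.affineOpens) (s : P.adSections U) :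
    P.pullAdForms U (inducedNabla ω U s) =
      dSection (lieAlg H) s.1 + formBracket (lieAlg H) (ω.val U) s.1 :=
  (exists_pullAdForms_eq ω U s).choose_spec

/-- The axioms of a connection are checked after pullback to the total space, which is injective. -/
lemma inducedNabla_add (ω : P.Connection) (U : C.left.affineOpens) (s t : P.adSections U) :
    inducedNabla ω U (s + t) = inducedNabla ω U s + inducedNabla ω U t := by
  refine pullAdForms_injective U ?_
  rw [map_add, pullAdForms_inducedNabla, pullAdForms_inducedNabla,
    pullAdForms_inducedNabla, Submodule.coe_add, map_add, map_add]
  exact add_add_add_comm _ _ _ _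

lemma inducedNabla_smul (ω : P.Connection) (U : C.left.affineOpens) (c : ℂ) (s : P.adSections U) :
    inducedNabla ω U (c • s) = c • inducedNabla ω U s := by
  refine pullAdForms_injective U ?_
  have h2 : (c • s).1 = c • s.1 := rfl
  rw [pullAdForms_smul_complex, pullAdForms_inducedNabla, pullAdForms_inducedNabla, h2, map_smul,
    map_smul]
  exact (smul_add _ _ _).symm

lemma inducedNabla_leibniz (ω : P.Connection) (U : C.left.affineOpens) (a : Γ(C.left, U.1))
    (s : P.adSections U) : inducedNabla ω U (a • s) =
      a • inducedNabla ω U s + KaehlerDifferential.D ℂ Γ(C.left, U.1) a ⊗ₜ s := by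
  refine pullAdForms_injective U ?_
  have h1 : dSection (lieAlg H) (a • s).1 = a • dSection (lieAlg H) s.1 +
      formMul (lieAlg H) (KaehlerDifferential.D ℂ (P.fn U) (algebraMap _ (P.fn U) a)) s.1 :=
    dSection_smul a s.1
  have h2 : formBracket (lieAlg H) (ω.val U) (a • s).1 =
      a • formBracket (lieAlg H) (ω.val U) s.1 := formBracket_smul_right (ω.val U) a s.1
  rw [map_add, pullAdForms_smul, pullAdForms_inducedNabla, pullAdForms_inducedNabla,
    pullAdForms_tmul, kmap_D, h1, h2, smul_add]
  exact add_right_comm _ _ _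

lemma inducedNabla_compat (ω : P.Connection) (U V : C.left.affineOpens) (h : V ≤ U)
    (s : P.adSections U) : (Hom.id P).adFormsComap h (inducedNabla ω U s) =
      inducedNabla ω V ((Hom.id P).adComap h s) := by
  refine pullAdForms_injective V ?_
  rw [pullAdForms_adFormsComap, pullAdForms_inducedNabla, pullAdForms_inducedNabla, map_add,
    ← ω.compat U V h]
  refine congrArg₂ (· + ·) (rTensor_kmap_dSection _ s.1)
    (rTensor_kmap_formBracket _ (ω.val U) s.1)

/-- The connection on the adjoint bundle induced by a connection on the principal bundle. -/
def inducedConnection (ω : P.Connection) : P.AdConnection where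
  nabla U :=
    { toFun := inducedNabla ω U
      map_add' := inducedNabla_add ω U
      map_smul' := inducedNabla_smul ω U }
  leibniz := inducedNabla_leibniz ω
  compat := inducedNabla_compat ω

lemma isInduced_iff (ω : P.Connection) (D : P.AdConnection) :
    IsInduced ω D ↔ D = inducedConnection ω := by
  have h1 : IsInduced ω (inducedConnection ω) := pullAdForms_inducedNabla ω
  constructor
  · intro h
    refine AdConnection.ext (funext fun U => LinearMap.ext fun s => ?_)
    exact pullAdForms_injective U ((h U s).trans (h1 U s).symm)
  · rintro rfl
    exact h1

/-- The defining formula `ds + [ω, s]` says that `ad ∘ ω` is a connection form, so by uniqueness it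
is the connection form, and `p ∘ ad = id`. -/
lemma projectConnection_inducedConnection [LieAlgebra.IsKilling ℂ (lieAlg H)]
    {p : Module.End ℂ (lieAlg H) →ₗ[ℂ] lieAlg H}
    (hp : IsTraceOrthogonalProjection (lieAlg H) p) (ω : P.Connection) :
    projectConnection hp (inducedConnection ω) = ω := by
  have h1 : IsConnectionForm (inducedConnection ω) (ω.toForm.map
      (LieAlgebra.ad ℂ (lieAlg H) : lieAlg H →ₗ[ℂ] Module.End ℂ (lieAlg H))) :=
    pullAdForms_inducedNabla ω
  rw [isConnectionForm_iff] at h1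
  refine Connection.ext (funext fun U => ?_)
  change p.lTensor _ ((connectionForm (inducedConnection ω)).val U) = _
  rw [← h1]
  change p.lTensor _ (LinearMap.lTensor _ _ _) = _
  rw [← LinearMap.lTensor_comp_apply]
  have h2 : p ∘ₗ (LieAlgebra.ad ℂ (lieAlg H) : lieAlg H →ₗ[ℂ] Module.End ℂ (lieAlg H)) =
      LinearMap.id := LinearMap.ext hp.1
  rw [h2, LinearMap.lTensor_id, LinearMap.id_apply]

end PrincipalBundle

/-! ### Naturality of the projected connection -/

namespace PrincipalBundle

variable {H : Type} [CommRing H] [HopfAlgebra ℂ H] [Algebra.FiniteType ℂ H] [IsReduced H]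
  {C : CScheme} {P Q : PrincipalBundle H C}

/-- Connection forms are natural, and `p` acts on the values while pullback acts on the forms, so
the two commute. -/
lemma isFormPullback_projectConnection [LieAlgebra.IsKilling ℂ (lieAlg H)]
    {p : Module.End ℂ (lieAlg H) →ₗ[ℂ] lieAlg H}
    (hp : IsTraceOrthogonalProjection (lieAlg H) p) (f : Hom P Q) {D : P.AdConnection}
    {D' : Q.AdConnection} (hD : f.IsAdPullback D D') :
    f.IsFormPullback (projectConnection hp D).toForm (projectConnection hp D').toForm := by
  intro U
  have h1 := connectionForm_natural f (le_refl U) (fun s => (hD U s).symm)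
    (formApply_connectionForm D U) (formApply_connectionForm D' U)
  change p.lTensor _ ((connectionForm D).val U) =
    (kmap (f.comap (le_refl U))).rTensor _ (p.lTensor _ ((connectionForm D').val U))
  rw [← h1, ← LinearMap.comp_apply, ← LinearMap.comp_apply, LinearMap.rTensor_comp_lTensor,
    LinearMap.lTensor_comp_rTensor]

end PrincipalBundle

end

end PrincipalConnections

/-- `C` is a smooth projective curve over `ℂ` and `G = Spec H` is a complex affine algebraic group with
simple Lie algebra. -/
theorem mainTheorem7
    (C : PrincipalConnections.CScheme) [AlgebraicGeometry.IsIntegral C.left]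
    [AlgebraicGeometry.IsProper (PrincipalConnections.str C)]
    [AlgebraicGeometry.SmoothOfRelativeDimension 1 (PrincipalConnections.str C)]
    (H : Type) [CommRing H] [HopfAlgebra ℂ H] [Algebra.FiniteType ℂ H] [IsReduced H]
    [LieAlgebra.IsSimple ℂ (PrincipalConnections.lieAlg H)] :
    (∃! p : Module.End ℂ (PrincipalConnections.lieAlg H) →ₗ[ℂ] PrincipalConnections.lieAlg H,
      PrincipalConnections.IsTraceOrthogonalProjection (PrincipalConnections.lieAlg H) p) ∧
    ∀ p : Module.End ℂ (PrincipalConnections.lieAlg H) →ₗ[ℂ] PrincipalConnections.lieAlg H,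
      PrincipalConnections.IsTraceOrthogonalProjection (PrincipalConnections.lieAlg H) p →
      ∃ (Φ₀ : ∀ E : PrincipalConnections.PrincipalBundle H C, E.Connection → E.AdConnection)
        (Φ : ∀ E : PrincipalConnections.PrincipalBundle H C, E.AdConnection → E.Connection),
        -- `Φ₀` sends a connection to the induced connection on the adjoint bundle
        (∀ (E : PrincipalConnections.PrincipalBundle H C) (ω : E.Connection)
          (D : E.AdConnection),
          PrincipalConnections.PrincipalBundle.IsInduced ω D ↔ D = Φ₀ E ω) ∧
        -- `Φ` sends a connection on the adjoint bundle to the projection of its connection form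
        (∀ (E : PrincipalConnections.PrincipalBundle H C) (D : E.AdConnection),
          ∃ θ : E.Form (Module.End ℂ (PrincipalConnections.lieAlg H)),
            (∀ θ₁ : E.Form (Module.End ℂ (PrincipalConnections.lieAlg H)),
              PrincipalConnections.PrincipalBundle.IsConnectionForm D θ₁ ↔ θ₁ = θ) ∧
            (Φ E D).toForm = θ.map p) ∧
        -- naturality of `Φ`
        (∀ (E F : PrincipalConnections.PrincipalBundle H C) (f : E.Hom F)
          (D : E.AdConnection) (D₁ : F.AdConnection), f.IsAdPullback D D₁ →
          f.IsFormPullback (Φ E D).toForm (Φ F D₁).toForm) ∧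
        ∀ (E : PrincipalConnections.PrincipalBundle H C) (ω : E.Connection),
          Φ E (Φ₀ E ω) = ω := by
  have : AlgebraicGeometry.Smooth (PrincipalConnections.str C) :=
    AlgebraicGeometry.SmoothOfRelativeDimension.smooth (n := 1) (PrincipalConnections.str C)
  -- Cartan's criterion: a simple Lie algebra has trivial radical, so in characteristic zero its
  -- Killing form is nondegenerate.
  have : LieAlgebra.IsKilling ℂ (PrincipalConnections.lieAlg H) :=
    LieAlgebra.HasTrivialRadical.instIsKilling _ _
  refine ⟨PrincipalConnections.existsUnique_projection, fun p hp =>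
    ⟨fun _ ω => PrincipalConnections.PrincipalBundle.inducedConnection ω,
      fun _ D => PrincipalConnections.PrincipalBundle.projectConnection hp D,
      fun _ => PrincipalConnections.PrincipalBundle.isInduced_iff,
      fun _ D => ⟨_, PrincipalConnections.PrincipalBundle.isConnectionForm_iff D, rfl⟩,
      fun _ _ f _ _ =>
        PrincipalConnections.PrincipalBundle.isFormPullback_projectConnection hp f,
      fun _ => PrincipalConnections.PrincipalBundle.projectConnection_inducedConnection hp⟩⟩
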